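/- **Setting.** Let $n,p\ge 1$ be integers. A *parafermion Fock space of order $p$* is a complex inner product space $W$ with everywhere defined linear operators $f_j^{\pm}$ ($1\le j\le n$) and a vector $|0\rangle\in W$ such that, for all $j,k,l$ and all $\xi,\eta,\epsilon\in\{+,-\}$ (read as $\pm1$ in algebraic expressions), $$[[f_j^{\xi},f_k^{\eta}],f_l^{\epsilon}]=\tfrac12(\epsilon-\eta)^2\delta_{kl}f_j^{\xi}-\tfrac12(\epsilon-\xi)^2\delta_{jl}f_k^{\eta},$$ $$\langle 0|0\rangle=1,\quad f_j^-|0\rangle=0,\quad (f_j^{\pm})^\dagger=f_j^{\mp},\quad [f_j^-,f_k^+]|0\rangle=p\,\delta_{jk}|0\rangle,$$ and $W$ is irreducible: its only closed subspaces invariant under all $f_j^\pm$ are $0$ and $W$. Let $\mathfrak{so}(2n+1)$ be the complex Lie algebra of matrices $\begin{pmatrix}a&b&c\\ d&-a^t&e\\ -e^t&-c^t&0\end{pmatrix}$ with $a,b,d$ of size $n\times n$, $b,d$ antisymmetric, and $c,e$ of size $n\times1$. Let $e_{ij}$ be the matrix units, $h_j=e_{jj}-e_{n+j,n+j}$, and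 let the positive roots be $\epsilon_j$, and $\epsilon_j\pm\epsilon_k$ for $j<k$, with $(\epsilon_j)$ the basis dual to $(h_j)$. A *Gelfand–Zetlin pattern* is an array $m=(m_{ij})_{1\le i\le j\le n}$ of nonnegative integers with $m_{i,j+1}\ge m_{ij}\ge m_{i+1,j+1}$ for $1\le i\le j\le n-1$. Put $l_{ij}=m_{ij}-i$; $\mathcal E_j=1$ if $j$ is even and $0$ otherwise; $\mathcal O_j=1-\mathcal E_j$; $S(k,l)=1$ if $k\le l$ and $-1$ if $k>l$. For $k$ even put $$G_k(m_{1n},\dots,m_{nn})=\left(-\frac{(\mathcal E_n(m_{kn}+n-k)+1)\prod_{1\le j\le n,\,j\ne k}(m_{kn}-m_{jn}-k+j)}{\prod_{1\le j\le\lfloor n/2\rfloor,\,j\ne k/2}(m_{kn}-m_{2j,n}-k+2j)(m_{kn}-m_{2j,n}-k+2j+1)}\right)^{1/2},$$ and for $k$ odd put $$G_k(m_{1n},\dots,m_{nn})=\left(\frac{(p-m_{kn}+k-1)(\mathcal O_n(m_{kn}+n-k)+1)\prod_{1\le j\le n,\,j\ne k}(m_{kn}-m_{jn}-k+j)}{\prod_{1\le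 j\le\lceil n/2\rceil,\,j\ne (k+1)/2}(m_{kn}-m_{2j-1,n}-k+2j-1)(m_{kn}-m_{2j-1,n}-k+2j)}\right)^{1/2}.$$ **Theorem.** A parafermion Fock space of order $p$, complete as an inner product space, exists. Let $W=W(p)$ be any parafermion Fock space of order $p$. Then the following hold. 1. The vectors killed by all $f_j^-$ are exactly the multiples of $|0\rangle$. 2. $W(p)$ is finite-dimensional and $$\dim W(p)=\prod_{1\le j\le k\le n}\frac{p+1+2n-j-k}{1+2n-j-k}=\prod_{i=0}^{\lfloor (n-1)/2\rfloor}\binom{p+2n-2i-1}{2n-4i-1}\Big/\binom{2n-2i-1}{2n-4i-1}.$$ 3. There are a Lie algebra representation of $\mathfrak{so}(2n+1)$ on $W(p)$, in which $\sqrt2(e_{j,2n+1}-e_{2n+1,n+j})$ acts as $f_j^+$ and $\sqrt2(e_{2n+1,j}-e_{n+j,2n+1})$ acts as $f_j^-$, and an orthonormal basis of $W(p)$, whose vectors $|m)$ are indexed by the Gelfand–Zetlin patterns $m$ with $m_{1n}\le p$, such that (a)–(d) hold. (a) The representation is irreducible and has a highest weight vector of weight $(\frac p2,\dots,\frac p2)$.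 The basis vector of the zero pattern is $|0\rangle$. (b) For $1\le k\le n$, $\;h_k|m)=\bigl(-\tfrac p2+\sum_{j=1}^k m_{jk}-\sum_{j=1}^{k-1}m_{j,k-1}\bigr)|m)$. In (c) and (d), a subscript $\pm i,j$ on $|m)$ means the replacement $m_{ij}\to m_{ij}\pm1$, and a term is omitted if the resulting array is not a Gelfand–Zetlin pattern with $m_{1n}\le p$. (c) $$f_n^+|m)=\sum_{i=1}^n\left(\frac{\prod_{k=1}^{n-1}(l_{k,n-1}-l_{in}-1)}{\prod_{k\ne i=1}^{n}(l_{kn}-l_{in})}\right)^{1/2}G_i(m_{1n},\dots,m_{nn})\,|m)_{+i,n},$$ $$f_n^-|m)=\sum_{i=1}^n\left(\frac{\prod_{k=1}^{n-1}(l_{k,n-1}-l_{in})}{\prod_{k\ne i=1}^{n}(l_{kn}-l_{in}+1)}\right)^{1/2}G_i(m_{1n},\dots,m_{in}-1,\dots,m_{nn})\,|m)_{-i,n}.$$ (d) For $1\le j\le n$, $$f_j^+|m)=\sum_{i_n=1}^n\cdots\sum_{i_j=1}^j S(i_n,i_{n-1})\cdots S(i_{j+1},i_j)\left(\frac{\prod_{k=1}^{j-1}(l_{k,j-1}-l_{i_j,j}-1)}{\prod_{k\ne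 i_j=1}^{j}(l_{kj}-l_{i_j,j})}\right)^{1/2}$$ $$\times\prod_{r=1}^{n-j}\left(\frac{\prod_{k\ne i_{n-r}=1}^{n-r}(l_{k,n-r}-l_{i_{n-r+1},n-r+1}-1)\prod_{k\ne i_{n-r+1}=1}^{n-r+1}(l_{k,n-r+1}-l_{i_{n-r},n-r})}{\prod_{k\ne i_{n-r+1}=1}^{n-r+1}(l_{k,n-r+1}-l_{i_{n-r+1},n-r+1})\prod_{k\ne i_{n-r}=1}^{n-r}(l_{k,n-r}-l_{i_{n-r},n-r}-1)}\right)^{1/2}$$ $$\times\, G_{i_n}(m_{1n},\dots,m_{nn})\,|m)_{+i_n,n;\dots;+i_j,j},$$ $$f_j^-|m)=\sum_{i_n=1}^n\cdots\sum_{i_j=1}^j S(i_n,i_{n-1})\cdots S(i_{j+1},i_j)\left(\frac{\prod_{k=1}^{j-1}(l_{k,j-1}-l_{i_j,j})}{\prod_{k\ne i_j=1}^{j}(l_{kj}-l_{i_j,j}+1)}\right)^{1/2}$$ $$\times\prod_{r=1}^{n-j}\left(\frac{\prod_{k\ne i_{n-r}=1}^{n-r}(l_{k,n-r}-l_{i_{n-r+1},n-r+1})\prod_{k\ne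 i_{n-r+1}=1}^{n-r+1}(l_{k,n-r+1}-l_{i_{n-r},n-r}+1)}{\prod_{k\ne i_{n-r+1}=1}^{n-r+1}(l_{k,n-r+1}-l_{i_{n-r+1},n-r+1}+1)\prod_{k\ne i_{n-r}=1}^{n-r}(l_{k,n-r}-l_{i_{n-r},n-r})}\right)^{1/2}$$ $$\times\, G_{i_n}(m_{1n},\dots,m_{i_n,n}-1,\dots,m_{nn})\,|m)_{-i_n,n;\dots;-i_j,j}.$$ Here $\prod_{k\ne i=1}^{n}$ is the product over $1\le k\le n$ with $k\ne i$. -/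

import Mathlib

attribute [local instance 100] LieRing.ofAssociativeRing

namespace Parafermion

/- ### Gelfand–Zetlin patterns

A triangular array `m i j` (`1 ≤ i ≤ j ≤ n`, row index `j`, the top row being `j = n`) is stored as a
function on `ℕ × ℕ`, with `1`-based indices, that vanishes outside the triangle. -/

/-- `m` is a Gelfand–Zetlin pattern with `n` rows, nonnegative integer entries, and `m 1 n ≤ p`. -/
structure IsGZPattern (n p : ℕ) (m : ℕ → ℕ → ℤ) : Prop where
  supp : ∀ i j, ¬ (1 ≤ i ∧ i ≤ j ∧ j ≤ n) → m i j = 0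
  nonneg : ∀ i j, 0 ≤ m i j
  between : ∀ i j, 1 ≤ i → i ≤ j → j + 1 ≤ n → m (i + 1) (j + 1) ≤ m i j ∧ m i j ≤ m i (j + 1)
  top_le : m 1 n ≤ p

/-- The set of Gelfand–Zetlin patterns with `n` rows and top row at most `p`. -/
def GZPattern (n p : ℕ) : Type := {m : ℕ → ℕ → ℤ // IsGZPattern n p m}

theorem IsGZPattern.le {n p : ℕ} {m : ℕ → ℕ → ℤ} (h : IsGZPattern n p m) (i j : ℕ) :
    m i j ≤ p := by
  by_cases hij : 1 ≤ i ∧ i ≤ j ∧ j ≤ n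
  · obtain ⟨h1, h2, h3⟩ := hij
    have up : ∀ k i j, 1 ≤ i → i ≤ j → j + k = n → m i j ≤ m i n := by
      intro k
      induction k with
      | zero => intro i j _ _ hk; simp at hk; rw [hk]
      | succ k ih =>
        intro i j hi hj hk
        exact ((h.between i j hi hj (by omega)).2).trans (ih i (j + 1) hi (by omega) (by omega))
    have left : ∀ i, 1 ≤ i → i ≤ n → m i n ≤ p := by
      intro i hi
      induction i, hi using Nat.le_induction with
      | base => intro _; exact h.top_le
      | succ i hi ih =>
        intro hin
        obtain ⟨q, rfl⟩ : ∃ q, n = q + 1 := ⟨n - 1, by omega⟩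
        have b := h.between i q hi (by omega) le_rfl
        exact b.1.trans (b.2.trans (ih (by omega)))
    exact (up (n - j) i j h1 h2 (by omega)).trans (left i h1 (by omega))
  · rw [h.supp i j hij]; positivity

instance (n p : ℕ) : Finite (GZPattern n p) := by
  let F : GZPattern n p → (Fin (n + 1) → Fin (n + 1) → Set.Icc (0 : ℤ) p) :=
    fun m i j => ⟨m.1 i j, m.2.nonneg _ _, m.2.le _ _⟩
  apply Finite.of_injective F
  intro m m' hF
  apply Subtype.ext
  funext i j
  by_cases hij : 1 ≤ i ∧ i ≤ j ∧ j ≤ n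
  · have := congrFun (congrFun hF ⟨i, by omega⟩) ⟨j, by omega⟩
    exact congrArg Subtype.val this
  · rw [m.2.supp i j hij, m'.2.supp i j hij]

noncomputable instance (n p : ℕ) : Fintype (GZPattern n p) := Fintype.ofFinite _

/-- The pattern all of whose entries are zero. -/
def GZPattern.zero (n p : ℕ) : GZPattern n p :=
  ⟨fun _ _ => 0, ⟨by simp, by simp, by simp, by simp⟩⟩

open Classical in
/-- The vector `|m)` attached to an arbitrary array `m`: the basis vector `e m` if `m` is a pattern
with top row at most `p`, and `0` otherwise. -/
noncomputable def ket {n p : ℕ} {W : Type*} [Zero W] (e : GZPattern n p → W)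
    (m : ℕ → ℕ → ℤ) : W :=
  if h : IsGZPattern n p m then e ⟨m, h⟩ else 0

/-- The array obtained from `m` by the single replacement `m i j → m i j + s`. -/
def shiftOne (m : ℕ → ℕ → ℤ) (s : ℤ) (i j : ℕ) : ℕ → ℕ → ℤ :=
  fun a b => if a = i ∧ b = j then m a b + s else m a b

/-- Index tuples `(i_n, i_{n-1}, …, i_j)` with `1 ≤ i_a ≤ a` for `j ≤ a ≤ n`. -/
abbrev RowPath (j n : ℕ) : Type := ∀ a : Finset.Icc j n, Finset.Icc 1 (a : ℕ)

/-- The entry `i_a` of an index tuple (with the irrelevant value `0` unless `j ≤ a ≤ n`). -/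
def RowPath.idx {j n : ℕ} (i : RowPath j n) (a : ℕ) : ℕ :=
  if h : a ∈ Finset.Icc j n then (i ⟨a, h⟩ : ℕ) else 0

/-- The array obtained from `m` by the replacements `m i_a a → m i_a a + s`, `a = n, n - 1, …, j`. -/
def shiftPath {j n : ℕ} (m : ℕ → ℕ → ℤ) (s : ℤ) (i : RowPath j n) : ℕ → ℕ → ℤ :=
  fun a b => if b ∈ Finset.Icc j n ∧ a = i.idx b then m a b + s else m a b

/-- `l_{ij} = m_{ij} - i`. -/
def l (m : ℕ → ℕ → ℤ) (i j : ℕ) : ℝ := (m i j : ℝ) - i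

/-- `𝓔_j = 1` if `j` is even, and `0` otherwise. -/
def evenInd (j : ℕ) : ℝ := if Even j then 1 else 0

/-- `𝓞_j = 1` if `j` is odd, and `0` otherwise. -/
def oddInd (j : ℕ) : ℝ := if Odd j then 1 else 0

/-- The sign `S(k, l)`. -/
def S (k l : ℕ) : ℝ := if k ≤ l then 1 else -1

/-- The reduced matrix element `G_k(r_1, …, r_n)`. -/
noncomputable def G (n p k : ℕ) (r : ℕ → ℤ) : ℝ :=
  if Even k then
    √(-(((evenInd n * (r k + n - k) + 1) *
          ∏ j ∈ (Finset.Icc 1 n).erase k, ((r k : ℝ) - r j - k + j)) /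
        ∏ j ∈ (Finset.Icc 1 (n / 2)).erase (k / 2),
          (((r k : ℝ) - r (2 * j) - k + 2 * j) * ((r k : ℝ) - r (2 * j) - k + 2 * j + 1))))
  else
    √((((p : ℝ) - r k + k - 1) * (oddInd n * (r k + n - k) + 1) *
          ∏ j ∈ (Finset.Icc 1 n).erase k, ((r k : ℝ) - r j - k + j)) /
        ∏ j ∈ (Finset.Icc 1 ((n + 1) / 2)).erase ((k + 1) / 2),
          (((r k : ℝ) - r (2 * j - 1) - k + 2 * j - 1) * ((r k : ℝ) - r (2 * j - 1) - k + 2 * j)))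

/-- The coefficient of `|m)_{+i,n}` in `f_n^+ |m)`. -/
noncomputable def raiseLastCoeff (n p : ℕ) (m : ℕ → ℕ → ℤ) (i : ℕ) : ℝ :=
  √((∏ k ∈ Finset.Icc 1 (n - 1), (l m k (n - 1) - l m i n - 1)) /
      ∏ k ∈ (Finset.Icc 1 n).erase i, (l m k n - l m i n)) *
    G n p i (fun a => m a n)

/-- The coefficient of `|m)_{-i,n}` in `f_n^- |m)`. -/
noncomputable def lowerLastCoeff (n p : ℕ) (m : ℕ → ℕ → ℤ) (i : ℕ) : ℝ :=
  √((∏ k ∈ Finset.Icc 1 (n - 1), (l m k (n - 1) - l m i n)) /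
      ∏ k ∈ (Finset.Icc 1 n).erase i, (l m k n - l m i n + 1)) *
    G n p i (Function.update (fun a => m a n) i (m i n - 1))

/-- The coefficient of `|m)_{+i_n,n;…;+i_j,j}` in `f_j^+ |m)`. The product over `1 ≤ r ≤ n - j` is
written with the row index `a = n - r`. -/
noncomputable def raiseCoeff {j n : ℕ} (p : ℕ) (m : ℕ → ℕ → ℤ) (i : RowPath j n) : ℝ :=
  (∏ a ∈ Finset.Ico j n, S (i.idx (a + 1)) (i.idx a)) *
    √((∏ k ∈ Finset.Icc 1 (j - 1), (l m k (j - 1) - l m (i.idx j) j - 1)) /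
        ∏ k ∈ (Finset.Icc 1 j).erase (i.idx j), (l m k j - l m (i.idx j) j)) *
    (∏ a ∈ Finset.Ico j n,
      √(((∏ k ∈ (Finset.Icc 1 a).erase (i.idx a),
              (l m k a - l m (i.idx (a + 1)) (a + 1) - 1)) *
            ∏ k ∈ (Finset.Icc 1 (a + 1)).erase (i.idx (a + 1)),
              (l m k (a + 1) - l m (i.idx a) a)) /
          ((∏ k ∈ (Finset.Icc 1 (a + 1)).erase (i.idx (a + 1)),
              (l m k (a + 1) - l m (i.idx (a + 1)) (a + 1))) *
            ∏ k ∈ (Finset.Icc 1 a).erase (i.idx a),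
              (l m k a - l m (i.idx a) a - 1)))) *
    G n p (i.idx n) (fun a => m a n)

/-- The coefficient of `|m)_{-i_n,n;…;-i_j,j}` in `f_j^- |m)`. -/
noncomputable def lowerCoeff {j n : ℕ} (p : ℕ) (m : ℕ → ℕ → ℤ) (i : RowPath j n) : ℝ :=
  (∏ a ∈ Finset.Ico j n, S (i.idx (a + 1)) (i.idx a)) *
    √((∏ k ∈ Finset.Icc 1 (j - 1), (l m k (j - 1) - l m (i.idx j) j)) /
        ∏ k ∈ (Finset.Icc 1 j).erase (i.idx j), (l m k j - l m (i.idx j) j + 1)) *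
    (∏ a ∈ Finset.Ico j n,
      √(((∏ k ∈ (Finset.Icc 1 a).erase (i.idx a),
              (l m k a - l m (i.idx (a + 1)) (a + 1))) *
            ∏ k ∈ (Finset.Icc 1 (a + 1)).erase (i.idx (a + 1)),
              (l m k (a + 1) - l m (i.idx a) a + 1)) /
          ((∏ k ∈ (Finset.Icc 1 (a + 1)).erase (i.idx (a + 1)),
              (l m k (a + 1) - l m (i.idx (a + 1)) (a + 1) + 1)) *
            ∏ k ∈ (Finset.Icc 1 a).erase (i.idx a),
              (l m k a - l m (i.idx a) a)))) *
    G n p (i.idx n) (Function.update (fun a => m a n) (i.idx n) (m (i.idx n) n - 1))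

/- ### The parafermion Fock space -/

/-- The operators `f j 1 = f_{j+1}^+` and `f j (-1) = f_{j+1}^-` (`j = 0, …, n - 1`) on the inner
product space `W`, with vacuum vector `vac`, form a parafermion Fock space of order `p`.
Irreducibility is topological (no proper nonzero closed invariant subspace), as is usual on a Hilbert
space; completeness of `W` is not required. -/
structure IsFockSpace (n p : ℕ) (W : Type*) [NormedAddCommGroup W] [InnerProductSpace ℂ W]
    (f : Fin n → ℤˣ → Module.End ℂ W) (vac : W) : Prop where
  triple : ∀ (j k l : Fin n) (ξ η ε : ℤˣ),
    ⁅⁅f j ξ, f k η⁆, f l ε⁆ =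
      ((1 / 2 : ℂ) * (((ε : ℤ) : ℂ) - ((η : ℤ) : ℂ)) ^ 2 * (if k = l then 1 else 0)) • f j ξ -
      ((1 / 2 : ℂ) * (((ε : ℤ) : ℂ) - ((ξ : ℤ) : ℂ)) ^ 2 * (if j = l then 1 else 0)) • f k η
  vac_norm : inner ℂ vac vac = 1
  annihilate : ∀ j, f j (-1) vac = 0
  adjoint : ∀ (j : Fin n) (ξ : ℤˣ) (u v : W), inner ℂ (f j ξ u) v = inner ℂ u (f j (-ξ) v)
  order : ∀ j k, ⁅f j (-1), f k 1⁆ vac = ((p : ℂ) * (if j = k then 1 else 0)) • vac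
  irreducible : ∀ U : Submodule ℂ W, IsClosed (U : Set W) →
    (∀ j ξ, ∀ u ∈ U, f j ξ u ∈ U) → U = ⊥ ∨ U = ⊤

/- ### The Lie algebra `so(2n+1)`

The index set `{1, …, 2n+1}` is `(Fin n ⊕ Fin n) ⊕ Unit`. -/

/-- The row and column indices `1, …, 2n+1` of the matrices in `so(2n+1)`. -/
abbrev SoIdx (n : ℕ) : Type := (Fin n ⊕ Fin n) ⊕ Unit

/-- The index `j` (for `j = 1, …, n`). -/
abbrev lo {n : ℕ} (j : Fin n) : SoIdx n := Sum.inl (Sum.inl j)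

/-- The index `n + j` (for `j = 1, …, n`). -/
abbrev hi {n : ℕ} (j : Fin n) : SoIdx n := Sum.inl (Sum.inr j)

/-- The index `2n + 1`. -/
abbrev mid {n : ℕ} : SoIdx n := Sum.inr ()

/-- The symmetric bilinear form preserved by `so(2n+1)`. -/
def soForm (n : ℕ) : Matrix (SoIdx n) (SoIdx n) ℂ :=
  Matrix.fromBlocks (Matrix.fromBlocks 0 1 1 0) 0 0 1

/-- `so(2n+1)` as the Lie algebra of all `X` with `Xᵀ J + J X = 0`; see `mem_so_iff` for the block
form of its elements. -/
def so (n : ℕ) : LieSubalgebra ℂ (Matrix (SoIdx n) (SoIdx n) ℂ) :=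
  skewAdjointMatricesLieSubalgebra (soForm n)

/-- The involution `j ↔ n + j`, `2n + 1 ↔ 2n + 1` of the index set. -/
def dual {n : ℕ} : SoIdx n → SoIdx n
  | Sum.inl (Sum.inl j) => hi j
  | Sum.inl (Sum.inr j) => lo j
  | Sum.inr _ => mid

theorem mem_so_iff_entries {n : ℕ} (X : Matrix (SoIdx n) (SoIdx n) ℂ) :
    X ∈ so n ↔ ∀ i j, X (dual j) i = -X (dual i) j := by
  have key : X ∈ so n ↔ X.transpose * soForm n = soForm n * (-X) := by
    unfold so
    rw [mem_skewAdjointMatricesLieSubalgebra, mem_skewAdjointMatricesSubmodule]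
    rfl
  have hl : ∀ i j, (X.transpose * soForm n) i j = X (dual j) i := by
    intro i j
    rcases j with (j | j) | j <;>
      simp [soForm, Matrix.mul_apply, Fintype.sum_sum_type, Matrix.one_apply, dual]
  have hr : ∀ i j, (soForm n * (-X)) i j = -X (dual i) j := by
    intro i j
    rcases i with (i | i) | i <;>
      simp [soForm, Matrix.mul_apply, Fintype.sum_sum_type, Matrix.one_apply, dual]
  rw [key]
  constructor
  · intro h i j
    rw [← hl, ← hr, h]
  · intro h
    ext i j
    rw [hl, hr, h]

/-- The elements of `so(2n+1)` in block form. -/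
theorem mem_so_iff {n : ℕ} (X : Matrix (SoIdx n) (SoIdx n) ℂ) :
    X ∈ so n ↔ ∃ (a b d : Matrix (Fin n) (Fin n) ℂ) (c e : Matrix (Fin n) Unit ℂ),
      b.transpose = -b ∧ d.transpose = -d ∧
      X = Matrix.fromBlocks (Matrix.fromBlocks a b d (-a.transpose)) (Matrix.fromRows c e)
        (Matrix.fromCols (-e.transpose) (-c.transpose)) 0 := by
  rw [mem_so_iff_entries]
  constructor
  · intro h
    refine ⟨Matrix.of fun i j => X (lo i) (lo j), Matrix.of fun i j => X (lo i) (hi j),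
      Matrix.of fun i j => X (hi i) (lo j), Matrix.of fun i _ => X (lo i) mid,
      Matrix.of fun i _ => X (hi i) mid, ?_, ?_, ?_⟩
    · ext i j
      exact h (hi i) (hi j)
    · ext i j
      exact h (lo i) (lo j)
    · ext i j
      rcases i with (i | i) | i <;> rcases j with (j | j) | j
      · rfl
      · rfl
      · rfl
      · rfl
      · exact h (hi j) (lo i)
      · rfl
      · exact h (lo j) mid
      · exact h (hi j) mid
      · exact self_eq_neg.mp (h mid mid)
  · rintro ⟨a, b, d, c, e, hb, hd, rfl⟩ i j
    have hb' : ∀ i j, b j i = - b i j := fun i j => congrFun (congrFun hb i) j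
    have hd' : ∀ i j, d j i = - d i j := fun i j => congrFun (congrFun hd i) j
    rcases i with (i | i) | i <;> rcases j with (j | j) | j <;> simp [dual]
    · exact hd' i j
    · exact hb' i j

/-- The element `e_{uv} - e_{v'u'}` of `so(2n+1)`, where `'` is the involution `dual`. -/
def elt {n : ℕ} (u v : SoIdx n) : so n :=
  ⟨Matrix.single u v 1 - Matrix.single (dual v) (dual u) 1, by
    have hd : ∀ x y : SoIdx n, dual x = y ↔ x = dual y := by
      intro x y
      rcases x with (x | x) | x <;> rcases y with (y | y) | y <;> simp [dual]
    rw [mem_so_iff_entries]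
    intro i j
    simp only [Matrix.sub_apply, Matrix.single_apply]
    have hdd : ∀ x : SoIdx n, dual (dual x) = x := fun x => (hd _ _).mpr rfl
    have h1 : (u = dual j ∧ v = i) ↔ (dual v = dual i ∧ dual u = j) := by
      rw [hd u j, hd v (dual i), hdd]
      exact and_comm
    have h2 : (dual v = dual j ∧ dual u = i) ↔ (u = dual i ∧ v = j) := by
      rw [hd u i, hd v (dual j), hdd]
      exact and_comm
    simp only [h1, h2]
    ring⟩

/-- The Cartan element `h_j = e_{jj} - e_{n+j,n+j}`. -/
def cartan {n : ℕ} (j : Fin n) : so n := elt (lo j) (lo j)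

/-- `f_j^+ = √2 (e_{j,2n+1} - e_{2n+1,n+j})` and `f_j^- = √2 (e_{2n+1,j} - e_{n+j,2n+1})`. -/
noncomputable def paraElt {n : ℕ} (j : Fin n) (ξ : ℤˣ) : so n :=
  ((√2 : ℝ) : ℂ) • (if ξ = 1 then elt (lo j) mid else elt mid (lo j))

/-- A representation without invariant subspaces other than `0` and the (nonzero) whole space. -/
def IsIrreducibleRep {n : ℕ} {W : Type*} [AddCommGroup W] [Module ℂ W]
    (ρ : so n →ₗ⁅ℂ⁆ Module.End ℂ W) : Prop :=
  Nontrivial W ∧ ∀ U : Submodule ℂ W, (∀ X, ∀ u ∈ U, ρ X u ∈ U) → U = ⊥ ∨ U = ⊤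

/-- `v` is a highest weight vector of weight `∑ Λ_j ε_j`, for the positive roots `ε_j`,
`ε_j - ε_k`, `ε_j + ε_k` (`j < k`). -/
structure IsHighestWeightVector {n : ℕ} {W : Type*} [AddCommGroup W] [Module ℂ W]
    (ρ : so n →ₗ⁅ℂ⁆ Module.End ℂ W) (Λ : Fin n → ℂ) (v : W) : Prop where
  ne_zero : v ≠ 0
  weight : ∀ j, ρ (cartan j) v = Λ j • v
  short : ∀ j, ρ (elt (lo j) mid) v = 0
  minus : ∀ j k, j < k → ρ (elt (lo j) (lo k)) v = 0
  plus : ∀ j k, j < k → ρ (elt (lo j) (hi k)) v = 0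

end Parafermion

open Parafermion

/-!
The Fock space is realized on the finite-dimensional space with an orthonormal basis indexed by the
patterns `m` with `m 1 n ≤ p`; a Fock space of order `p` is unique, so that everything can be
checked in this model.

*The model.* For every row `k` there is a real matrix `E_k` that raises one entry of row `k`; the
squares of its matrix elements, `raiseSq`, are rational functions of the numbers `l i k = m i k - i`,
positive when the raised array is a pattern and zero when it is not. Here `E_k`, for `k < n`,
belongs to the simple root `ε_k - ε_{k+1}`, and `E_n` is `f_n^+`. The commutators of `E_k` with the
transposes `E_rᵀ` are computed entrywise. Off the diagonal the two ways around a square of patterns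
cancel (`raiseSq_diamond`); the diagonal entries are sums of residues of a rational function in
which nodes may collide (`sum_ladder_residues`), and give the weights (`sum_raiseSq_of_lt`,
`sum_raiseSq_last`). With `f_k^+ = [E_k, [E_{k+1}, …, E_n]]` and `f_k^- = (f_k^+)ᵀ` the parafermion
relations follow from these commutators alone (`IsChevalleySystem.triple`). No Serre relation has to
be verified: whatever must vanish is shown to have Hilbert–Schmidt norm zero, by means of
`‖[E, X]‖² = ‖[Eᵀ, X]‖² - ⟨X, [[E, Eᵀ], X]⟩`. The iterated commutators have the stated matrix
elements (`vectorMat_apply`), the signs `S` being the values of `|e - 1| - |e|` for integers `e`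
(`raise_step`).

*Irreducibility and uniqueness.* A vector killed by all `E_kᵀ` is a multiple of the vacuum
(`eq_zero_of_killed`), so that an invariant subspace and its orthogonal complement cannot both be
nonzero (`modelOp_irreducible`). In any Fock space the vectors created from the vacuum form a
subspace that is invariant under the annihilation operators as well, and their inner products are
determined by the relations. Hence in the product of the model with any Fock space the vectors
created from the pair of vacua form the graph of an isometry (`IsFockSpace.exists_equiv`).

*The representation of `so(2n+1)`.* The triple relations say that the linear map sending the
generators and their brackets to the operators and their commutators is a homomorphism
(`soLinear_lie`).

*The dimension.* The patterns with a given top row are counted by a Vandermonde determinant in the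
coordinates `x i = m (n - i) n + i` (`card_triangles`), so that the dimension is, up to a constant,
the sum of these determinants over `x 0 < … < x (n - 1) < n + p`. Such a sum is a coefficient of
`Ω^r / r!` for `n = 2r`, or of `Θ Ω^r / r!` for `n = 2r + 1`, where `Θ = ∑ θ_x` and
`Ω = ∑_{x < y} θ_x θ_y` in an exterior algebra (`factorial_mul_elemSum`). The monomials in
the determinant may be replaced by other monic polynomials. For a suitable choice `Ω`, for odd `n`
modulo multiples of `Θ`, has coefficients `c_i c_j K i j` with `K` independent of `p` (`exists_adapted_even`,
`exists_adapted_odd`), and then the sum depends on `p` only through explicit factorials such as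
`∏ c_i` (`sum_det_even`, `sum_det_odd`). The constant is fixed by `p = 0`, where there is a single
pattern.
-/

namespace Parafermion

/-! ### A residue identity with colliding nodes -/

open Polynomial in
/-- For distinct nodes this is the leading coefficient in Lagrange interpolation of the difference
of `∏ (z - a)` and `∏ (z - y j)`. -/
theorem sum_prod_sub_div_of_injOn {ι K : Type*} [DecidableEq ι] [Field K]
    (s : Finset ι) (y : ι → K) (A : Multiset K)
    (hA : Multiset.card A = s.card) (hy : Set.InjOn y s) :
    ∑ i ∈ s, (A.map (fun a => y i - a)).prod / ∏ j ∈ s.erase i, (y i - y j) =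
      ∑ i ∈ s, y i - A.sum := by
  rcases s.eq_empty_or_nonempty with rfl | hs
  · have : A = 0 := by simpa using hA
    simp [this]
  have hpos : 0 < s.card := hs.card_pos
  set P : K[X] := (A.map (fun a => X - C a)).prod with hP
  have hPm : P.Monic := monic_multiset_prod_of_monic _ _ (fun a _ => monic_X_sub_C a)
  have hPd : P.natDegree = s.card := by rw [hP, natDegree_multiset_prod_X_sub_C_eq_card, hA]
  have hN : (Lagrange.nodal s y).natDegree = s.card := Lagrange.natDegree_nodal
  have hNm : (Lagrange.nodal s y).Monic := Lagrange.nodal_monic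
  have hdeg : (P - Lagrange.nodal s y).degree < s.card := by
    have h1 : P.degree = s.card := by rw [degree_eq_natDegree hPm.ne_zero, hPd]
    have h2 : (Lagrange.nodal s y).degree = s.card := Lagrange.degree_nodal
    rw [← h1]
    exact degree_sub_lt_left (h1.trans h2.symm) hPm.ne_zero (by rw [hPm.leadingCoeff,
        hNm.leadingCoeff])
  have key := Lagrange.coeff_eq_sum hy hdeg
  have e1 : P.coeff (s.card - 1) = -A.sum := by
    rw [hP, ← hA]
    exact multiset_prod_X_sub_C_coeff_card_pred A (by omega)
  have e2 : (Lagrange.nodal s y).coeff (s.card - 1) = -∑ i ∈ s, y i := by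
    rw [Lagrange.nodal_eq]
    exact prod_X_sub_C_coeff_card_pred s y hpos
  rw [coeff_sub, e1, e2] at key
  rw [show ∑ i ∈ s, y i - A.sum = -A.sum - -∑ i ∈ s, y i by ring, key]
  refine Finset.sum_congr rfl fun i hi => ?_
  rw [eval_sub, Lagrange.eval_nodal_at_node hi, sub_zero, hP, eval_multiset_prod, Multiset.map_map]
  simp

/-- The sum of the residues of `∏ (z - a) / ∏ (z - y j)`, in the form needed when two nodes may
coincide: at such a double node the numerator has a double zero and the corresponding two quotients
`0 / 0` are read as `0`. -/
theorem sum_prod_sub_div_eq {ι K : Type*} [DecidableEq ι] [Field K] [DecidableEq K]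
    (s : Finset ι) (y : ι → K) (A : Multiset K) (hA : Multiset.card A = s.card)
    (hcol : ∀ i ∈ s, ∀ j ∈ s, i ≠ j → y i = y j →
      2 ≤ A.count (y i) ∧ ∀ k ∈ s, y k = y i → k = i ∨ k = j) :
    ∑ i ∈ s, (A.map (fun a => y i - a)).prod / ∏ j ∈ s.erase i, (y i - y j) =
      ∑ i ∈ s, y i - A.sum := by
  induction hn : s.card using Nat.strong_induction_on generalizing s A with
  | _ N ih =>
  by_cases hy : Set.InjOn y s
  · exact sum_prod_sub_div_of_injOn s y A hA hy
  simp only [Set.InjOn, not_forall] at hy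
  obtain ⟨i, hi, j, hj, hij, hne⟩ := hy
  simp only [Finset.mem_coe] at hi hj
  obtain ⟨hc, hthird⟩ := hcol i hi j hj hne hij
  obtain ⟨A', rfl⟩ : ∃ A', A = y i ::ₘ y i ::ₘ A' := by
    obtain ⟨B, hB⟩ := Multiset.le_iff_exists_add.mp (Multiset.le_count_iff_replicate_le.mp hc)
    exact ⟨B, by simpa [Multiset.replicate_succ] using hB⟩
  set s' := (s.erase i).erase j with hs'
  have hj' : j ∈ s.erase i := Finset.mem_erase.mpr ⟨hne ∘ Eq.symm, hj⟩
  have hcard : s'.card + 2 = s.card := by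
    rw [hs', Finset.card_erase_of_mem hj', Finset.card_erase_of_mem hi]
    have := Finset.card_pos.mpr ⟨j, hj'⟩
    rw [Finset.card_erase_of_mem hi] at this
    omega
  have hmem : ∀ k ∈ s', k ∈ s ∧ k ≠ i ∧ k ≠ j := by
    intro k hk
    simp only [hs', Finset.mem_erase] at hk
    exact ⟨hk.2.2, hk.2.1, hk.1⟩
  have hyk : ∀ k ∈ s', y k ≠ y i := by
    intro k hk h
    obtain ⟨h1, h2, h3⟩ := hmem k hk
    rcases hthird k h1 h with h | h
    · exact h2 h
    · exact h3 h
  have hsplit : ∀ g : ι → K, ∑ k ∈ s, g k = g i + (g j + ∑ k ∈ s', g k) := by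
    intro g
    rw [← Finset.add_sum_erase s g hi, ← Finset.add_sum_erase _ g hj']
  have hrec := ih s'.card (by omega) s' A' (by simp at hA; omega) (by
    intro k hk k' hk' hkk he
    obtain ⟨h1, h2, h3⟩ := hmem k hk
    obtain ⟨h1', h2', h3'⟩ := hmem k' hk'
    obtain ⟨c1, c2⟩ := hcol k h1 k' h1' hkk he
    refine ⟨?_, fun q hq => c2 q (hmem q hq).1⟩
    rwa [Multiset.count_cons_of_ne (hyk k hk), Multiset.count_cons_of_ne (hyk k hk)] at c1) rfl
  rw [hsplit, hsplit y]
  have z1 : ((y i ::ₘ y i ::ₘ A').map (fun a => y i - a)).prod = 0 := by simp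
  have z2 : ((y i ::ₘ y i ::ₘ A').map (fun a => y j - a)).prod = 0 := by simp [hij]
  rw [z1, z2, zero_div, zero_div, zero_add, zero_add]
  have : ∑ k ∈ s', ((y i ::ₘ y i ::ₘ A').map (fun a => y k - a)).prod /
      ∏ j ∈ s.erase k, (y k - y j) =
      ∑ k ∈ s', (A'.map (fun a => y k - a)).prod / ∏ j ∈ s'.erase k, (y k - y j) := by
    refine Finset.sum_congr rfl fun k hk => ?_
    obtain ⟨h1, h2, h3⟩ := hmem k hk
    have hik : i ∈ s.erase k := Finset.mem_erase.mpr ⟨h2.symm, hi⟩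
    have hjk : j ∈ (s.erase k).erase i := by
      simp only [Finset.mem_erase]; exact ⟨hne ∘ Eq.symm, h3.symm, hj⟩
    rw [← Finset.mul_prod_erase _ _ hik, ← Finset.mul_prod_erase _ _ hjk, ← hij]
    have he : ((s.erase k).erase i).erase j = s'.erase k := by
      ext q; simp only [hs', Finset.mem_erase]; tauto
    rw [he]
    simp only [Multiset.map_cons, Multiset.prod_cons]
    have h0 : y k - y i ≠ 0 := sub_ne_zero.mpr (hyk k hk)
    rw [mul_div_mul_left _ _ h0, mul_div_mul_left _ _ h0]
  rw [this, hrec]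
  simp only [Multiset.sum_cons, ← hij]
  ring

/-- The residue identity for the nodes `x i` and `x i - 1`. The two sums over `i` that result are
the contributions of raising and of lowering an entry to a diagonal matrix element of `[E, Eᵀ]`. -/
theorem sum_ladder_residues {ι K : Type*} [DecidableEq ι] [Field K] [DecidableEq K]
    (s : Finset ι) (x : ι → K) (A : Multiset K) (hA : Multiset.card A = 2 * s.card)
    (hinj : Set.InjOn x s)
    (hcol : ∀ i ∈ s, ∀ j ∈ s, x i = x j - 1 → 2 ≤ A.count (x i)) :
    ∑ i ∈ s, ((A.map (fun a => x i - a)).prod /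
          ∏ j ∈ s.erase i, ((x i - x j) * (x i - x j + 1)) -
        (A.map (fun a => x i - 1 - a)).prod /
          ∏ j ∈ s.erase i, ((x i - 1 - x j) * (x i - x j))) =
      ∑ i ∈ s, (2 * x i - 1) - A.sum := by
  classical
  let y : ι × Bool → K := fun q => if q.2 then x q.1 else x q.1 - 1
  have h1ne : ∀ z : K, z ≠ z - 1 := fun z h => one_ne_zero (α := K) (by linear_combination h)
  have key := sum_prod_sub_div_eq (s ×ˢ (Finset.univ : Finset Bool)) y A
    (by simp [hA, mul_comm]) (by
      have aux : ∀ i ∈ s, ∀ j ∈ s, x i = x j - 1 → ∀ k ∈ s, ∀ b,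
          y (k, b) = x i → (k, b) = (i, true) ∨ (k, b) = (j, false) := by
        intro i hi j hj h k hk b hkb
        cases b
        · right
          simp only [y, Bool.false_eq_true, if_false] at hkb
          rw [h] at hkb
          rw [hinj hk hj (by linear_combination hkb)]
        · left
          simp only [y, if_true] at hkb
          rw [hinj hk hi hkb]
      rintro ⟨i, b⟩ hi ⟨j, c⟩ hj hne he
      simp only [Finset.mem_product, Finset.mem_univ, and_true] at hi hj
      cases b <;> cases c
      · simp only [y, Bool.false_eq_true, if_false, sub_left_inj] at he
        exact absurd (by rw [hinj hi hj he]) hne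
      · have he' : x j = x i - 1 := by simpa [y] using he.symm
        refine ⟨?_, ?_⟩
        · simpa [y, ← he'] using hcol j hj i hi he'
        · rintro ⟨k, d⟩ hk hkd
          simp only [Finset.mem_product, Finset.mem_univ, and_true] at hk
          exact (aux j hj i hi he' k hk d (by rw [hkd, he]; simp [y])).symm
      · have he' : x i = x j - 1 := by simpa [y] using he
        refine ⟨?_, ?_⟩
        · simpa [y] using hcol i hi j hj he'
        · rintro ⟨k, d⟩ hk hkd
          simp only [Finset.mem_product, Finset.mem_univ, and_true] at hk
          exact aux i hi j hj he' k hk d (by rw [hkd]; simp [y])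
      · simp only [y, if_true] at he
        exact absurd (by rw [hinj hi hj he]) hne)
  rw [Finset.sum_product, Finset.sum_product] at key
  have hden : ∀ i ∈ s, ∀ b (g : ι × Bool → K),
      ∏ j ∈ (s ×ˢ (Finset.univ : Finset Bool)).erase (i, b), g j =
        g (i, !b) * ∏ j ∈ s.erase i, (g (j, true) * g (j, false)) := by
    intro i hi b g
    have : (s ×ˢ (Finset.univ : Finset Bool)).erase (i, b) =
        insert (i, !b) ((s.erase i) ×ˢ (Finset.univ : Finset Bool)) := by
      ext ⟨j, c⟩
      simp only [Finset.mem_erase, Finset.mem_product, Finset.mem_univ, and_true,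
        Finset.mem_insert, Prod.mk.injEq, ne_eq]
      by_cases hji : j = i
      · subst hji; cases b <;> cases c <;> simp [hi]
      · simp [hji]
    rw [this, Finset.prod_insert (by simp), Finset.prod_product]
    simp
  have hR : ∑ i ∈ s, ∑ b : Bool, y (i, b) = ∑ i ∈ s, (2 * x i - 1) :=
    Finset.sum_congr rfl fun i _ => by simp [y]; ring
  rw [hR] at key
  rw [← key]
  refine Finset.sum_congr rfl fun i hi => ?_
  rw [Fintype.sum_bool, hden i hi, hden i hi, sub_eq_add_neg]
  simp only [y, if_true, Bool.not_true, Bool.not_false, Bool.false_eq_true, if_false]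
  congr 1
  · congr 1
    rw [show x i - (x i - 1) = 1 by ring, one_mul]
    exact Finset.prod_congr rfl fun j _ => by ring
  · rw [show x i - 1 - x i = -1 by ring, neg_one_mul, div_neg]
    congr 2
    exact Finset.prod_congr rfl fun j _ => by ring

/-! ### The unitary trick for real matrices -/

section Unitary

open Matrix

variable {ι : Type*} [Fintype ι]

theorem transpose_lie (X Y : Matrix ι ι ℝ) : ⁅X, Y⁆ᵀ = ⁅Yᵀ, Xᵀ⁆ := by
  simp [Ring.lie_def]

/-- The squared Hilbert–Schmidt norm. -/
noncomputable def normSq (X : Matrix ι ι ℝ) : ℝ := (Xᵀ * X).trace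

theorem normSq_eq_zero {X : Matrix ι ι ℝ} : normSq X = 0 ↔ X = 0 :=
  trace_conjTranspose_mul_self_eq_zero_iff (A := X)

theorem normSq_neg (X : Matrix ι ι ℝ) : normSq (-X) = normSq X := by simp [normSq]

theorem normSq_smul (c : ℝ) (X : Matrix ι ι ℝ) : normSq (c • X) = c ^ 2 * normSq X := by
  simp [normSq, smul_smul, pow_two, mul_assoc]

theorem trace_transpose_lie_mul (E X Y : Matrix ι ι ℝ) :
    (⁅E, X⁆ᵀ * Y).trace = (Xᵀ * ⁅Eᵀ, Y⁆).trace := by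
  simp only [Ring.lie_def, transpose_sub, transpose_mul, sub_mul, mul_sub, trace_sub]
  congr 1
  · rw [mul_assoc]
  · rw [mul_assoc, trace_mul_comm, mul_assoc]

variable [DecidableEq ι]

/-- The unitary trick: `⁅Eᵀ, ·⁆` is adjoint to `⁅E, ·⁆` for the Hilbert–Schmidt inner product. -/
theorem normSq_lie (E X : Matrix ι ι ℝ) :
    normSq ⁅E, X⁆ = normSq ⁅Eᵀ, X⁆ - (Xᵀ * ⁅⁅E, Eᵀ⁆, X⁆).trace := by
  have h : ⁅Eᵀ, ⁅E, X⁆⁆ = ⁅E, ⁅Eᵀ, X⁆⁆ - ⁅⁅E, Eᵀ⁆, X⁆ := by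
    rw [lie_lie]; abel
  unfold normSq
  rw [trace_transpose_lie_mul, trace_transpose_lie_mul, h, mul_sub, trace_sub, transpose_transpose]

/-- If `X` has weight `μ` for `[E, Eᵀ]`, the norms of `[E, X]` and `[Eᵀ, X]` are related. -/
theorem normSq_lie_of_weight {E X : Matrix ι ι ℝ} {μ : ℝ} (h : ⁅⁅E, Eᵀ⁆, X⁆ = μ • X) :
    normSq ⁅E, X⁆ = normSq ⁅Eᵀ, X⁆ - μ * normSq X := by
  rw [normSq_lie, h]; simp [normSq]

theorem lie_eq_zero_of_weight_zero {E X : Matrix ι ι ℝ} (h : ⁅⁅E, Eᵀ⁆, X⁆ = 0)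
    (h' : ⁅Eᵀ, X⁆ = 0) : ⁅E, X⁆ = 0 := by
  rw [← normSq_eq_zero, normSq_lie_of_weight (μ := 0) (by rw [h, zero_smul]), h']
  simp [normSq]

end Unitary

/-! ### Parafermion relations from simple raising operators -/

section Chevalley

open Matrix

variable {ι : Type*} [Fintype ι] [DecidableEq ι]

/-- Real matrices `E 1, …, E n` that behave, together with their transposes, like the Chevalley
generators of `so(2n+1)`: `E k` for `k < n` belongs to the simple root `ε_k - ε_{k+1}`, and `E n` is
`f_n^+`. The matrices `a k` are the operators `f_k^+` built from them. No Serre relation is assumed: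
these relations follow because the transpose is an adjoint. -/
structure IsChevalleySystem (n : ℕ) (E h a : ℕ → Matrix ι ι ℝ) : Prop where
  comm : ∀ k l, 1 ≤ k → k ≤ n → 1 ≤ l → l ≤ n → k ≠ l → ⁅E k, (E l)ᵀ⁆ = 0
  self : ∀ k, 1 ≤ k → k < n → ⁅E k, (E k)ᵀ⁆ = h k - h (k + 1)
  last : ⁅E n, (E n)ᵀ⁆ = (2 : ℝ) • h n
  weight : ∀ j k, 1 ≤ j → j ≤ n → 1 ≤ k → k < n →
    ⁅h j, E k⁆ = ((if j = k then (1 : ℝ) else 0) - (if j = k + 1 then 1 else 0)) • E k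
  weight_last : ∀ j, 1 ≤ j → j ≤ n → ⁅h j, E n⁆ = (if j = n then (1 : ℝ) else 0) • E n
  symm : ∀ j, (h j)ᵀ = h j
  a_last : a n = E n
  a_rec : ∀ k, 1 ≤ k → k < n → a k = ⁅E k, a (k + 1)⁆

theorem downward_induction {n : ℕ} {P : ∀ k, 1 ≤ k → k ≤ n → Prop}
    (last : ∀ h : 1 ≤ n, P n h le_rfl)
    (step : ∀ k (hk : 1 ≤ k) (hkn : k < n), P (k + 1) (by omega) hkn → P k hk hkn.le) :
    ∀ k (hk : 1 ≤ k) (hkn : k ≤ n), P k hk hkn := by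
  intro k hk hkn
  induction hd : n - k generalizing k with
  | zero =>
    obtain rfl : k = n := by omega
    exact last hk
  | succ d ih => exact step k hk (by omega) (ih (k + 1) (by omega) (by omega) (by omega))

namespace IsChevalleySystem

variable {n : ℕ} {E h a : ℕ → Matrix ι ι ℝ} (H : IsChevalleySystem n E h a)
include H

theorem weight_a {j l : ℕ} (hj : 1 ≤ j) (hjn : j ≤ n) (hl : 1 ≤ l) (hln : l ≤ n) :
    ⁅h j, a l⁆ = (if j = l then (1 : ℝ) else 0) • a l := by
  induction l, hl, hln using downward_induction with
  | last => rw [H.a_last]; exact H.weight_last j hj hjn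
  | step l hl hln ih =>
    rw [H.a_rec l hl hln, leibniz_lie, H.weight j l hj hjn hl hln, ih, smul_lie, lie_smul,
      ← add_smul]
    congr 1
    ring

/-- The `f_l^+` form a vector operator for the `E k`, `(E k)ᵀ` with `k < n`. The brackets with
`(E k)ᵀ` come from the commutators of the generators, those with `E k` from a norm computation. -/
theorem lie_a {l : ℕ} (hl : 1 ≤ l) (hln : l ≤ n) : ∀ k, 1 ≤ k → k < n →
    ⁅(E k)ᵀ, a l⁆ = (if k = l then a (l + 1) else 0) ∧
      ⁅E k, a l⁆ = (if k + 1 = l then a k else 0) := by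
  obtain ⟨d, hd⟩ : ∃ d, l + d = n := ⟨n - l, by omega⟩
  induction d using Nat.strong_induction_on generalizing l with
  | _ d ih =>
  intro k hk hkn
  have hw : ∀ q, 1 ≤ q → q ≤ n → ⁅⁅E k, (E k)ᵀ⁆, a q⁆ =
      ((if k = q then (1 : ℝ) else 0) - (if k + 1 = q then 1 else 0)) • a q := by
    intro q hq hqn
    rw [H.self k hk hkn, sub_lie, H.weight_a hk (by omega) hq hqn,
      H.weight_a (by omega) (by omega) hq hqn, sub_smul]
  have hF : ⁅(E k)ᵀ, a l⁆ = (if k = l then a (l + 1) else 0) := by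
    rcases Nat.eq_or_lt_of_le hln with rfl | hlt
    · rw [if_neg (by omega), H.a_last, ← lie_skew,
        H.comm l k (by omega) le_rfl hk (by omega) (by omega), neg_zero]
    · obtain ⟨f1, -⟩ := ih (d - 1) (by omega) (l := l + 1) (by omega) (by omega) (by omega) k hk hkn
      rw [H.a_rec l hl hlt, leibniz_lie, f1]
      by_cases hkl : k = l
      · subst hkl
        rw [if_neg (by omega), if_pos rfl, lie_zero, add_zero, ← lie_skew (E k)ᵀ (E k), neg_lie,
          hw _ (by omega) (by omega)]
        simp
      · have h1 : ⁅(E k)ᵀ, E l⁆ = 0 := by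
          rw [← lie_skew, H.comm l k hl (by omega) hk (by omega) (Ne.symm hkl), neg_zero]
        rw [if_neg hkl, h1, zero_lie, zero_add]
        split_ifs with hk2
        · obtain ⟨-, f2⟩ := ih (d - 2) (by omega) (l := l + 1 + 1) (by omega) (by omega) (by omega)
            l hl hlt
          rw [f2, if_neg (by omega)]
        · rw [lie_zero]
  refine ⟨hF, ?_⟩
  by_cases h1 : k + 1 = l
  · subst h1; rw [if_pos rfl, H.a_rec k hk hkn]
  rw [if_neg h1]
  by_cases h2 : k = l
  · subst h2
    have g1 := ih (d - 1) (by omega) (l := k + 1) (by omega) (by omega) (by omega) k hk hkn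
    -- `⁅(E k)ᵀ, a (k + 1)⁆ = 0` makes the norms of `a k` and `a (k + 1)` equal, and then the norm
    -- of `⁅E k, a k⁆` vanishes
    have n1 := normSq_lie_of_weight (hw (k + 1) (by omega) (by omega))
    have n2 := normSq_lie_of_weight (hw k (by omega) (by omega))
    rw [← H.a_rec k hk hkn, g1.1, if_neg (by omega : ¬ k = k + 1)] at n1
    rw [hF, if_pos rfl] at n2
    rw [← normSq_eq_zero, n2]
    simp [normSq] at n1 ⊢
    linarith
  · apply lie_eq_zero_of_weight_zero
    · rw [hw l hl hln, if_neg h2, if_neg h1]; simp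
    · rw [hF, if_neg h2]

theorem lie_b {l : ℕ} (hl : 1 ≤ l) (hln : l ≤ n) (k : ℕ) (hk : 1 ≤ k) (hkn : k < n) :
    ⁅E k, (a l)ᵀ⁆ = (if k = l then -(a (l + 1))ᵀ else 0) ∧
      ⁅(E k)ᵀ, (a l)ᵀ⁆ = (if k + 1 = l then -(a k)ᵀ else 0) := by
  obtain ⟨h1, h2⟩ := H.lie_a hl hln k hk hkn
  have t1 := congrArg transpose h1
  have t2 := congrArg transpose h2
  rw [transpose_lie, transpose_transpose] at t1
  rw [transpose_lie] at t2
  rw [← lie_skew, t1, ← lie_skew, t2]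
  constructor <;> split_ifs <;> simp

theorem lie_h_transpose {k : ℕ} (hk : 1 ≤ k) (hkn : k < n) :
    ⁅h (k + 1), (E k)ᵀ⁆ = (E k)ᵀ := by
  have t := congrArg transpose (H.weight (k + 1) k (by omega) (by omega) hk hkn)
  rw [transpose_lie, H.symm, ← lie_skew] at t
  rw [← neg_neg ⁅h (k + 1), (E k)ᵀ⁆, t]
  simp

theorem lie_a_succ_b {k : ℕ} (hk : 1 ≤ k) (hkn : k < n)
    (hs : ⁅a (k + 1), (a (k + 1))ᵀ⁆ = (2 : ℝ) • h (k + 1)) :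
    ⁅a (k + 1), (a k)ᵀ⁆ = (2 : ℝ) • (E k)ᵀ := by
  have h1 : ⁅a (k + 1), (E k)ᵀ⁆ = 0 := by
    rw [← lie_skew, (H.lie_a (by omega) hkn k hk hkn).1, if_neg (by omega), neg_zero]
  rw [H.a_rec k hk hkn, transpose_lie, leibniz_lie, h1, lie_zero, add_zero, hs, smul_lie,
    H.lie_h_transpose hk hkn]

theorem lie_a_b {k : ℕ} (hk : 1 ≤ k) (hkn : k ≤ n) : ⁅a k, (a k)ᵀ⁆ = (2 : ℝ) • h k := by
  induction k, hk, hkn using downward_induction with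
  | last => rw [H.a_last]; exact H.last
  | step k hk hkn ih =>
    have h1 := H.lie_a_succ_b hk hkn ih
    have h2 := (H.lie_b hk hkn.le k hk hkn).1
    rw [if_pos rfl] at h2
    have h3 : ⁅a k, (a k)ᵀ⁆ = ⁅⁅E k, a (k + 1)⁆, (a k)ᵀ⁆ := by rw [← H.a_rec k hk hkn]
    rw [h3, lie_lie, h1, h2, lie_smul, H.self k hk hkn, lie_neg, ih, smul_sub]
    abel

theorem E_eq {k : ℕ} (hk : 1 ≤ k) (hkn : k < n) :
    (2 : ℝ) • E k = ⁅a k, (a (k + 1))ᵀ⁆ := by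
  have t := congrArg transpose (H.lie_a_succ_b hk hkn (H.lie_a_b (by omega) hkn))
  rw [transpose_lie, transpose_transpose, transpose_smul, transpose_transpose] at t
  exact t.symm

/-- The relation `[[f_j^+, f_k^-], f_l^+] = 2 δ_kl f_j^+`. Both sides transform in the same way
under the `E k`, `(E k)ᵀ`, so that the case `j = k = n` implies the others. -/
theorem lie_lie_a_b_a {j k l : ℕ} (hj : 1 ≤ j) (hjn : j ≤ n) (hk : 1 ≤ k) (hkn : k ≤ n)
    (hl : 1 ≤ l) (hln : l ≤ n) :
    ⁅⁅a j, (a k)ᵀ⁆, a l⁆ = (if k = l then (2 : ℝ) else 0) • a j := by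
  induction k, hk, hkn using downward_induction generalizing j l with
  | last hk =>
    induction j, hj, hjn using downward_induction generalizing l with
    | last hj =>
      rw [H.lie_a_b hk le_rfl, smul_lie, H.weight_a hk le_rfl hl hln, smul_smul]
      split_ifs with h
      · subst h; simp
      · simp
    | step j hj hjn ih =>
      have ih := fun l hl hln => ih (l := l) hl hln
      have e := congrArg (fun X => ⁅E j, X⁆) (ih l hl hln)
      simp only [lie_smul] at e
      rw [leibniz_lie, leibniz_lie (E j) (a (j + 1)), (H.lie_a (by omega) hjn j hj hjn).2,
        (H.lie_a hl hln j hj hjn).2, (H.lie_b hk le_rfl j hj hjn).1, if_pos rfl, if_neg (by omega),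
        lie_zero, add_zero] at e
      have z : ⁅⁅a (j + 1), (a n)ᵀ⁆, if j + 1 = l then a j else 0⁆ = 0 := by
        split_ifs
        · rw [ih j hj hjn.le, if_neg (by omega), zero_smul]
        · rw [lie_zero]
      rw [z, add_zero] at e
      exact e
  | step k hk hkn ih =>
    have ih := fun j hj hjn l hl hln => ih (j := j) hj hjn (l := l) hl hln
    have e := congrArg (fun X => ⁅(E k)ᵀ, X⁆) (ih j hj hjn l hl hln)
    simp only [lie_smul] at e
    rw [leibniz_lie, leibniz_lie (E k)ᵀ (a j), (H.lie_a hj hjn k hk hkn).1,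
      (H.lie_a hl hln k hk hkn).1, (H.lie_b (by omega) hkn k hk hkn).2, if_pos rfl, lie_neg,
      add_lie, neg_lie] at e
    have z1 : ⁅⁅if k = j then a (j + 1) else 0, (a (k + 1))ᵀ⁆, a l⁆ =
        (if k + 1 = l then (2 : ℝ) else 0) • (if k = j then a (j + 1) else 0) := by
      split_ifs with h1 h2
      · rw [ih _ (by omega) (by omega) _ hl hln, if_pos h2]
      · rw [ih _ (by omega) (by omega) _ hl hln, if_neg h2]
      · simp
      · simp
    have z2 : ⁅⁅a j, (a (k + 1))ᵀ⁆, if k = l then a (l + 1) else 0⁆ =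
        (if k = l then (2 : ℝ) else 0) • a j := by
      split_ifs with h1
      · subst h1
        rw [ih _ hj hjn _ (by omega) (by omega), if_pos rfl]
      · simp
    rw [z1, z2] at e
    have e' : ⁅⁅a j, (a k)ᵀ⁆, a l⁆ - (if k = l then (2 : ℝ) else 0) • a j = 0 := by
      rw [← sub_eq_zero.mpr e.symm]; abel
    exact sub_eq_zero.mp e'

theorem lie_b_lie_a_a {j k l : ℕ} (hj : 1 ≤ j) (hjn : j ≤ n) (hk : 1 ≤ k) (hkn : k ≤ n)
    (hl : 1 ≤ l) (hln : l ≤ n) :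
    ⁅(a l)ᵀ, ⁅a j, a k⁆⁆ =
      (if l = j then (2 : ℝ) else 0) • a k - (if l = k then (2 : ℝ) else 0) • a j := by
  rw [leibniz_lie, ← lie_skew (a l)ᵀ (a j), neg_lie, H.lie_lie_a_b_a hj hjn hl hln hk hkn,
    ← lie_skew (a l)ᵀ (a k), lie_neg, ← lie_skew (a j), neg_neg,
    H.lie_lie_a_b_a hk hkn hl hln hj hjn]
  abel

/-- The relation `[[f_j^+, f_k^+], f_l^+] = 0`, by computing the norm of the left-hand side. -/
theorem lie_lie_a_a_a {j k l : ℕ} (hj : 1 ≤ j) (hjn : j ≤ n) (hk : 1 ≤ k) (hkn : k ≤ n)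
    (hl : 1 ≤ l) (hln : l ≤ n) : ⁅⁅a j, a k⁆, a l⁆ = 0 := by
  have main : ∀ j k, 1 ≤ j → j ≤ n → 1 ≤ k → k ≤ n → j ≠ k →
      normSq ⁅a j, a k⁆ = 2 * normSq (a k) := by
    intro j k hj hjn hk hkn hjk
    have hw : ⁅⁅a j, (a j)ᵀ⁆, a k⁆ = (0 : ℝ) • a k := by
      rw [H.lie_lie_a_b_a hj hjn hj hjn hk hkn, if_neg hjk, zero_smul, zero_smul]
    rw [normSq_lie_of_weight hw, zero_mul, sub_zero]
    unfold normSq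
    rw [trace_transpose_lie_mul, transpose_transpose, ← lie_skew (a j)ᵀ, lie_neg, lie_skew,
      H.lie_lie_a_b_a hk hkn hj hjn hj hjn, if_pos rfl]
    simp
  rcases eq_or_ne j k with rfl | hjk
  · rw [lie_self, zero_lie]
  -- the bracket with `(a l)ᵀ` is known, so that the norm of `⁅a l, ⁅a j, a k⁆⁆` can be computed
  -- from the weight of `⁅a j, a k⁆`
  have hw : ⁅⁅a l, (a l)ᵀ⁆, ⁅a j, a k⁆⁆ =
      ((if l = j then (2 : ℝ) else 0) + (if l = k then (2 : ℝ) else 0)) • ⁅a j, a k⁆ := by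
    rw [leibniz_lie, H.lie_lie_a_b_a hl hln hl hln hj hjn, H.lie_lie_a_b_a hl hln hl hln hk hkn,
      smul_lie, lie_smul, add_smul]
    by_cases h1 : l = j
    · subst h1; simp [hjk]
    · by_cases h2 : l = k
      · subst h2; simp [h1]
      · simp [h1, h2]
  have key := normSq_lie_of_weight hw
  rw [H.lie_b_lie_a_a hj hjn hk hkn hl hln] at key
  rw [← lie_skew, neg_eq_zero, ← normSq_eq_zero, key]
  by_cases h1 : l = j
  · subst h1
    rw [if_pos rfl, if_neg hjk, zero_smul, sub_zero, normSq_smul, main l k hl hln hk hkn hjk]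
    ring
  · by_cases h2 : l = k
    · subst h2
      rw [if_neg h1, if_pos rfl, zero_smul, zero_sub, normSq_neg, normSq_smul,
        ← lie_skew (a j) (a l), normSq_neg, main l j hl hln hj hjn h1]
      ring
    · simp [h1, h2, normSq]

/-- The operators `f_k^+ = a k` and `f_k^- = (a k)ᵀ` satisfy the parafermion relations. -/
theorem triple {j k l : ℕ} (hj : 1 ≤ j) (hjn : j ≤ n) (hk : 1 ≤ k) (hkn : k ≤ n)
    (hl : 1 ≤ l) (hln : l ≤ n) (ξ η ε : ℤˣ) {g : ℕ → ℤˣ → Matrix ι ι ℝ}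
    (hg1 : ∀ k, g k 1 = a k) (hg2 : ∀ k, g k (-1) = (a k)ᵀ) :
    ⁅⁅g j ξ, g k η⁆, g l ε⁆ =
      ((1 / 2 : ℝ) * (((ε : ℤ) : ℝ) - ((η : ℤ) : ℝ)) ^ 2 * (if k = l then 1 else 0)) • g j ξ -
      ((1 / 2 : ℝ) * (((ε : ℤ) : ℝ) - ((ξ : ℤ) : ℝ)) ^ 2 * (if j = l then 1 else 0)) • g k η := by
  have r1 : ⁅⁅a j, a k⁆, a l⁆ = 0 := H.lie_lie_a_a_a hj hjn hk hkn hl hln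
  have r2 : ⁅⁅a j, a k⁆, (a l)ᵀ⁆ =
      (if k = l then (2 : ℝ) else 0) • a j - (if j = l then (2 : ℝ) else 0) • a k := by
    rw [← lie_skew, H.lie_b_lie_a_a hj hjn hk hkn hl hln, neg_sub]
    simp only [eq_comm]
  have r3 := H.lie_lie_a_b_a hj hjn hk hkn hl hln
  have r4 := H.lie_lie_a_b_a hk hkn hj hjn hl hln
  -- the relations with more operators `f^-` are transposes of those with fewer
  have tr : ∀ X Y Z : Matrix ι ι ℝ, ⁅⁅Xᵀ, Yᵀ⁆, Zᵀ⁆ = (⁅⁅X, Y⁆, Z⁆)ᵀ := by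
    intro X Y Z
    rw [transpose_lie, transpose_lie, ← lie_skew, ← lie_skew Xᵀ, lie_neg, neg_neg]
  have t1 := tr (a j) (a k) (a l)
  have t2 := tr (a j) (a k) (a l)ᵀ
  have t3 := tr (a j) (a k)ᵀ (a l)
  have t4 := tr (a k) (a j)ᵀ (a l)
  rw [r1] at t1
  rw [r2] at t2
  rw [r3] at t3
  rw [r4] at t4
  rw [transpose_transpose] at t2 t3 t4
  have r4' : ⁅⁅(a j)ᵀ, a k⁆, a l⁆ = -((if j = l then (2 : ℝ) else 0) • a k) := by
    rw [← lie_skew (a j)ᵀ, neg_lie, r4]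
  have t4' : ⁅⁅a j, (a k)ᵀ⁆, (a l)ᵀ⁆ = -((if j = l then (2 : ℝ) else 0) • a k)ᵀ := by
    rw [← lie_skew (a j), neg_lie, t4]
  have hu : ∀ z : ℤˣ, z = 1 ∨ z = -1 := Int.units_eq_one_or
  rcases hu ξ with rfl | rfl <;> rcases hu η with rfl | rfl <;> rcases hu ε with rfl | rfl <;>
    simp only [hg1, hg2, r1, r2, r3, r4', t1, t2, t3, t4'] <;>
    by_cases h1 : j = l <;> by_cases h2 : k = l <;> simp [h1, h2] <;> norm_num

end IsChevalleySystem
end Chevalley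

/-! ### Patterns and their shifts -/

theorem shiftOne_apply (m : ℕ → ℕ → ℤ) (s : ℤ) (i k a b : ℕ) :
    shiftOne m s i k a b = m a b + if a = i ∧ b = k then s else 0 := by
  unfold shiftOne; split_ifs <;> simp

theorem shiftOne_shiftOne_comm (m : ℕ → ℕ → ℤ) (s t : ℤ) (i k j q : ℕ) :
    shiftOne (shiftOne m s i k) t j q = shiftOne (shiftOne m t j q) s i k := by
  funext a b; simp only [shiftOne_apply]; ring

theorem shiftOne_shiftOne_self (m : ℕ → ℕ → ℤ) (s t : ℤ) (i k : ℕ) :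
    shiftOne (shiftOne m s i k) t i k = shiftOne m (s + t) i k := by
  funext a b; simp only [shiftOne_apply]; split_ifs <;> ring

theorem shiftOne_zero (m : ℕ → ℕ → ℤ) (i k : ℕ) : shiftOne m 0 i k = m := by
  funext a b; simp [shiftOne_apply]

theorem shiftOne_neg_one_eq_iff {m m' : ℕ → ℕ → ℤ} {i k : ℕ} :
    m' = shiftOne m 1 i k ↔ m = shiftOne m' (-1) i k := by
  constructor <;> rintro rfl <;> rw [shiftOne_shiftOne_self] <;> simp [shiftOne_zero]

theorem l_shiftOne (m : ℕ → ℕ → ℤ) (s : ℤ) (i k a b : ℕ) :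
    l (shiftOne m s i k) a b = l m a b + if a = i ∧ b = k then (s : ℝ) else 0 := by
  unfold l; rw [shiftOne_apply]; push_cast; split_ifs <;> ring

theorem IsGZPattern.antitone {n p : ℕ} {m : ℕ → ℕ → ℤ} (h : IsGZPattern n p m) {i j k : ℕ}
    (hi : 1 ≤ i) (hij : i ≤ j) (hjk : j ≤ k) (hkn : k ≤ n) : m j k ≤ m i k := by
  induction j, hij using Nat.le_induction with
  | base => exact le_rfl
  | succ j hij ih =>
    obtain ⟨q, rfl⟩ : ∃ q, k = q + 1 := ⟨k - 1, by omega⟩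
    have b := h.between j q (by omega) (by omega) hkn
    exact (b.1.trans b.2).trans (ih (by omega))

theorem IsGZPattern.raise_iff {n p : ℕ} {m : ℕ → ℕ → ℤ} (h : IsGZPattern n p m) {i k : ℕ}
    (hi : 1 ≤ i) (hik : i ≤ k) (hkn : k ≤ n) :
    IsGZPattern n p (shiftOne m 1 i k) ↔
      (1 < i → m i k < m (i - 1) (k - 1)) ∧ (k < n → m i k < m i (k + 1)) ∧
        (k = n → i = 1 → m i k < p) := by
  constructor
  · intro h'
    refine ⟨fun h1 => ?_, fun h1 => ?_, fun h1 h2 => ?_⟩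
    · have := (h'.between (i - 1) (k - 1) (by omega) (by omega) (by omega)).1
      rw [show i - 1 + 1 = i by omega, show k - 1 + 1 = k by omega, shiftOne_apply, shiftOne_apply,
        if_pos (⟨rfl, rfl⟩ : i = i ∧ k = k), if_neg (fun h => by omega)] at this
      omega
    · have := (h'.between i k hi hik h1).2
      rw [shiftOne_apply, shiftOne_apply, if_pos (⟨rfl, rfl⟩ : i = i ∧ k = k),
        if_neg (fun h => by omega)] at this
      omega
    · subst h1 h2
      have := h'.top_le
      rw [shiftOne_apply, if_pos ⟨rfl, rfl⟩] at this
      omega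
  · rintro ⟨h1, h2, h3⟩
    constructor
    · intro a b hab
      rw [shiftOne_apply, h.supp a b hab, if_neg]
      · rfl
      · rintro ⟨rfl, rfl⟩; exact hab ⟨hi, hik, hkn⟩
    · intro a b
      have := h.nonneg a b
      rw [shiftOne_apply]; split_ifs <;> omega
    · intro a b ha hab hb
      have := h.between a b ha hab hb
      simp only [shiftOne_apply]
      by_cases c1 : a + 1 = i ∧ b + 1 = k
      · obtain ⟨rfl, rfl⟩ := c1
        have := h1 (by omega)
        simp only [Nat.add_sub_cancel] at this
        split_ifs <;> omega
      · by_cases c2 : a = i ∧ b = k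
        · obtain ⟨rfl, rfl⟩ := c2
          have := h2 (by omega)
          split_ifs <;> omega
        · split_ifs <;> omega
    · have := h.top_le
      rw [shiftOne_apply]
      split_ifs with c
      · obtain ⟨c1, c2⟩ := c
        have := h3 c2.symm c1.symm
        subst c1 c2
        omega
      · omega

theorem IsGZPattern.lower_iff {n p : ℕ} {m : ℕ → ℕ → ℤ} (h : IsGZPattern n p m) {i k : ℕ}
    (hi : 1 ≤ i) (hik : i ≤ k) (hkn : k ≤ n) :
    IsGZPattern n p (shiftOne m (-1) i k) ↔
      (i < k → m i (k - 1) < m i k) ∧ (k < n → m (i + 1) (k + 1) < m i k) ∧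
        (k = n → i = n → 0 < m i k) := by
  constructor
  · intro h'
    refine ⟨fun h1 => ?_, fun h1 => ?_, fun h1 h2 => ?_⟩
    · have := (h'.between i (k - 1) (by omega) (by omega) (by omega)).2
      rw [show k - 1 + 1 = k by omega, shiftOne_apply, shiftOne_apply,
        if_pos (⟨rfl, rfl⟩ : i = i ∧ k = k), if_neg (fun h => by omega)] at this
      omega
    · have := (h'.between i k hi hik h1).1
      rw [shiftOne_apply, shiftOne_apply, if_pos (⟨rfl, rfl⟩ : i = i ∧ k = k),
        if_neg (fun h => by omega)] at this
      omega
    · have := h'.nonneg i k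
      rw [shiftOne_apply, if_pos ⟨rfl, rfl⟩] at this
      omega
  · rintro ⟨h1, h2, h3⟩
    constructor
    · intro a b hab
      rw [shiftOne_apply, h.supp a b hab, if_neg]
      · rfl
      · rintro ⟨rfl, rfl⟩; exact hab ⟨hi, hik, hkn⟩
    · intro a b
      have := h.nonneg a b
      rw [shiftOne_apply]
      split_ifs with c
      · obtain ⟨rfl, rfl⟩ := c
        rcases Nat.lt_or_ge b n with hb | hb
        · have := h2 hb; have := h.nonneg (a + 1) (b + 1); omega
        · rcases Nat.lt_or_ge a b with hab | hab
          · have := h1 hab; have := h.nonneg a (b - 1); omega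
          · have := h3 (by omega) (by omega); omega
      · omega
    · intro a b ha hab hb
      have := h.between a b ha hab hb
      simp only [shiftOne_apply]
      by_cases c1 : a = i ∧ b + 1 = k
      · obtain ⟨rfl, rfl⟩ := c1
        have := h1 (by omega)
        simp only [Nat.add_sub_cancel] at this
        split_ifs <;> omega
      · by_cases c2 : a = i ∧ b = k
        · obtain ⟨rfl, rfl⟩ := c2
          have := h2 (by omega)
          split_ifs <;> omega
        · split_ifs <;> omega
    · have := h.top_le
      rw [shiftOne_apply]
      split_ifs <;> omega

/-- No inequality between the entries of a pattern gets tighter both by raising one entry and by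
raising another one; hence in a diamond `q`, `q + (i,k)`, `q + (j,r)`, `q + (i,k) + (j,r)` the two
middle arrays being patterns implies that the others are. -/
theorem isGZPattern_diamond {n p : ℕ} {q : ℕ → ℕ → ℤ} {i k j r : ℕ} (hne : ¬ (i = j ∧ k = r))
    (h1 : IsGZPattern n p (shiftOne q 1 i k)) (h2 : IsGZPattern n p (shiftOne q 1 j r)) :
    IsGZPattern n p q ∧ IsGZPattern n p (shiftOne (shiftOne q 1 i k) 1 j r) := by
  refine ⟨⟨?_, ?_, ?_, ?_⟩, ⟨?_, ?_, ?_, ?_⟩⟩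
  · intro a b hab
    have e1 := h1.supp a b hab
    have e2 := h2.supp a b hab
    simp only [shiftOne_apply] at e1 e2
    split_ifs at e1 e2 <;> omega
  · intro a b
    have e1 := h1.nonneg a b
    have e2 := h2.nonneg a b
    simp only [shiftOne_apply] at e1 e2
    split_ifs at e1 e2 <;> omega
  · intro a b ha hab hb
    have e1 := h1.between a b ha hab hb
    have e2 := h2.between a b ha hab hb
    simp only [shiftOne_apply] at e1 e2
    split_ifs at e1 e2 <;> omega
  · have e1 := h1.top_le
    simp only [shiftOne_apply] at e1
    split_ifs at e1 <;> omega
  · intro a b hab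
    have e1 := h1.supp a b hab
    have e2 := h2.supp a b hab
    simp only [shiftOne_apply] at e1 e2 ⊢
    split_ifs at e1 e2 ⊢ <;> omega
  · intro a b
    have e1 := h1.nonneg a b
    simp only [shiftOne_apply] at e1 ⊢
    split_ifs at e1 ⊢ <;> omega
  · intro a b ha hab hb
    have e1 := h1.between a b ha hab hb
    have e2 := h2.between a b ha hab hb
    simp only [shiftOne_apply] at e1 e2 ⊢
    split_ifs at e1 e2 ⊢ <;> omega
  · have e1 := h1.top_le
    have e2 := h2.top_le
    simp only [shiftOne_apply] at e1 e2 ⊢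
    split_ifs at e1 e2 ⊢ <;> omega

/-! ### The squared matrix elements of the simple raising operators -/

/-- The factor of the squared matrix element of `f_n^+` that does not come from the rows of the
pattern. -/
noncomputable def edgeFactor (n p i : ℕ) (z : ℝ) : ℝ :=
  if Even i then evenInd n * (z + n) + 1 else (z - (p - 1)) * (oddInd n * (z + n) + 1)

/-- The numerator polynomial for the entry `i` of row `k`: its roots come from the rows `k ± 1`, and
for `k = n` from `edgeFactor` in place of the missing row `n + 1`. -/
noncomputable def rowPoly (n p k : ℕ) (m : ℕ → ℕ → ℤ) (i : ℕ) (z : ℝ) : ℝ :=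
  (if k = n then edgeFactor n p i z else ∏ q ∈ Finset.Icc 1 (k + 1), (z - l m q (k + 1))) *
    ∏ q ∈ Finset.Icc 1 (k - 1), (z - l m q (k - 1) + 1)

/-- The indices of row `k` that interact with `i`: all of them for `k < n`, those of the same parity
for `k = n`. -/
def rowClass (n k i : ℕ) : Finset ℕ :=
  (Finset.Icc 1 k).filter fun j => k = n → (Even j ↔ Even i)

/-- The square of the matrix element of the simple raising operator of row `k` between `m` and
`m + (i, k)`. -/
noncomputable def raiseSq (n p k : ℕ) (m : ℕ → ℕ → ℤ) (i : ℕ) : ℝ :=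
  -(rowPoly n p k m i (l m i k) /
    ∏ j ∈ (rowClass n k i).erase i, ((l m i k - l m j k) * (l m i k - l m j k + 1)))

/-- The dependence of `raiseSq n p k m i` on the entry `(j, r)` of the pattern, as a function of
`d = l m i k - l m j r`. -/
noncomputable def pairFactor (n i k j r : ℕ) (d : ℝ) : ℝ :=
  if r = k + 1 then d else if r + 1 = k then d + 1 else
    if r = k ∧ (k = n → (Even j ↔ Even i)) then (d * (d + 1))⁻¹ else 1

/-- Shifting another entry `(j, r)` of the pattern changes only one factor of
`raiseSq n p k m i`. -/
theorem raiseSq_shiftOne {n p : ℕ} (m : ℕ → ℕ → ℤ) {i k j r : ℕ}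
    (hj : 1 ≤ j) (hjr : j ≤ r) (hrn : r ≤ n) (hne : ¬ (i = j ∧ k = r)) :
    ∃ w : ℝ, ∀ t : ℤ, raiseSq n p k (shiftOne m t j r) i =
      w * pairFactor n i k j r (l m i k - l m j r - t) := by
  have hx : ∀ t : ℤ, l (shiftOne m t j r) i k = l m i k := by
    intro t; rw [l_shiftOne, if_neg hne, add_zero]
  have hrow : ∀ b, b ≠ r → ∀ (t : ℤ) a, l (shiftOne m t j r) a b = l m a b := by
    intro b hb t a; rw [l_shiftOne, if_neg (fun h => hb h.2), add_zero]
  have hself : ∀ t : ℤ, l (shiftOne m t j r) j r = l m j r + t := by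
    intro t; rw [l_shiftOne, if_pos ⟨rfl, rfl⟩]
  have hprod : ∀ (s : Finset ℕ) (g : ℝ → ℝ) (t : ℤ),
      ∏ q ∈ s.erase j, g (l (shiftOne m t j r) q r) = ∏ q ∈ s.erase j, g (l m q r) := by
    intro s g t
    refine Finset.prod_congr rfl fun q hq => ?_
    rw [l_shiftOne, if_neg (fun h => Finset.ne_of_mem_erase hq h.1), add_zero]
  have hmem : j ∈ Finset.Icc 1 r := Finset.mem_Icc.mpr ⟨hj, hjr⟩
  unfold raiseSq rowPoly pairFactor
  by_cases c1 : r = k + 1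
  · subst c1
    refine ⟨-((∏ q ∈ (Finset.Icc 1 (k + 1)).erase j, (l m i k - l m q (k + 1))) *
      (∏ q ∈ Finset.Icc 1 (k - 1), (l m i k - l m q (k - 1) + 1)) /
      ∏ j ∈ (rowClass n k i).erase i, ((l m i k - l m j k) * (l m i k - l m j k + 1))), ?_⟩
    intro t
    rw [if_neg (by omega : ¬ k = n), if_pos rfl, ← Finset.mul_prod_erase _ _ hmem]
    simp only [hx, hself, hrow k (by omega), hrow (k - 1) (by omega)]
    have e := hprod (Finset.Icc 1 (k + 1)) (fun z => l m i k - z) t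
    beta_reduce at e
    rw [e]
    ring
  by_cases c2 : r + 1 = k
  · subst c2
    refine ⟨-((if r + 1 = n then edgeFactor n p i (l m i (r + 1)) else
        ∏ q ∈ Finset.Icc 1 (r + 1 + 1), (l m i (r + 1) - l m q (r + 1 + 1))) *
      (∏ q ∈ (Finset.Icc 1 r).erase j, (l m i (r + 1) - l m q r + 1)) /
      ∏ j ∈ (rowClass n (r + 1) i).erase i,
        ((l m i (r + 1) - l m j (r + 1)) * (l m i (r + 1) - l m j (r + 1) + 1))), ?_⟩
    intro t
    rw [if_neg c1, if_pos rfl, Nat.add_sub_cancel, ← Finset.mul_prod_erase _ _ hmem]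
    simp only [hx, hself, hrow (r + 1) (by omega), hrow (r + 1 + 1) (by omega)]
    have e := hprod (Finset.Icc 1 r) (fun z => l m i (r + 1) - z + 1) t
    beta_reduce at e
    rw [e]
    ring
  by_cases c3 : r = k ∧ (k = n → (Even j ↔ Even i))
  · have c4 := c3
    obtain ⟨rfl, c3⟩ := c3
    have hji : j ∈ (rowClass n r i).erase i := by
      rw [Finset.mem_erase, rowClass, Finset.mem_filter]
      exact ⟨fun h => hne ⟨h.symm, rfl⟩, hmem, c3⟩
    refine ⟨-((if r = n then edgeFactor n p i (l m i r) else
        ∏ q ∈ Finset.Icc 1 (r + 1), (l m i r - l m q (r + 1))) *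
      (∏ q ∈ Finset.Icc 1 (r - 1), (l m i r - l m q (r - 1) + 1)) /
      ∏ a ∈ ((rowClass n r i).erase i).erase j,
        ((l m i r - l m a r) * (l m i r - l m a r + 1))), ?_⟩
    intro t
    rw [if_neg c1, if_neg c2, if_pos c4, ← Finset.mul_prod_erase _ _ hji]
    simp only [hx, hself, hrow (r - 1) (by omega), hrow (r + 1) (by omega)]
    have e := hprod ((rowClass n r i).erase i)
      (fun z => (l m i r - z) * (l m i r - z + 1)) t
    beta_reduce at e
    rw [e, ← sub_sub, div_mul_eq_div_div_swap, div_eq_mul_inv _ ((_ - _) * _)]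
    ring
  · refine ⟨-((if k = n then edgeFactor n p i (l m i k) else
        ∏ q ∈ Finset.Icc 1 (k + 1), (l m i k - l m q (k + 1))) *
      (∏ q ∈ Finset.Icc 1 (k - 1), (l m i k - l m q (k - 1) + 1)) /
      ∏ a ∈ (rowClass n k i).erase i,
        ((l m i k - l m a k) * (l m i k - l m a k + 1))), ?_⟩
    intro t
    rw [if_neg c1, if_neg c2, if_neg c3, mul_one]
    simp only [hx, hrow (k + 1) (by omega), hrow (k - 1) (by omega)]
    congr 2
    refine Finset.prod_congr rfl fun a ha => ?_
    have : l (shiftOne m t j r) a k = l m a k := by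
      rw [l_shiftOne, if_neg, add_zero]
      rintro ⟨rfl, rfl⟩
      exact c3 ⟨rfl, (Finset.mem_filter.mp (Finset.mem_of_mem_erase ha)).2⟩
    rw [this]

theorem pairFactor_diamond (n i k j r : ℕ) (d : ℝ) :
    pairFactor n i k j r d * pairFactor n j r i k (-d) =
      pairFactor n i k j r (d - 1) * pairFactor n j r i k (-d - 1) := by
  unfold pairFactor
  by_cases c1 : r = k + 1
  · subst c1; simp [show ¬ k = k + 1 + 1 by omega]; ring
  by_cases c2 : r + 1 = k
  · subst c2; simp [show ¬ r = r + 1 + 1 by omega]; ring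
  have c1' : ¬ k = r + 1 := fun h => c2 h.symm
  have c2' : ¬ k + 1 = r := fun h => c1 h.symm
  rw [if_neg c1, if_neg c2, if_neg c1', if_neg c2', if_neg c1, if_neg c2, if_neg c1', if_neg c2']
  by_cases c3 : r = k ∧ (k = n → (Even j ↔ Even i))
  · obtain ⟨rfl, c3⟩ := c3
    have c4 : r = r ∧ (r = n → (Even i ↔ Even j)) := ⟨rfl, fun h => (c3 h).symm⟩
    rw [if_pos ⟨rfl, c3⟩, if_pos c4, if_pos ⟨rfl, c3⟩, if_pos c4, ← mul_inv, ← mul_inv]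
    congr 1; ring
  · have c4 : ¬ (k = r ∧ (r = n → (Even i ↔ Even j))) := by
      rintro ⟨rfl, h⟩; exact c3 ⟨rfl, fun e => (h e).symm⟩
    rw [if_neg c3, if_neg c4, if_neg c3, if_neg c4]

/-- The identity behind the vanishing of all off-diagonal matrix elements of `[E_k, E_rᵀ]`. -/
theorem raiseSq_diamond {n p : ℕ} (q : ℕ → ℕ → ℤ) {i k j r : ℕ}
    (hi : 1 ≤ i) (hik : i ≤ k) (hkn : k ≤ n) (hj : 1 ≤ j) (hjr : j ≤ r) (hrn : r ≤ n)
    (hne : ¬ (i = j ∧ k = r)) :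
    raiseSq n p k q i * raiseSq n p r q j =
      raiseSq n p k (shiftOne q 1 j r) i * raiseSq n p r (shiftOne q 1 i k) j := by
  obtain ⟨w, hw⟩ := raiseSq_shiftOne (p := p) q hj hjr hrn hne
  obtain ⟨v, hv⟩ := raiseSq_shiftOne (p := p) q hi hik hkn
    (fun h => hne ⟨h.1.symm, h.2.symm⟩ : ¬ (j = i ∧ r = k))
  have w0 := hw 0
  have v0 := hv 0
  rw [shiftOne_zero] at w0 v0
  rw [w0, v0, hw 1, hv 1]
  have := pairFactor_diamond n i k j r (l q i k - l q j r)
  push_cast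
  rw [sub_zero, sub_zero, show l q j r - l q i k = -(l q i k - l q j r) by ring]
  linear_combination w * v * this

theorem prod_pos_of_sign {N a : ℕ} (ha : a ≤ N) (g : ℕ → ℝ)
    (hneg : ∀ q, 1 ≤ q → q ≤ a → g q < 0) (hpos : ∀ q, a < q → q ≤ N → 0 < g q) :
    0 < (-1) ^ a * ∏ q ∈ Finset.Icc 1 N, g q := by
  have h1 : ((-1 : ℝ)) ^ a = ∏ q ∈ Finset.Icc 1 N, if q ≤ a then -1 else 1 := by
    rw [Finset.prod_ite, Finset.prod_const_one, mul_one, Finset.prod_const]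
    congr 1
    have : (Finset.Icc 1 N).filter (fun q => q ≤ a) = Finset.Icc 1 a := by
      ext q; simp only [Finset.mem_filter, Finset.mem_Icc]; omega
    rw [this, Nat.card_Icc, Nat.add_sub_cancel]
  rw [h1, ← Finset.prod_mul_distrib]
  refine Finset.prod_pos fun q hq => ?_
  rw [Finset.mem_Icc] at hq
  split_ifs with h
  · have := hneg q hq.1 h; linarith
  · have := hpos q (by omega) hq.2; linarith

section Signs

variable {n p : ℕ} {m : ℕ → ℕ → ℤ} {i k : ℕ}

theorem l_cast (m : ℕ → ℕ → ℤ) (i k : ℕ) : l m i k = ((m i k - i : ℤ) : ℝ) := by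
  unfold l; push_cast; ring

theorem rowPoly_shiftOne (hk : 1 ≤ k) (t : ℤ) (j : ℕ) (z : ℝ) :
    rowPoly n p k (shiftOne m t j k) i z = rowPoly n p k m i z := by
  have hrow : ∀ b, b ≠ k → ∀ a, l (shiftOne m t j k) a b = l m a b := by
    intro b hb a; rw [l_shiftOne, if_neg (fun h => hb h.2), add_zero]
  unfold rowPoly
  simp only [hrow (k + 1) (by omega), hrow (k - 1) (by omega)]

/-- When the raised array is a pattern, the interlacing inequalities determine the sign of every
factor. -/
theorem raiseSq_pos (h : IsGZPattern n p m) (hi : 1 ≤ i) (hik : i ≤ k) (hkn : k ≤ n)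
    (h' : IsGZPattern n p (shiftOne m 1 i k)) : 0 < raiseSq n p k m i := by
  obtain ⟨c1, c2, c3⟩ := (h.raise_iff hi hik hkn).mp h'
  have hden : 0 < ∏ j ∈ (rowClass n k i).erase i,
      ((l m i k - l m j k) * (l m i k - l m j k + 1)) := by
    refine Finset.prod_pos fun j hj => ?_
    simp only [rowClass, Finset.mem_erase, Finset.mem_filter, Finset.mem_Icc] at hj
    obtain ⟨hji, ⟨hj1, hjk⟩, -⟩ := hj
    have e : (l m i k - l m j k) * (l m i k - l m j k + 1) =
        (((m i k - i - (m j k - j)) * (m i k - i - (m j k - j) + 1) : ℤ) : ℝ) := by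
      rw [l_cast, l_cast]; push_cast; ring
    rw [e]
    have : 0 < (m i k - i - (m j k - j)) * (m i k - i - (m j k - j) + 1) := by
      rcases lt_or_gt_of_ne hji with hlt | hgt
      · have s1 := c1 (by omega)
        have s2 := (h.between (i - 1) (k - 1) (by omega) (by omega) (by omega)).2
        rw [show k - 1 + 1 = k by omega] at s2
        have s3 := h.antitone (i := j) (j := i - 1) hj1 (by omega) (by omega) hkn
        apply mul_pos_of_neg_of_neg <;> omega
      · have s1 := h.antitone hi hgt.le hjk hkn
        apply mul_pos <;> omega
    exact_mod_cast this
  have hdn : 0 < (-1) ^ (i - 1) * ∏ q ∈ Finset.Icc 1 (k - 1), (l m i k - l m q (k - 1) + 1) := by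
    apply prod_pos_of_sign (by omega)
    · intro q hq1 hq2
      have s1 := c1 (by omega)
      have s2 := h.antitone (i := q) (j := i - 1) (k := k - 1) hq1 hq2 (by omega) (by omega)
      rw [l_cast, l_cast]
      have : m i k - i - (m q (k - 1) - q) + 1 < 0 := by omega
      exact_mod_cast this
    · intro q hq1 hq2
      have s2 := h.antitone (i := i) (j := q) (k := k - 1) hi (by omega) hq2 (by omega)
      have s1 := (h.between i (k - 1) hi (by omega) (by omega)).2
      rw [show k - 1 + 1 = k by omega] at s1
      rw [l_cast, l_cast]
      have : 0 < m i k - i - (m q (k - 1) - q) + 1 := by omega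
      exact_mod_cast this
  have hnum : rowPoly n p k m i (l m i k) < 0 := by
    unfold rowPoly
    by_cases hkn' : k = n
    · rw [if_pos hkn']
      subst hkn'
      have hxn : 0 ≤ l m i k + k := by
        rw [l_cast]
        have := h.nonneg i k
        have : 0 ≤ m i k - i + k := by omega
        exact_mod_cast this
      unfold edgeFactor
      split_ifs with hev
      · have ho : Odd (i - 1) := by
          rw [Nat.odd_sub hi]; simp [hev]
        rw [ho.neg_one_pow] at hdn
        have : 0 < evenInd k * (l m i k + k) + 1 := by
          unfold evenInd; split_ifs <;> nlinarith
        nlinarith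
      · have ho : Even (i - 1) := by
          rw [Nat.even_sub hi]; simp [hev]
        rw [ho.neg_one_pow] at hdn
        have e1 : 0 < oddInd k * (l m i k + k) + 1 := by
          unfold oddInd; split_ifs <;> nlinarith
        have e2 : l m i k - (p - 1) < 0 := by
          rw [l_cast]
          have : m i k - i - (p - 1) < 0 := by
            by_cases hi1 : i = 1
            · have := c3 rfl hi1; omega
            · have := h.le i k; omega
          exact_mod_cast this
        have := mul_neg_of_neg_of_pos e2 e1
        nlinarith
    · rw [if_neg hkn']
      have hup : 0 < (-1) ^ i * ∏ q ∈ Finset.Icc 1 (k + 1), (l m i k - l m q (k + 1)) := by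
        apply prod_pos_of_sign (by omega)
        · intro q hq1 hq2
          have s1 := c2 (by omega)
          have s2 := h.antitone (i := q) (j := i) (k := k + 1) hq1 hq2 (by omega) (by omega)
          rw [l_cast, l_cast]
          have : m i k - i - (m q (k + 1) - q) < 0 := by omega
          exact_mod_cast this
        · intro q hq1 hq2
          have s2 := h.antitone (i := i + 1) (j := q) (k := k + 1) (by omega) hq1 hq2 (by omega)
          have s1 := (h.between i k hi hik (by omega)).1
          rw [l_cast, l_cast]
          have : 0 < m i k - i - (m q (k + 1) - q) := by omega
          exact_mod_cast this
      have hs : ((-1 : ℝ)) ^ i * (-1) ^ (i - 1) = -1 := by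
        rw [← pow_add]
        exact Odd.neg_one_pow (by rw [Nat.odd_add]; rw [Nat.even_sub hi]; simp)
      have := mul_pos hup hdn
      rw [mul_mul_mul_comm, hs] at this
      linarith
  unfold raiseSq
  rw [← neg_div]
  exact div_pos (by linarith) hden

/-- When the raised array is not a pattern, one of the interlacing inequalities is an equality, and
the corresponding root of `rowPoly` is hit. The denominator may vanish as well; the quotient is then
`0` by the convention for division by zero. -/
theorem raiseSq_eq_zero (h : IsGZPattern n p m) (hi : 1 ≤ i) (hik : i ≤ k) (hkn : k ≤ n)
    (h' : ¬ IsGZPattern n p (shiftOne m 1 i k)) : raiseSq n p k m i = 0 := by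
  have : rowPoly n p k m i (l m i k) = 0 := by
    rw [h.raise_iff hi hik hkn] at h'
    unfold rowPoly
    by_cases c1 : 1 < i → m i k < m (i - 1) (k - 1)
    · apply mul_eq_zero_of_left
      by_cases c2 : k < n → m i k < m i (k + 1)
      · have c3 : ¬ (k = n → i = 1 → m i k < p) := fun c3 => h' ⟨c1, c2, c3⟩
        push Not at c3
        obtain ⟨rfl, rfl, c3⟩ := c3
        have := h.top_le
        have e : m 1 k = p := by omega
        rw [if_pos rfl, edgeFactor, if_neg (by decide), l, e]
        push_cast; ring
      · push Not at c2
        have := (h.between i k hi hik (by omega)).2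
        rw [if_neg (by omega)]
        apply Finset.prod_eq_zero (i := i) (by rw [Finset.mem_Icc]; omega)
        rw [l, l, show m i k = m i (k + 1) by omega, sub_self]
    · apply mul_eq_zero_of_right
      push Not at c1
      have := (h.between (i - 1) (k - 1) (by omega) (by omega) (by omega)).1
      rw [show i - 1 + 1 = i by omega, show k - 1 + 1 = k by omega] at this
      apply Finset.prod_eq_zero (i := i - 1) (by rw [Finset.mem_Icc]; omega)
      rw [l, l, show m i k = m (i - 1) (k - 1) by omega, Nat.cast_sub hi]
      push_cast; ring
  unfold raiseSq
  rw [this]; simp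

theorem raiseSq_nonneg (h : IsGZPattern n p m) (hi : 1 ≤ i) (hik : i ≤ k) (hkn : k ≤ n) :
    0 ≤ raiseSq n p k m i := by
  by_cases h' : IsGZPattern n p (shiftOne m 1 i k)
  · exact (raiseSq_pos h hi hik hkn h').le
  · exact (raiseSq_eq_zero h hi hik hkn h').ge

theorem raiseSq_lower_eq (hk : 1 ≤ k) : raiseSq n p k (shiftOne m (-1) i k) i =
    -(rowPoly n p k m i (l m i k - 1) /
      ∏ j ∈ (rowClass n k i).erase i, ((l m i k - 1 - l m j k) * (l m i k - l m j k))) := by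
  unfold raiseSq
  rw [rowPoly_shiftOne hk]
  have : l (shiftOne m (-1) i k) i k = l m i k - 1 := by
    rw [l_shiftOne, if_pos ⟨rfl, rfl⟩]; push_cast; ring
  rw [this]
  congr 2
  refine Finset.prod_congr rfl fun j hj => ?_
  rw [l_shiftOne, if_neg (fun h => Finset.ne_of_mem_erase hj h.1)]
  ring

/-- When `m` cannot be lowered at `(i, k)`, the formal matrix element into `m` vanishes. -/
theorem raiseSq_lower_eq_zero (h : IsGZPattern n p m) (hi : 1 ≤ i) (hik : i ≤ k) (hkn : k ≤ n)
    (h' : ¬ IsGZPattern n p (shiftOne m (-1) i k)) :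
    raiseSq n p k (shiftOne m (-1) i k) i = 0 := by
  have : rowPoly n p k m i (l m i k - 1) = 0 := by
    rw [h.lower_iff hi hik hkn] at h'
    unfold rowPoly
    by_cases c1 : i < k → m i (k - 1) < m i k
    · apply mul_eq_zero_of_left
      by_cases c2 : k < n → m (i + 1) (k + 1) < m i k
      · have c3 : ¬ (k = n → i = n → 0 < m i k) := fun c3 => h' ⟨c1, c2, c3⟩
        push Not at c3
        obtain ⟨rfl, rfl, c3⟩ := c3
        have := h.nonneg i i
        have e : m i i = 0 := by omega
        rw [if_pos rfl, edgeFactor, l, e]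
        split_ifs with hev
        · rw [evenInd, if_pos hev]; push_cast; ring
        · rw [oddInd, if_pos (Nat.not_even_iff_odd.mp hev)]; push_cast; ring
      · push Not at c2
        have := (h.between i k hi hik (by omega)).1
        rw [if_neg (by omega)]
        apply Finset.prod_eq_zero (i := i + 1) (by rw [Finset.mem_Icc]; omega)
        rw [l, l, show m i k = m (i + 1) (k + 1) by omega]
        push_cast; ring
    · apply mul_eq_zero_of_right
      push Not at c1
      have := (h.between i (k - 1) hi (by omega) (by omega)).2
      rw [show k - 1 + 1 = k by omega] at this
      apply Finset.prod_eq_zero (i := i) (by rw [Finset.mem_Icc]; omega)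
      rw [l, l, show m i k = m i (k - 1) by omega]
      ring
  rw [raiseSq_lower_eq (by omega), this]; simp

end Signs

/-! ### The diagonal matrix elements of the commutators -/

/-- The residue identity for the indices of one class, which share the numerator `∏ (z - a)`,
`a ∈ A`. -/
theorem sum_raiseSq_class {n p k : ℕ} {m : ℕ → ℕ → ℤ} (hk : 1 ≤ k) (s : Finset ℕ)
    (hs : ∀ i ∈ s, rowClass n k i = s) (A : Multiset ℝ)
    (hA : ∀ i ∈ s, ∀ z, rowPoly n p k m i z = (A.map (fun a => z - a)).prod)
    (hcard : Multiset.card A = 2 * s.card) (hinj : Set.InjOn (fun i => l m i k) s)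
    (hcol : ∀ i ∈ s, ∀ j ∈ s, l m i k = l m j k - 1 → 2 ≤ A.count (l m i k)) :
    ∑ i ∈ s, (raiseSq n p k (shiftOne m (-1) i k) i - raiseSq n p k m i) =
      ∑ i ∈ s, (2 * l m i k - 1) - A.sum := by
  rw [← sum_ladder_residues s (fun i => l m i k) A hcard hinj hcol]
  refine Finset.sum_congr rfl fun i hi => ?_
  rw [raiseSq_lower_eq hk, raiseSq, hA i hi, hA i hi, hs i hi]
  ring

/-- The eigenvalue of `h_j` on the basis vector of the pattern `m`. -/
noncomputable def weightVal (p : ℕ) (m : ℕ → ℕ → ℤ) (j : ℕ) : ℝ :=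
  -(p : ℝ) / 2 + ∑ q ∈ Finset.Icc 1 j, (m q j : ℝ) - ∑ q ∈ Finset.Icc 1 (j - 1), (m q (j - 1) : ℝ)

theorem sum_l (m : ℕ → ℕ → ℤ) (N k : ℕ) : ∑ q ∈ Finset.Icc 1 N, l m q k =
    ∑ q ∈ Finset.Icc 1 N, (m q k : ℝ) - N * (N + 1) / 2 := by
  unfold l
  rw [Finset.sum_sub_distrib]
  congr 1
  induction N with
  | zero => simp
  | succ N ih => rw [Finset.sum_Icc_succ_top (by omega), ih]; push_cast; ring

section RowSums

variable {n p : ℕ} {m : ℕ → ℕ → ℤ} {k : ℕ}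

theorem IsGZPattern.l_lt (h : IsGZPattern n p m) {i j : ℕ} (hi : 1 ≤ i) (hij : i < j)
    (hjk : j ≤ k) (hkn : k ≤ n) : l m j k ≤ l m i k - ((j : ℝ) - i) := by
  have := h.antitone hi hij.le hjk hkn
  have : ((m j k : ℤ) : ℝ) ≤ m i k := by exact_mod_cast this
  unfold l; linarith

theorem IsGZPattern.l_injOn (h : IsGZPattern n p m) (hkn : k ≤ n) :
    Set.InjOn (fun i => l m i k) (Finset.Icc 1 k) := by
  intro i hi j hj hij
  simp only [Finset.coe_Icc, Set.mem_Icc] at hi hj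
  simp only at hij
  rcases lt_trichotomy i j with hlt | rfl | hlt
  · have := h.l_lt hi.1 hlt hj.2 hkn
    have : (i : ℝ) < j := by exact_mod_cast hlt
    linarith
  · rfl
  · have := h.l_lt hj.1 hlt hi.2 hkn
    have : (j : ℝ) < i := by exact_mod_cast hlt
    linarith

/-- The diagonal matrix elements of `[E_k, E_kᵀ] = h_k - h_{k+1}` for `k < n`. -/
theorem sum_raiseSq_of_lt (h : IsGZPattern n p m) (hk : 1 ≤ k) (hkn : k < n) :
    ∑ i ∈ Finset.Icc 1 k, (raiseSq n p k (shiftOne m (-1) i k) i - raiseSq n p k m i) =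
      weightVal p m k - weightVal p m (k + 1) := by
  rw [sum_raiseSq_class hk (Finset.Icc 1 k)
    (fun i _ => by
      unfold rowClass; rw [Finset.filter_true_of_mem]; intro _ _ e; omega)
    ((Finset.Icc 1 (k + 1)).val.map (fun q => l m q (k + 1)) +
      (Finset.Icc 1 (k - 1)).val.map (fun q => l m q (k - 1) - 1))
    (fun i hi z => by
      rw [rowPoly, if_neg (by omega), Multiset.map_add, Multiset.prod_add, Multiset.map_map,
        Multiset.map_map]
      congr 1
      refine Finset.prod_congr rfl fun q _ => ?_
      simp only [Function.comp]; ring)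
    (by simp; omega) (h.l_injOn hkn.le)
    (by
      intro i hi j hj hij
      rw [Finset.mem_Icc] at hi hj
      have hlt : j < i := by
        rcases lt_trichotomy i j with hlt | rfl | hlt
        · have := h.l_lt hi.1 hlt hj.2 hkn.le
          have : (i : ℝ) < j := by exact_mod_cast hlt
          linarith
        · linarith
        · exact hlt
      have hij' : m i k - i = m j k - j - 1 := by
        rw [l_cast, l_cast] at hij; exact_mod_cast hij
      have s1 := h.antitone hj.1 hlt.le hi.2 hkn.le
      -- nodes collide only for neighbours with equal entries, which force the entries of the rows
      -- `k + 1` and `k - 1` between them to be equal too, and these give the double root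
      obtain rfl : i = j + 1 := by omega
      have s2 := h.between j k hj.1 hj.2 hkn
      have s3 := h.between (j + 1) k (by omega) (by omega) hkn
      have s4 := h.between j (k - 1) hj.1 (by omega) (by omega)
      rw [show k - 1 + 1 = k by omega] at s4
      push_cast at hij'
      rw [Multiset.count_add]
      have c1 : 0 < Multiset.count (l m (j + 1) k)
          ((Finset.Icc 1 (k + 1)).val.map (fun q => l m q (k + 1))) := by
        rw [Multiset.count_pos, Multiset.mem_map]
        refine ⟨j + 1, by simp; omega, ?_⟩
        rw [l, l, show m (j + 1) (k + 1) = m (j + 1) k by omega]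
      have c2 : 0 < Multiset.count (l m (j + 1) k)
          ((Finset.Icc 1 (k - 1)).val.map (fun q => l m q (k - 1) - 1)) := by
        rw [Multiset.count_pos, Multiset.mem_map]
        refine ⟨j, by simp; omega, ?_⟩
        rw [l, l, show m j (k - 1) = m (j + 1) k by omega]
        push_cast; ring
      omega)]
  have e1 : ((Finset.Icc 1 (k + 1)).val.map (fun q => l m q (k + 1))).sum =
      ∑ q ∈ Finset.Icc 1 (k + 1), l m q (k + 1) := rfl
  have e2 : ((Finset.Icc 1 (k - 1)).val.map (fun q => l m q (k - 1) - 1)).sum =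
      ∑ q ∈ Finset.Icc 1 (k - 1), (l m q (k - 1) - 1) := rfl
  rw [Multiset.sum_add, e1, e2, Finset.sum_sub_distrib, Finset.sum_sub_distrib, ← Finset.mul_sum,
    sum_l, sum_l, sum_l]
  unfold weightVal
  simp only [Finset.sum_const, Nat.card_Icc, Nat.add_sub_cancel, nsmul_eq_mul, mul_one]
  rw [Nat.cast_sub hk]
  push_cast; ring

theorem card_filter_even_Icc (n : ℕ) :
    ((Finset.Icc 1 n).filter fun j => Even j).card = n / 2 ∧
      ((Finset.Icc 1 n).filter fun j => ¬ Even j).card = (n + 1) / 2 := by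
  induction n with
  | zero => simp
  | succ n ih =>
    have : Finset.Icc 1 (n + 1) = insert (n + 1) (Finset.Icc 1 n) := by
      ext q; simp only [Finset.mem_insert, Finset.mem_Icc]; omega
    rw [this, Finset.filter_insert, Finset.filter_insert]
    split_ifs with hev
    · rw [Finset.card_insert_of_notMem (by simp), ih.1, ih.2]
      obtain ⟨c, hc⟩ := hev; omega
    · rw [Finset.card_insert_of_notMem (by simp), ih.1, ih.2]
      obtain ⟨c, hc⟩ := Nat.not_even_iff_odd.mp hev; omega

/-- The diagonal matrix elements of `[E_n, E_nᵀ] = 2 h_n`: the residue identity is applied to the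
even and to the odd indices separately. -/
theorem sum_raiseSq_last (h : IsGZPattern n p m) (hn : 1 ≤ n) :
    ∑ i ∈ Finset.Icc 1 n, (raiseSq n p n (shiftOne m (-1) i n) i - raiseSq n p n m i) =
      2 * weightVal p m n := by
  -- neighbours have different parity, so that nodes of one class never collide
  have hnocol : ∀ i ∈ Finset.Icc 1 n, ∀ j ∈ Finset.Icc 1 n, (Even j ↔ Even i) →
      l m i n ≠ l m j n - 1 := by
    intro i hi j hj hev hij
    rw [Finset.mem_Icc] at hi hj
    have hij' : m i n - i = m j n - j - 1 := by
      rw [l_cast, l_cast] at hij; exact_mod_cast hij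
    rcases lt_trichotomy i j with hlt | rfl | hlt
    · have := h.antitone hi.1 hlt.le hj.2 le_rfl; omega
    · omega
    · have := h.antitone hj.1 hlt.le hi.2 le_rfl
      obtain rfl : i = j + 1 := by omega
      rw [Nat.even_add_one] at hev
      tauto
  obtain ⟨hce, hco⟩ := card_filter_even_Icc n
  rw [← Finset.sum_filter_add_sum_filter_not _ (fun j => Even j)]
  set dn : Multiset ℝ := (Finset.Icc 1 (n - 1)).val.map (fun q => l m q (n - 1) - 1) with hdn
  have hdnP : ∀ z : ℝ, (dn.map (fun a => z - a)).prod =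
      ∏ q ∈ Finset.Icc 1 (n - 1), (z - l m q (n - 1) + 1) := by
    intro z
    rw [hdn, Multiset.map_map]
    refine Finset.prod_congr rfl fun q _ => ?_
    simp only [Function.comp]; ring
  have hdnC : Multiset.card dn = n - 1 := by simp [hdn]
  have e2 : dn.sum = ∑ q ∈ Finset.Icc 1 (n - 1), (l m q (n - 1) - 1) := rfl
  rw [sum_raiseSq_class hn ((Finset.Icc 1 n).filter fun j => Even j)
    (fun i hi => by
      rw [Finset.mem_filter] at hi
      unfold rowClass; refine Finset.filter_congr fun j _ => ?_
      simp [hi.2])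
    ((if Even n then {-((n : ℝ) + 1)} else 0) + dn)
    (fun i hi z => by
      rw [Finset.mem_filter] at hi
      rw [rowPoly, if_pos rfl, edgeFactor, if_pos hi.2, Multiset.map_add, Multiset.prod_add, hdnP,
        evenInd]
      congr 1
      split_ifs <;> simp; ring)
    (by
      rw [hce, Multiset.card_add, hdnC]
      split_ifs with hev
      · obtain ⟨c, hc⟩ := hev; simp; omega
      · obtain ⟨c, hc⟩ := Nat.not_even_iff_odd.mp hev; simp; omega)
    ((h.l_injOn le_rfl).mono (by intro x hx; exact Finset.mem_of_mem_filter x hx))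
    (by
      intro i hi j hj hij
      rw [Finset.mem_filter] at hi hj
      exact absurd hij (hnocol i hi.1 j hj.1 (by simp [hi.2, hj.2]))),
    sum_raiseSq_class hn ((Finset.Icc 1 n).filter fun j => ¬ Even j)
    (fun i hi => by
      rw [Finset.mem_filter] at hi
      unfold rowClass; refine Finset.filter_congr fun j _ => ?_
      simp [hi.2])
    ((((p : ℝ) - 1) ::ₘ if Even n then 0 else {-((n : ℝ) + 1)}) + dn)
    (fun i hi z => by
      rw [Finset.mem_filter] at hi
      rw [rowPoly, if_pos rfl, edgeFactor, if_neg hi.2, Multiset.map_add, Multiset.prod_add, hdnP,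
        oddInd, Multiset.map_cons, Multiset.prod_cons]
      congr 2
      by_cases hev : Even n
      · rw [if_neg (Nat.not_odd_iff_even.mpr hev), if_pos hev]; simp
      · rw [if_pos (Nat.not_even_iff_odd.mp hev), if_neg hev]; simp; ring)
    (by
      rw [hco, Multiset.card_add, hdnC]
      split_ifs with hev
      · obtain ⟨c, hc⟩ := hev; simp; omega
      · obtain ⟨c, hc⟩ := Nat.not_even_iff_odd.mp hev; simp; omega)
    ((h.l_injOn le_rfl).mono (by intro x hx; exact Finset.mem_of_mem_filter x hx))
    (by
      intro i hi j hj hij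
      rw [Finset.mem_filter] at hi hj
      exact absurd hij (hnocol i hi.1 j hj.1 (by simp [hi.2, hj.2])))]
  have e3 : ∀ x y c d : ℝ, x - c + (y - d) = x + y - (c + d) := by intros; ring
  rw [e3, Finset.sum_filter_add_sum_filter_not, Multiset.sum_add, Multiset.sum_add, e2,
    Finset.sum_sub_distrib, Finset.sum_sub_distrib, ← Finset.mul_sum, sum_l, sum_l]
  unfold weightVal
  have e4 : (if Even n then ({-((n : ℝ) + 1)} : Multiset ℝ) else 0).sum +
      (((p : ℝ) - 1) ::ₘ if Even n then (0 : Multiset ℝ) else {-((n : ℝ) + 1)}).sum =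
      (p : ℝ) - 1 - (n + 1) := by
    split_ifs <;> simp <;> ring
  simp only [Finset.sum_const, Nat.card_Icc, Nat.add_sub_cancel, nsmul_eq_mul, mul_one]
  rw [Nat.cast_sub hn]
  push_cast
  linear_combination -e4

end RowSums

/-! ### The model: matrices indexed by patterns -/

section Model

open Matrix

/-- Matrices and bases indexed by patterns require decidable equality. -/
noncomputable instance (n p : ℕ) : DecidableEq (GZPattern n p) := Classical.decEq _

open Classical in
/-- The matrix of the simple raising operator of row `k`. -/
noncomputable def raiseMat (n p k : ℕ) : Matrix (GZPattern n p) (GZPattern n p) ℝ :=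
  Matrix.of fun m' m => ∑ i ∈ Finset.Icc 1 k,
    if m'.1 = shiftOne m.1 1 i k then √(raiseSq n p k m.1 i) else 0

/-- The matrix of the Cartan element `h_j`. -/
noncomputable def weightMat (n p j : ℕ) : Matrix (GZPattern n p) (GZPattern n p) ℝ :=
  Matrix.diagonal fun m => weightVal p m.1 j

/-- The iterated commutator `[E (n-d), [E (n-d+1), …, E n]]`. -/
noncomputable def vectorMatAux (n p : ℕ) : ℕ → Matrix (GZPattern n p) (GZPattern n p) ℝ
  | 0 => raiseMat n p n
  | d + 1 => ⁅raiseMat n p (n - (d + 1)), vectorMatAux n p d⁆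

/-- The matrix of `f_k^+`. -/
noncomputable def vectorMat (n p k : ℕ) : Matrix (GZPattern n p) (GZPattern n p) ℝ :=
  vectorMatAux n p (n - k)

variable {n p : ℕ}

open Classical in
/-- For two different entries, the products of matrix elements along the two ways from `m` to `m'`,
lowering first or raising first, agree. -/
theorem sum_diamond {i k j r : ℕ} (hi : 1 ≤ i) (hik : i ≤ k) (hkn : k ≤ n) (hj : 1 ≤ j)
    (hjr : j ≤ r) (hrn : r ≤ n) (hne : ¬ (i = j ∧ k = r)) (m' m : GZPattern n p) :
    ∑ q : GZPattern n p, (if m'.1 = shiftOne q.1 1 i k then √(raiseSq n p k q.1 i) else 0) *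
        (if m.1 = shiftOne q.1 1 j r then √(raiseSq n p r q.1 j) else 0) =
      ∑ q : GZPattern n p, (if q.1 = shiftOne m'.1 1 j r then √(raiseSq n p r m'.1 j) else 0) *
        (if q.1 = shiftOne m.1 1 i k then √(raiseSq n p k m.1 i) else 0) := by
  by_cases hE : shiftOne m'.1 1 j r = shiftOne m.1 1 i k
  · set q0 := shiftOne m'.1 (-1) i k with hq0
    have e1 : m'.1 = shiftOne q0 1 i k := shiftOne_neg_one_eq_iff.mpr rfl
    have e2 : m.1 = shiftOne q0 1 j r := by
      rw [hq0, shiftOne_shiftOne_comm, hE, shiftOne_shiftOne_self]; simp [shiftOne_zero]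
    obtain ⟨v1, v2⟩ := isGZPattern_diamond hne (e1 ▸ m'.2) (e2 ▸ m.2)
    rw [← e1] at v2
    rw [Finset.sum_eq_single ⟨q0, v1⟩, Finset.sum_eq_single ⟨_, v2⟩, if_pos e1, if_pos e2,
      if_pos rfl, if_pos hE, ← Real.sqrt_mul (raiseSq_nonneg v1 hi hik hkn),
      ← Real.sqrt_mul (raiseSq_nonneg m'.2 hj hjr hrn),
      raiseSq_diamond q0 hi hik hkn hj hjr hrn hne, ← e1, ← e2, mul_comm]
    · intro q _ hq
      rw [if_neg (fun h => hq (Subtype.ext h)), zero_mul]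
    · exact fun h => absurd (Finset.mem_univ _) h
    · intro q _ hq
      rw [if_neg (fun h => hq (Subtype.ext (shiftOne_neg_one_eq_iff.mp h))), zero_mul]
    · exact fun h => absurd (Finset.mem_univ _) h
  · rw [Finset.sum_eq_zero, Finset.sum_eq_zero]
    · intro q _
      split_ifs with h1 h2
      · exact absurd (h1.symm.trans h2) hE
      · simp
      · simp
      · simp
    · intro q _
      split_ifs with h1 h2
      · rw [h1, h2] at hE
        exact absurd (shiftOne_shiftOne_comm _ _ _ _ _ _ _) hE
      · simp
      · simp
      · simp

open Classical in
theorem raiseMat_mul_transpose (k r : ℕ) (m' m : GZPattern n p) :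
    (raiseMat n p k * (raiseMat n p r)ᵀ) m' m = ∑ i ∈ Finset.Icc 1 k, ∑ j ∈ Finset.Icc 1 r,
      ∑ q : GZPattern n p, (if m'.1 = shiftOne q.1 1 i k then √(raiseSq n p k q.1 i) else 0) *
        (if m.1 = shiftOne q.1 1 j r then √(raiseSq n p r q.1 j) else 0) := by
  simp only [mul_apply, transpose_apply, raiseMat, of_apply, Finset.sum_mul_sum]
  rw [Finset.sum_comm]
  exact Finset.sum_congr rfl fun i _ => Finset.sum_comm

open Classical in
theorem transpose_mul_raiseMat (k r : ℕ) (m' m : GZPattern n p) :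
    ((raiseMat n p r)ᵀ * raiseMat n p k) m' m = ∑ i ∈ Finset.Icc 1 k, ∑ j ∈ Finset.Icc 1 r,
      ∑ q : GZPattern n p, (if q.1 = shiftOne m'.1 1 j r then √(raiseSq n p r m'.1 j) else 0) *
        (if q.1 = shiftOne m.1 1 i k then √(raiseSq n p k m.1 i) else 0) := by
  simp only [mul_apply, transpose_apply, raiseMat, of_apply, Finset.sum_mul_sum]
  rw [Finset.sum_comm, Finset.sum_congr rfl fun j _ => Finset.sum_comm, Finset.sum_comm]

theorem lie_raiseMat_of_ne {k r : ℕ} (hkn : k ≤ n) (hrn : r ≤ n) (hne : k ≠ r) :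
    ⁅raiseMat n p k, (raiseMat n p r)ᵀ⁆ = 0 := by
  ext m' m
  rw [Ring.lie_def, Matrix.sub_apply, raiseMat_mul_transpose, transpose_mul_raiseMat,
      Matrix.zero_apply,
    sub_eq_zero]
  refine Finset.sum_congr rfl fun i hi => Finset.sum_congr rfl fun j hj => ?_
  rw [Finset.mem_Icc] at hi hj
  exact sum_diamond hi.1 hi.2 hkn hj.1 hj.2 hrn (fun h => hne h.2) m' m

theorem lie_raiseMat_self {k : ℕ} (hkn : k ≤ n) :
    ⁅raiseMat n p k, (raiseMat n p k)ᵀ⁆ = Matrix.diagonal fun m => ∑ i ∈ Finset.Icc 1 k,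
      (raiseSq n p k (shiftOne m.1 (-1) i k) i - raiseSq n p k m.1 i) := by
  classical
  ext m' m
  rw [Ring.lie_def, Matrix.sub_apply, raiseMat_mul_transpose, transpose_mul_raiseMat,
    ← Finset.sum_sub_distrib, diagonal_apply]
  have key : ∀ i ∈ Finset.Icc 1 k, (∑ j ∈ Finset.Icc 1 k,
      ∑ q : GZPattern n p, (if m'.1 = shiftOne q.1 1 i k then √(raiseSq n p k q.1 i) else 0) *
        (if m.1 = shiftOne q.1 1 j k then √(raiseSq n p k q.1 j) else 0)) -
      (∑ j ∈ Finset.Icc 1 k,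
      ∑ q : GZPattern n p, (if q.1 = shiftOne m'.1 1 j k then √(raiseSq n p k m'.1 j) else 0) *
        (if q.1 = shiftOne m.1 1 i k then √(raiseSq n p k m.1 i) else 0)) =
      if m' = m then raiseSq n p k (shiftOne m'.1 (-1) i k) i - raiseSq n p k m'.1 i else 0 := by
    intro i hi
    rw [← Finset.sum_sub_distrib, Finset.sum_eq_single i]
    · rw [Finset.mem_Icc] at hi
      have A1 : ∑ q : GZPattern n p,
          (if m'.1 = shiftOne q.1 1 i k then √(raiseSq n p k q.1 i) else 0) *
          (if m.1 = shiftOne q.1 1 i k then √(raiseSq n p k q.1 i) else 0) =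
          if m' = m then raiseSq n p k (shiftOne m'.1 (-1) i k) i else 0 := by
        by_cases hv : IsGZPattern n p (shiftOne m'.1 (-1) i k)
        · rw [Finset.sum_eq_single ⟨_, hv⟩, if_pos (shiftOne_neg_one_eq_iff.mpr rfl),
            ← shiftOne_neg_one_eq_iff.mpr rfl]
          · by_cases hm : m' = m
            · rw [if_pos hm, if_pos (by rw [hm]), Real.mul_self_sqrt
                (raiseSq_nonneg hv hi.1 hi.2 hkn)]
            · rw [if_neg hm, if_neg (fun h => hm (Subtype.ext h.symm)), mul_zero]
          · intro q _ hq
            rw [if_neg, zero_mul]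
            exact fun h => hq (Subtype.ext (shiftOne_neg_one_eq_iff.mp h))
          · exact fun h => absurd (Finset.mem_univ _) h
        · rw [raiseSq_lower_eq_zero m'.2 hi.1 hi.2 hkn hv, ite_self]
          refine Finset.sum_eq_zero fun q _ => ?_
          rw [if_neg, zero_mul]
          intro h
          exact hv (shiftOne_neg_one_eq_iff.mp h ▸ q.2)
      have A2 : ∑ q : GZPattern n p,
          (if q.1 = shiftOne m'.1 1 i k then √(raiseSq n p k m'.1 i) else 0) *
          (if q.1 = shiftOne m.1 1 i k then √(raiseSq n p k m.1 i) else 0) =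
          if m' = m then raiseSq n p k m'.1 i else 0 := by
        by_cases hv : IsGZPattern n p (shiftOne m'.1 1 i k)
        · rw [Finset.sum_eq_single ⟨_, hv⟩, if_pos rfl]
          · by_cases hm : m' = m
            · subst hm
              rw [if_pos rfl, if_pos rfl, Real.mul_self_sqrt (raiseSq_nonneg m'.2 hi.1 hi.2 hkn)]
            · rw [if_neg hm, if_neg, mul_zero]
              intro h
              apply hm
              apply Subtype.ext
              rw [shiftOne_neg_one_eq_iff.mp h, shiftOne_shiftOne_self]
              simp [shiftOne_zero]
          · intro q _ hq
            rw [if_neg (fun h => hq (Subtype.ext h)), zero_mul]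
          · exact fun h => absurd (Finset.mem_univ _) h
        · rw [raiseSq_eq_zero m'.2 hi.1 hi.2 hkn hv, ite_self]
          simp
      rw [A1, A2]
      split_ifs <;> simp
    · intro j hj hji
      rw [Finset.mem_Icc] at hi hj
      rw [sub_eq_zero]
      exact sum_diamond hi.1 hi.2 hkn hj.1 hj.2 hkn (fun h => hji h.1.symm) m' m
    · intro h; exact absurd hi h
  rw [Finset.sum_congr rfl key]
  split_ifs with h
  · subst h; rfl
  · simp

theorem weightVal_shiftOne {m : ℕ → ℕ → ℤ} {i k j : ℕ} (hi : 1 ≤ i) (hik : i ≤ k) (hj : 1 ≤ j)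
    (t : ℤ) : weightVal p (shiftOne m t i k) j =
      weightVal p m j + t * ((if j = k then 1 else 0) - (if j = k + 1 then 1 else 0)) := by
  have key : ∀ b, ∑ q ∈ Finset.Icc 1 b, (shiftOne m t i k q b : ℝ) =
      ∑ q ∈ Finset.Icc 1 b, (m q b : ℝ) + if b = k then (t : ℝ) else 0 := by
    intro b
    simp only [shiftOne_apply, Int.cast_add, Finset.sum_add_distrib]
    congr 1
    by_cases hb : b = k
    · subst hb
      simp [Finset.sum_ite_eq', hi, hik]
    · simp [hb]
  unfold weightVal
  rw [key, key]
  by_cases h1 : j = k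
  · subst h1
    rw [if_pos rfl, if_neg (by omega), if_pos rfl, if_neg (by omega)]; ring
  · by_cases h2 : j = k + 1
    · subst h2; simp; ring
    · rw [if_neg h1, if_neg (by omega), if_neg h1, if_neg h2]; ring

theorem lie_weightMat_raiseMat {j k : ℕ} (hj : 1 ≤ j) :
    ⁅weightMat n p j, raiseMat n p k⁆ =
      ((if j = k then (1 : ℝ) else 0) - (if j = k + 1 then 1 else 0)) • raiseMat n p k := by
  classical
  ext m' m
  rw [Ring.lie_def, Matrix.sub_apply, weightMat, diagonal_mul, mul_diagonal, Matrix.smul_apply,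
      raiseMat,
    of_apply, mul_comm, ← mul_sub, smul_eq_mul, Finset.sum_mul, Finset.mul_sum]
  refine Finset.sum_congr rfl fun i hi => ?_
  rw [Finset.mem_Icc] at hi
  by_cases h : m'.1 = shiftOne m.1 1 i k
  · rw [if_pos h, h, weightVal_shiftOne hi.1 hi.2 hj]
    push_cast; ring
  · rw [if_neg h]; simp

/-- The raising matrices satisfy the commutation relations of the simple root vectors. -/
theorem isChevalleySystem_model {n : ℕ} (hn : 1 ≤ n) (p : ℕ) :
    IsChevalleySystem n (raiseMat n p) (weightMat n p) (vectorMat n p) where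
  comm k l _ hkn _ hln hne := lie_raiseMat_of_ne hkn hln hne
  self k hk hkn := by
    rw [lie_raiseMat_self hkn.le, weightMat, weightMat, diagonal_sub]
    congr 1
    funext m
    exact sum_raiseSq_of_lt m.2 hk hkn
  last := by
    rw [lie_raiseMat_self le_rfl, weightMat, ← diagonal_smul]
    congr 1
    funext m
    exact sum_raiseSq_last m.2 hn
  weight j k hj _ _ _ := lie_weightMat_raiseMat hj
  weight_last j hj hjn := by
    rw [lie_weightMat_raiseMat hj, if_neg (by omega : ¬ j = n + 1), sub_zero]
  symm j := diagonal_transpose _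
  a_last := by rw [vectorMat, Nat.sub_self]; rfl
  a_rec k _ hkn := by
    obtain ⟨d, hd⟩ : ∃ d, n - k = d + 1 := ⟨n - k - 1, by omega⟩
    rw [vectorMat, hd, vectorMatAux, vectorMat, show n - (d + 1) = k by omega,
      show n - (k + 1) = d by omega]

end Model

/-! ### Index tuples -/

namespace RowPath

theorem idx_of_mem {j n : ℕ} (i : RowPath j n) {a : ℕ} (h : a ∈ Finset.Icc j n) :
    i.idx a = (i ⟨a, h⟩ : ℕ) := by
  unfold idx; rw [dif_pos h]

theorem idx_mem {j n : ℕ} (i : RowPath j n) {a : ℕ} (h : a ∈ Finset.Icc j n) :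
    i.idx a ∈ Finset.Icc 1 a := by
  rw [idx_of_mem i h]; exact (i ⟨a, h⟩).2

theorem ext_idx {j n : ℕ} {i i' : RowPath j n} (h : ∀ a ∈ Finset.Icc j n, i.idx a = i'.idx a) :
    i = i' := by
  funext ⟨a, ha⟩
  apply Subtype.ext
  have := h a ha
  rwa [idx_of_mem i ha, idx_of_mem i' ha] at this

/-- The index tuple with prescribed entries. -/
def ofFun {j n : ℕ} (g : ℕ → ℕ) (hg : ∀ a ∈ Finset.Icc j n, g a ∈ Finset.Icc 1 a) : RowPath j n :=
  fun a => ⟨g a, hg a a.2⟩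

theorem idx_ofFun {j n : ℕ} (g : ℕ → ℕ) (hg : ∀ a ∈ Finset.Icc j n, g a ∈ Finset.Icc 1 a) {a : ℕ}
    (ha : a ∈ Finset.Icc j n) : (ofFun g hg).idx a = g a := by
  rw [idx_of_mem _ ha]; rfl

/-- Extension of an index tuple `(i_n, …, i_{j+1})` by an entry `i_j`. -/
def cons {j n : ℕ} (i' : Finset.Icc 1 j) (i : RowPath (j + 1) n) : RowPath j n :=
  ofFun (fun a => if a = j then i' else i.idx a) (by
    intro a ha
    rw [Finset.mem_Icc] at ha
    split_ifs with h
    · rw [h]; exact i'.2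
    · exact i.idx_mem (by rw [Finset.mem_Icc]; omega))

theorem idx_cons_self {j n : ℕ} (hjn : j ≤ n) (i' : Finset.Icc 1 j) (i : RowPath (j + 1) n) :
    (cons i' i).idx j = i' := by
  rw [cons, idx_ofFun _ _ (by rw [Finset.mem_Icc]; omega), if_pos rfl]

theorem idx_cons_of_lt {j n : ℕ} (i' : Finset.Icc 1 j) (i : RowPath (j + 1) n) {a : ℕ}
    (ha : j < a) (han : a ≤ n) : (cons i' i).idx a = i.idx a := by
  rw [cons, idx_ofFun _ _ (by rw [Finset.mem_Icc]; omega), if_neg (by omega)]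

theorem sum_cons {j n : ℕ} (hjn : j ≤ n) {M : Type*} [AddCommMonoid M] (F : RowPath j n → M) :
    ∑ i, F i = ∑ i' : Finset.Icc 1 j, ∑ i : RowPath (j + 1) n, F (cons i' i) := by
  rw [← Fintype.sum_prod_type']
  symm
  refine Fintype.sum_bijective (fun q : (Finset.Icc 1 j) × RowPath (j + 1) n => cons q.1 q.2)
    ⟨?_, ?_⟩ _ _ (fun _ => rfl)
  · rintro ⟨i', i⟩ ⟨k', k⟩ h
    change cons i' i = cons k' k at h
    have h1 : i' = k' := by
      have := congrArg (fun r => idx r j) h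
      simp only [idx_cons_self hjn] at this
      exact Subtype.ext this
    have h2 : i = k := by
      apply ext_idx
      intro a ha
      rw [Finset.mem_Icc] at ha
      have := congrArg (fun r => idx r a) h
      rwa [idx_cons_of_lt _ _ (by omega) ha.2, idx_cons_of_lt _ _ (by omega) ha.2] at this
    rw [h1, h2]
  · intro r
    refine ⟨⟨r ⟨j, by rw [Finset.mem_Icc]; omega⟩, ofFun r.idx ?_⟩, ?_⟩
    · intro a ha
      rw [Finset.mem_Icc] at ha
      exact r.idx_mem (by rw [Finset.mem_Icc]; omega)
    · apply ext_idx
      intro a ha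
      have ha' := Finset.mem_Icc.mp ha
      rcases Nat.eq_or_lt_of_le ha'.1 with rfl | hlt
      · rw [idx_cons_self hjn, idx_of_mem r ha]
      · rw [idx_cons_of_lt _ _ hlt ha'.2, idx_ofFun _ _ (by rw [Finset.mem_Icc]; omega)]

theorem sum_top {n : ℕ} (hn : 1 ≤ n) {M : Type*} [AddCommMonoid M] (F : ℕ → M) :
    ∑ i : RowPath n n, F (i.idx n) = ∑ i ∈ Finset.Icc 1 n, F i := by
  have hnn : n ∈ Finset.Icc n n := by simp
  refine Finset.sum_bij' (fun i _ => i.idx n)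
    (fun a ha => ofFun (fun b => if b = n then a else 1) (by
      intro b hb
      rw [Finset.mem_Icc] at hb
      obtain rfl : b = n := by omega
      rw [if_pos rfl]; exact ha))
    (fun i _ => i.idx_mem hnn) (fun _ _ => Finset.mem_univ _) ?_ ?_ (fun _ _ => rfl)
  · intro i _
    apply ext_idx
    intro b hb
    rw [idx_ofFun _ _ hb]
    rw [Finset.mem_Icc] at hb
    obtain rfl : b = n := by omega
    rw [if_pos rfl]
  · intro a _
    rw [idx_ofFun _ _ hnn, if_pos rfl]

end RowPath

theorem shiftPath_apply {j n : ℕ} (m : ℕ → ℕ → ℤ) (s : ℤ) (i : RowPath j n) (a b : ℕ) :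
    shiftPath m s i a b = m a b + if b ∈ Finset.Icc j n ∧ a = i.idx b then s else 0 := by
  unfold shiftPath; split_ifs <;> simp

theorem shiftPath_cons {j n : ℕ} (hjn : j ≤ n) (m : ℕ → ℕ → ℤ) (s : ℤ) (i' : Finset.Icc 1 j)
    (i : RowPath (j + 1) n) :
    shiftPath m s (RowPath.cons i' i) = shiftOne (shiftPath m s i) s i' j := by
  funext a b
  rw [shiftOne_apply, shiftPath_apply, shiftPath_apply]
  rcases lt_trichotomy b j with h | rfl | h
  · rw [if_neg (by simp; omega), if_neg (by simp; omega), if_neg (by omega)]; simp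
  · rw [RowPath.idx_cons_self hjn]
    simp [hjn]
  · by_cases hbn : b ≤ n
    · rw [RowPath.idx_cons_of_lt _ _ h hbn]
      have h1 : b ∈ Finset.Icc j n := by rw [Finset.mem_Icc]; omega
      have h2 : b ∈ Finset.Icc (j + 1) n := by rw [Finset.mem_Icc]; omega
      simp [h1, h2, show ¬ b = j by omega]
    · rw [if_neg (by simp; omega), if_neg (by simp; omega), if_neg (by omega)]; simp

theorem shiftPath_top {n : ℕ} (m : ℕ → ℕ → ℤ) (s : ℤ) (i : RowPath n n) :
    shiftPath m s i = shiftOne m s (i.idx n) n := by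
  funext a b
  rw [shiftOne_apply, shiftPath_apply]
  congr 1
  by_cases hb : b = n
  · subst hb; simp
  · rw [if_neg (by simp; omega), if_neg (by omega)]

/-! ### The matrix elements of `f_n^+` -/

/-- The part of the squared matrix element of a raising operator of row `k` that comes from the
rows `k` and `k - 1`. -/
noncomputable def rowFactor (m : ℕ → ℕ → ℤ) (k i : ℕ) : ℝ :=
  (∏ q ∈ Finset.Icc 1 (k - 1), (l m q (k - 1) - l m i k - 1)) /
    ∏ q ∈ (Finset.Icc 1 k).erase i, (l m q k - l m i k)

theorem prod_neg_comm {ι : Type*} (s : Finset ι) (f g : ι → ℝ) (h : ∀ q ∈ s, f q = -g q) :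
    ∏ q ∈ s, f q = (-1) ^ s.card * ∏ q ∈ s, g q := by
  rw [Finset.prod_congr rfl h, Finset.prod_neg]

section RowFactor

variable {n p : ℕ} {m : ℕ → ℕ → ℤ} {i k : ℕ}

theorem prod_erase_ne_zero (h : IsGZPattern n p m) (hi : 1 ≤ i) (hik : i ≤ k) (hkn : k ≤ n) :
    ∏ q ∈ (Finset.Icc 1 k).erase i, (l m q k - l m i k) ≠ 0 := by
  rw [Finset.prod_ne_zero_iff]
  intro q hq h0
  rw [Finset.mem_erase] at hq
  have hi' : i ∈ (Finset.Icc 1 k : Finset ℕ) := by rw [Finset.mem_Icc]; omega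
  exact hq.1 (h.l_injOn hkn hq.2 hi' (sub_eq_zero.mp h0))

theorem rowFactor_nonneg (h : IsGZPattern n p m) (hi : 1 ≤ i) (hik : i ≤ k) (hkn : k ≤ n) :
    0 ≤ rowFactor m k i := by
  by_cases hz : ∃ q ∈ Finset.Icc 1 (k - 1), l m q (k - 1) - l m i k - 1 = 0
  · obtain ⟨q, hq, h0⟩ := hz
    rw [rowFactor, Finset.prod_eq_zero hq h0, zero_div]
  push Not at hz
  have hdn : 0 < (-1) ^ (i - 1) * ∏ q ∈ Finset.Icc 1 (k - 1), -(l m q (k - 1) - l m i k - 1) := by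
    apply prod_pos_of_sign (by omega)
    · intro q hq1 hq2
      have s1 := (h.between (i - 1) (k - 1) (by omega) (by omega) (by omega)).1
      rw [show i - 1 + 1 = i by omega, show k - 1 + 1 = k by omega] at s1
      have s2 := h.antitone (i := q) (j := i - 1) (k := k - 1) hq1 hq2 (by omega) (by omega)
      have h0 := hz q (by rw [Finset.mem_Icc]; omega)
      have : 0 ≤ m q (k - 1) - q - (m i k - i) - 1 := by omega
      have : (0 : ℝ) ≤ l m q (k - 1) - l m i k - 1 := by
        rw [l_cast, l_cast]; exact_mod_cast this
      have := lt_of_le_of_ne this h0.symm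
      linarith
    · intro q hq1 hq2
      have s2 := h.antitone (i := i) (j := q) (k := k - 1) hi (by omega) hq2 (by omega)
      have s1 := (h.between i (k - 1) hi (by omega) (by omega)).2
      rw [show k - 1 + 1 = k by omega] at s1
      rw [l_cast, l_cast]
      have : 0 < -(m q (k - 1) - q - (m i k - i) - 1) := by omega
      exact_mod_cast this
  have hden : 0 <
      (-1) ^ i * ∏ q ∈ Finset.Icc 1 k, (if q = i then -1 else -(l m q k - l m i k)) := by
    apply prod_pos_of_sign (by omega)
    · intro q hq1 hq2
      split_ifs with hqi
      · norm_num
      · have := h.l_lt (k := k) hq1 (by omega : q < i) hik hkn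
        have : (q : ℝ) < i := by exact_mod_cast (by omega : q < i)
        linarith
    · intro q hq1 hq2
      rw [if_neg (by omega)]
      have := h.l_lt (k := k) hi hq1 hq2 hkn
      have : (i : ℝ) < q := by exact_mod_cast hq1
      linarith
  have hi' : i ∈ Finset.Icc 1 k := by rw [Finset.mem_Icc]; omega
  rw [← Finset.mul_prod_erase _ _ hi', if_pos rfl, Finset.prod_congr rfl (g := fun q =>
    -(l m q k - l m i k)) (fun q hq => if_neg (Finset.ne_of_mem_erase hq)), Finset.prod_neg,
    Finset.card_erase_of_mem hi', Nat.card_Icc, Nat.add_sub_cancel] at hden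
  rw [Finset.prod_neg, Nat.card_Icc, Nat.add_sub_cancel] at hdn
  have hs : ((-1 : ℝ)) ^ i = -(-1) ^ (i - 1) := by
    obtain ⟨c, rfl⟩ : ∃ c, i = c + 1 := ⟨i - 1, by omega⟩
    rw [pow_succ]; simp
  have hprod := mul_pos hdn hden
  rw [hs] at hprod
  have e1 : ((-1 : ℝ)) ^ (i - 1) * (-1) ^ (i - 1) = 1 := by rw [← mul_pow]; simp
  have e2 : ((-1 : ℝ)) ^ (k - 1) * (-1) ^ (k - 1) = 1 := by rw [← mul_pow]; simp
  have e3 : 0 < (∏ q ∈ Finset.Icc 1 (k - 1), (l m q (k - 1) - l m i k - 1)) *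
      ∏ q ∈ (Finset.Icc 1 k).erase i, (l m q k - l m i k) := by
    calc (0 : ℝ) < _ := hprod
      _ = ((-1 : ℝ) ^ (i - 1) * (-1) ^ (i - 1)) * ((-1 : ℝ) ^ (k - 1) * (-1) ^ (k - 1)) *
          ((∏ q ∈ Finset.Icc 1 (k - 1), (l m q (k - 1) - l m i k - 1)) *
            ∏ q ∈ (Finset.Icc 1 k).erase i, (l m q k - l m i k)) := by ring
      _ = _ := by rw [e1, e2, one_mul, one_mul]
  exact (div_pos_iff.mpr (mul_pos_iff.mp e3)).le

/-- The radicand in `G`. -/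
noncomputable def topFactor (n p k : ℕ) (r : ℕ → ℤ) : ℝ :=
  if Even k then
    -(((evenInd n * (r k + n - k) + 1) *
          ∏ j ∈ (Finset.Icc 1 n).erase k, ((r k : ℝ) - r j - k + j)) /
        ∏ j ∈ (Finset.Icc 1 (n / 2)).erase (k / 2),
          (((r k : ℝ) - r (2 * j) - k + 2 * j) * ((r k : ℝ) - r (2 * j) - k + 2 * j + 1)))
  else
    ((((p : ℝ) - r k + k - 1) * (oddInd n * (r k + n - k) + 1) *
          ∏ j ∈ (Finset.Icc 1 n).erase k, ((r k : ℝ) - r j - k + j)) /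
        ∏ j ∈ (Finset.Icc 1 ((n + 1) / 2)).erase ((k + 1) / 2),
          (((r k : ℝ) - r (2 * j - 1) - k + 2 * j - 1) * ((r k : ℝ) - r (2 * j - 1) - k + 2 * j)))

theorem G_eq_sqrt (n p k : ℕ) (r : ℕ → ℤ) : G n p k r = √(topFactor n p k r) := by
  unfold G topFactor; split_ifs <;> rfl

/-- The square of the stated matrix element of `f_n^+` is `raiseSq`: the full products over row `n`
cancel, and the products over the indices of one parity remain. -/
theorem rowFactor_mul_topFactor (h : IsGZPattern n p m) (hi : 1 ≤ i) (hin : i ≤ n) :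
    rowFactor m n i * topFactor n p i (fun a => m a n) = raiseSq n p n m i := by
  set x := l m i n with hx
  have hi' : i ∈ Finset.Icc 1 n := by rw [Finset.mem_Icc]; omega
  have hD := prod_erase_ne_zero h hi hin le_rfl
  set D := ∏ q ∈ (Finset.Icc 1 n).erase i, (l m q n - l m i n) with hDdef
  have hnum : ∏ j ∈ (Finset.Icc 1 n).erase i, ((m i n : ℝ) - m j n - i + j) =
      (-1) ^ (n - 1) * D := by
    rw [prod_neg_comm _ _ (fun q => l m q n - l m i n) (fun q _ => by unfold l; ring),
      Finset.card_erase_of_mem hi', Nat.card_Icc, Nat.add_sub_cancel]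
  have hup : ∏ q ∈ Finset.Icc 1 (n - 1), (l m q (n - 1) - l m i n - 1) =
      (-1) ^ (n - 1) * ∏ q ∈ Finset.Icc 1 (n - 1), (x - l m q (n - 1) + 1) := by
    rw [prod_neg_comm _ _ (fun q => x - l m q (n - 1) + 1) (fun q _ => by rw [hx]; ring),
      Nat.card_Icc, Nat.add_sub_cancel]
  have e2 : ((-1 : ℝ)) ^ (n - 1) * (-1) ^ (n - 1) = 1 := by rw [← mul_pow]; simp
  have hxn : (m i n : ℝ) + n - i = x + n := by rw [hx, l]; ring
  unfold rowFactor topFactor raiseSq rowPoly edgeFactor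
  rw [if_pos rfl, hup, hnum, hxn, ← hx, ← hDdef]
  by_cases hev : Even i
  · rw [if_pos hev, if_pos hev]
    have hden : ∏ j ∈ (Finset.Icc 1 (n / 2)).erase (i / 2),
        (((m i n : ℝ) - m (2 * j) n - i + 2 * j) * ((m i n : ℝ) - m (2 * j) n - i + 2 * j + 1)) =
        ∏ j ∈ (rowClass n n i).erase i, ((x - l m j n) * (x - l m j n + 1)) := by
      refine Finset.prod_nbij' (fun j => 2 * j) (fun q => q / 2) ?_ ?_ ?_ ?_ ?_
      · intro j hj
        simp only [Finset.mem_erase, Finset.mem_Icc, rowClass, Finset.mem_filter] at hj ⊢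
        obtain ⟨c, rfl⟩ := hev
        simp; omega
      · intro q hq
        simp only [Finset.mem_erase, Finset.mem_Icc, rowClass, Finset.mem_filter] at hq ⊢
        obtain ⟨d, rfl⟩ := (hq.2.2 trivial).mpr hev
        obtain ⟨c, rfl⟩ := hev
        omega
      · intro j _; simp
      · intro q hq
        simp only [Finset.mem_erase, Finset.mem_Icc, rowClass, Finset.mem_filter] at hq
        obtain ⟨d, rfl⟩ := (hq.2.2 trivial).mpr hev
        omega
      · intro j _
        rw [hx, l, l]; push_cast; ring
    rw [hden]
    set Q := ∏ j ∈ (rowClass n n i).erase i, ((x - l m j n) * (x - l m j n + 1))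
    set U := ∏ q ∈ Finset.Icc 1 (n - 1), (x - l m q (n - 1) + 1)
    calc _ = -((evenInd n * (x + n) + 1) * U / Q) * ((-1 : ℝ) ^ (n - 1) * (-1) ^ (n - 1)) *
          (D / D) := by ring
      _ = _ := by rw [e2, div_self hD]; ring
  · rw [if_neg hev, if_neg hev]
    have hden : ∏ j ∈ (Finset.Icc 1 ((n + 1) / 2)).erase ((i + 1) / 2),
        (((m i n : ℝ) - m (2 * j - 1) n - i + 2 * j - 1) *
          ((m i n : ℝ) - m (2 * j - 1) n - i + 2 * j)) =
        ∏ j ∈ (rowClass n n i).erase i, ((x - l m j n) * (x - l m j n + 1)) := by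
      refine Finset.prod_nbij' (fun j => 2 * j - 1) (fun q => (q + 1) / 2) ?_ ?_ ?_ ?_ ?_
      · intro j hj
        simp only [Finset.mem_erase, Finset.mem_Icc, rowClass, Finset.mem_filter] at hj ⊢
        obtain ⟨c, rfl⟩ := Nat.not_even_iff_odd.mp hev
        refine ⟨by omega, by omega, fun _ => ?_⟩
        have : Odd (2 * j - 1) := ⟨j - 1, by omega⟩
        simp [hev, Nat.not_even_iff_odd.mpr this]
      · intro q hq
        simp only [Finset.mem_erase, Finset.mem_Icc, rowClass, Finset.mem_filter] at hq ⊢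
        have hq' : ¬ Even q := fun e => hev ((hq.2.2 trivial).mp e)
        obtain ⟨d, rfl⟩ := Nat.not_even_iff_odd.mp hq'
        obtain ⟨c, rfl⟩ := Nat.not_even_iff_odd.mp hev
        omega
      · intro j hj
        simp only [Finset.mem_erase, Finset.mem_Icc] at hj
        omega
      · intro q hq
        simp only [Finset.mem_erase, Finset.mem_Icc, rowClass, Finset.mem_filter] at hq
        have hq' : ¬ Even q := fun e => hev ((hq.2.2 trivial).mp e)
        obtain ⟨d, rfl⟩ := Nat.not_even_iff_odd.mp hq'
        omega
      · intro j hj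
        simp only [Finset.mem_erase, Finset.mem_Icc] at hj
        rw [hx, l, l, Nat.cast_sub (by omega)]; push_cast; ring
    rw [hden]
    have hpx : (p : ℝ) - m i n + i - 1 = -(x - (p - 1)) := by rw [hx, l]; ring
    rw [hpx]
    set Q := ∏ j ∈ (rowClass n n i).erase i, ((x - l m j n) * (x - l m j n + 1))
    set U := ∏ q ∈ Finset.Icc 1 (n - 1), (x - l m q (n - 1) + 1)
    calc _ = -((x - (p - 1)) * (oddInd n * (x + n) + 1) * U / Q) *
          ((-1 : ℝ) ^ (n - 1) * (-1) ^ (n - 1)) * (D / D) := by ring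
      _ = _ := by rw [e2, div_self hD]; ring

theorem raiseLastCoeff_eq (h : IsGZPattern n p m) (hi : 1 ≤ i) (hin : i ≤ n) :
    raiseLastCoeff n p m i = √(raiseSq n p n m i) := by
  rw [← rowFactor_mul_topFactor h hi hin, Real.sqrt_mul (rowFactor_nonneg h hi hin le_rfl),
    ← G_eq_sqrt]
  rfl

end RowFactor

/-! ### The matrix elements of `f_j^+` -/

/-- The squared factor of the matrix elements of `f_j^+` that couples the rows `a` and `a + 1`, with
the indices `i` in row `a` and `i'` in row `a + 1`. -/
noncomputable def couplingFactor (m : ℕ → ℕ → ℤ) (a i i' : ℕ) : ℝ :=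
  ((∏ k ∈ (Finset.Icc 1 a).erase i, (l m k a - l m i' (a + 1) - 1)) *
      ∏ k ∈ (Finset.Icc 1 (a + 1)).erase i', (l m k (a + 1) - l m i a)) /
    ((∏ k ∈ (Finset.Icc 1 (a + 1)).erase i', (l m k (a + 1) - l m i' (a + 1))) *
      ∏ k ∈ (Finset.Icc 1 a).erase i, (l m k a - l m i a - 1))

/-- The part of the matrix element of `f_j^+` that does not depend on the rows below `j`. -/
noncomputable def raiseTail {j n : ℕ} (p : ℕ) (m : ℕ → ℕ → ℤ) (i : RowPath j n) : ℝ :=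
  (∏ a ∈ Finset.Ico j n, S (i.idx (a + 1)) (i.idx a)) *
    (∏ a ∈ Finset.Ico j n, √(couplingFactor m a (i.idx a) (i.idx (a + 1)))) *
    G n p (i.idx n) (fun a => m a n)

theorem raiseCoeff_eq {j n : ℕ} (p : ℕ) (m : ℕ → ℕ → ℤ) (i : RowPath j n) :
    raiseCoeff p m i = √(rowFactor m j (i.idx j)) * raiseTail p m i := by
  unfold raiseCoeff rowFactor raiseTail couplingFactor
  ring

/-- Prepending an entry to an index tuple contributes one sign and one coupling factor. -/
theorem raiseTail_cons {j n p : ℕ} (hjn : j < n) (m : ℕ → ℕ → ℤ) (i' : Finset.Icc 1 j)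
    (i : RowPath (j + 1) n) : raiseTail p m (RowPath.cons i' i) =
      S (i.idx (j + 1)) i' * √(couplingFactor m j i' (i.idx (j + 1))) * raiseTail p m i := by
  have hidx : ∀ a, j + 1 ≤ a → a ≤ n → (RowPath.cons i' i).idx a = i.idx a :=
    fun a h1 h2 => RowPath.idx_cons_of_lt _ _ h1 h2
  unfold raiseTail
  rw [Finset.prod_eq_prod_Ico_succ_bot hjn, Finset.prod_eq_prod_Ico_succ_bot hjn,
    RowPath.idx_cons_self hjn.le, hidx _ le_rfl hjn, hidx _ hjn le_rfl]
  have h1 : ∏ a ∈ Finset.Ico (j + 1) n,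
      S ((RowPath.cons i' i).idx (a + 1)) ((RowPath.cons i' i).idx a) =
      ∏ a ∈ Finset.Ico (j + 1) n, S (i.idx (a + 1)) (i.idx a) := by
    refine Finset.prod_congr rfl fun a ha => ?_
    rw [Finset.mem_Ico] at ha
    rw [hidx a ha.1 (by omega), hidx (a + 1) (by omega) (by omega)]
  have h2 : ∏ a ∈ Finset.Ico (j + 1) n,
      √(couplingFactor m a ((RowPath.cons i' i).idx a) ((RowPath.cons i' i).idx (a + 1))) =
      ∏ a ∈ Finset.Ico (j + 1) n, √(couplingFactor m a (i.idx a) (i.idx (a + 1))) := by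
    refine Finset.prod_congr rfl fun a ha => ?_
    rw [Finset.mem_Ico] at ha
    rw [hidx a ha.1 (by omega), hidx (a + 1) (by omega) (by omega)]
  rw [h1, h2]
  ring

theorem raiseTail_shiftOne {j n p : ℕ} (hjn : j < n) (m : ℕ → ℕ → ℤ) (t : ℤ) (i' : ℕ)
    (i : RowPath (j + 1) n) : raiseTail p (shiftOne m t i' j) i = raiseTail p m i := by
  have hl : ∀ a b, j < b → l (shiftOne m t i' j) a b = l m a b := by
    intro a b hb; rw [l_shiftOne, if_neg (by omega), add_zero]
  unfold raiseTail
  congr 1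
  · congr 1
    refine Finset.prod_congr rfl fun a ha => ?_
    rw [Finset.mem_Ico] at ha
    unfold couplingFactor
    simp only [fun b => hl b a (by omega), fun b => hl b (a + 1) (by omega)]
  · congr 1
    funext a
    rw [shiftOne_apply, if_neg (by omega), add_zero]

section Step

variable {n p : ℕ} {m : ℕ → ℕ → ℤ} {j i i' : ℕ}

/-- Raising `(i', j)` last is legitimate unless `l m i' j = l m i (j + 1) + 1`. -/
theorem isGZPattern_raise_last {m₁ : ℕ → ℕ → ℤ} (h : IsGZPattern n p m) (hi' : 1 ≤ i')
    (hij : i' ≤ j) (hjn : j < n) (hlow : ∀ a b, b ≤ j → m₁ a b = m a b)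
    (hrow : ∀ a, m₁ a (j + 1) = m a (j + 1) + if a = i then 1 else 0)
    (hr : IsGZPattern n p (shiftOne m₁ 1 i' j))
    (hd : m i' j - i' ≠ m i (j + 1) - i + 1) : IsGZPattern n p m₁ := by
  have hother : ∀ a b, b ≠ j → shiftOne m₁ 1 i' j a b = m₁ a b := by
    intro a b hb; rw [shiftOne_apply, if_neg (by omega), add_zero]
  constructor
  · intro a b hab
    by_cases hb : b = j
    · rw [hlow a b (by omega)]; exact h.supp a b hab
    · rw [← hother a b hb]; exact hr.supp a b hab
  · intro a b
    by_cases hb : b = j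
    · rw [hlow a b (by omega)]; exact h.nonneg a b
    · rw [← hother a b hb]; exact hr.nonneg a b
  · intro a b ha hab hb
    have e1 := h.between a b ha hab hb
    have e2 := hr.between a b ha hab hb
    rcases lt_trichotomy b j with hbj | rfl | hbj
    · have r1 := hlow (a + 1) (b + 1) (by omega)
      have r2 := hlow a b hbj.le
      have r3 := hlow a (b + 1) (by omega)
      omega
    · have o1 := hother (a + 1) (b + 1) (by omega)
      have o2 := hother a (b + 1) (by omega)
      have o3 := shiftOne_apply m₁ 1 i' b a b
      have r1 := hrow (a + 1)
      have r2 := hrow a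
      have r3 := hlow a b le_rfl
      by_cases hai : a = i'
      · subst hai
        rw [if_pos ⟨rfl, rfl⟩] at o3
        by_cases hi : a + 1 = i
        · subst hi
          rw [if_pos rfl] at r1
          rw [if_neg (by omega)] at r2
          push_cast at hd
          omega
        · rw [if_neg hi] at r1
          split_ifs at r2 <;> omega
      · rw [if_neg (by omega)] at o3
        omega
    · rw [hother _ _ (by omega), hother _ _ (by omega), hother _ _ (by omega)] at e2
      exact e2
  · have := hr.top_le
    rwa [hother _ _ (by omega)] at this

/-- Raising `(i', j)` first is legitimate unless `l m i' j = l m i (j + 1)`. -/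
theorem isGZPattern_raise_first {m₁ : ℕ → ℕ → ℤ} (h : IsGZPattern n p m) (hi' : 1 ≤ i')
    (hij : i' ≤ j) (hjn : j < n) (hlow : ∀ a b, b ≤ j → m₁ a b = m a b)
    (hrow : ∀ a, m₁ a (j + 1) = m a (j + 1) + if a = i then 1 else 0)
    (hr : IsGZPattern n p (shiftOne m₁ 1 i' j))
    (hd : m i' j - i' ≠ m i (j + 1) - i) : IsGZPattern n p (shiftOne m 1 i' j) := by
  rw [h.raise_iff hi' hij hjn.le]
  refine ⟨fun h1 => ?_, fun _ => ?_, fun h1 => by omega⟩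
  · have := (hr.between (i' - 1) (j - 1) (by omega) (by omega) (by omega)).1
    rw [show i' - 1 + 1 = i' by omega, show j - 1 + 1 = j by omega, shiftOne_apply, shiftOne_apply,
      if_pos (⟨rfl, rfl⟩ : i' = i' ∧ j = j), if_neg (fun h => by omega), hlow _ _ le_rfl,
      hlow _ _ (by omega)] at this
    omega
  · have e1 := (h.between i' j hi' hij hjn).2
    have e2 := (hr.between i' j hi' hij hjn).2
    rw [shiftOne_apply, shiftOne_apply, if_pos (⟨rfl, rfl⟩ : i' = i' ∧ j = j),
      if_neg (fun h => by omega), hlow _ _ le_rfl, hrow] at e2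
    by_cases hi : i' = i
    · subst hi
      rw [if_pos rfl] at e2
      omega
    · rw [if_neg hi] at e2
      omega

/-- `raiseSq` for row `j`, without the factor that contains the entry `(i, j + 1)`. -/
noncomputable def raiseSqReduced (m : ℕ → ℕ → ℤ) (j i i' : ℕ) : ℝ :=
  -((∏ q ∈ (Finset.Icc 1 (j + 1)).erase i, (l m i' j - l m q (j + 1))) *
      (∏ q ∈ Finset.Icc 1 (j - 1), (l m i' j - l m q (j - 1) + 1)) /
    ∏ q ∈ (Finset.Icc 1 j).erase i', ((l m i' j - l m q j) * (l m i' j - l m q j + 1)))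

/-- `rowFactor` for row `j + 1`, without the factor that contains the entry `(i', j)`. -/
noncomputable def rowFactorReduced (m : ℕ → ℕ → ℤ) (j i i' : ℕ) : ℝ :=
  (∏ q ∈ (Finset.Icc 1 j).erase i', (l m q j - l m i (j + 1) - 1)) /
    ∏ q ∈ (Finset.Icc 1 (j + 1)).erase i, (l m q (j + 1) - l m i (j + 1))

theorem raiseSq_eq_reduced {m₁ : ℕ → ℕ → ℤ} {t : ℤ} (hi : 1 ≤ i) (hij1 : i ≤ j + 1)
    (hjn : j < n) (hlow : ∀ a b, b ≤ j → m₁ a b = m a b)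
    (hrow : ∀ a, m₁ a (j + 1) = m a (j + 1) + if a = i then t else 0) :
    raiseSq n p j m₁ i' =
      (l m i' j - l m i (j + 1) - t) * raiseSqReduced m j i i' := by
  have hcls : rowClass n j i' = Finset.Icc 1 j := by
    unfold rowClass; rw [Finset.filter_true_of_mem]; intro _ _ e; omega
  have hl : ∀ a b, b ≤ j → l m₁ a b = l m a b := by
    intro a b hb; unfold l; rw [hlow a b hb]
  have hlr : ∀ a, l m₁ a (j + 1) = l m a (j + 1) + if a = i then (t : ℝ) else 0 := by
    intro a; unfold l; rw [hrow]; push_cast; split_ifs <;> ring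
  unfold raiseSq rowPoly raiseSqReduced
  rw [hcls, if_neg (by omega), ← Finset.mul_prod_erase _ _ (a := i)
    (by rw [Finset.mem_Icc]; omega : i ∈ Finset.Icc 1 (j + 1)), hlr i, if_pos rfl]
  simp only [hl _ j le_rfl, fun a => hl a (j - 1) (by omega)]
  rw [Finset.prod_congr rfl (s₁ := (Finset.Icc 1 (j + 1)).erase i)
    (g := fun q => l m i' j - l m q (j + 1)) (fun q hq => by
      rw [hlr, if_neg (Finset.ne_of_mem_erase hq), add_zero])]
  ring

theorem rowFactor_eq_reduced (t : ℤ) (hi' : 1 ≤ i') (hij : i' ≤ j) :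
    rowFactor (shiftOne m t i' j) (j + 1) i =
      (l m i' j + t - l m i (j + 1) - 1) * rowFactorReduced m j i i' := by
  unfold rowFactor rowFactorReduced
  have hl : ∀ a, l (shiftOne m t i' j) a (j + 1) = l m a (j + 1) := by
    intro a; rw [l_shiftOne, if_neg (by omega), add_zero]
  rw [Nat.add_sub_cancel, ← Finset.mul_prod_erase _ _ (a := i')
    (by rw [Finset.mem_Icc]; omega : i' ∈ Finset.Icc 1 j)]
  simp only [hl]
  rw [l_shiftOne, if_pos ⟨rfl, rfl⟩, Finset.prod_congr rfl (s₁ := (Finset.Icc 1 j).erase i')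
    (g := fun q => l m q j - l m i (j + 1) - 1) (fun q hq => by
      rw [l_shiftOne, if_neg (fun h => Finset.ne_of_mem_erase hq h.1), add_zero])]
  ring

theorem reduced_mul_reduced (hi : 1 ≤ i) (hij1 : i ≤ j + 1) (hi' : 1 ≤ i') (hij : i' ≤ j) :
    rowFactorReduced m j i i' * raiseSqReduced m j i i' =
      rowFactor m j i' * couplingFactor m j i' i := by
  have c1 : ((Finset.Icc 1 (j + 1)).erase i).card = j := by
    rw [Finset.card_erase_of_mem (by rw [Finset.mem_Icc]; omega), Nat.card_Icc]; omega
  have h1 : ∏ q ∈ (Finset.Icc 1 (j + 1)).erase i, (l m i' j - l m q (j + 1)) =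
      (-1) ^ j * ∏ q ∈ (Finset.Icc 1 (j + 1)).erase i, (l m q (j + 1) - l m i' j) := by
    rw [prod_neg_comm _ _ (fun q => l m q (j + 1) - l m i' j) (fun q _ => by ring), c1]
  have h2 : ∏ q ∈ Finset.Icc 1 (j - 1), (l m i' j - l m q (j - 1) + 1) =
      (-1) ^ (j - 1) * ∏ q ∈ Finset.Icc 1 (j - 1), (l m q (j - 1) - l m i' j - 1) := by
    rw [prod_neg_comm _ _ (fun q => l m q (j - 1) - l m i' j - 1) (fun q _ => by ring),
      Nat.card_Icc, Nat.add_sub_cancel]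
  have h3 : ∏ q ∈ (Finset.Icc 1 j).erase i', ((l m i' j - l m q j) * (l m i' j - l m q j + 1)) =
      (∏ q ∈ (Finset.Icc 1 j).erase i', (l m q j - l m i' j)) *
        ∏ q ∈ (Finset.Icc 1 j).erase i', (l m q j - l m i' j - 1) := by
    rw [← Finset.prod_mul_distrib]
    exact Finset.prod_congr rfl fun q _ => by ring
  have hs : ((-1 : ℝ)) ^ j * (-1) ^ (j - 1) = -1 := by
    obtain ⟨c, rfl⟩ : ∃ c, j = c + 1 := ⟨j - 1, by omega⟩
    rw [Nat.add_sub_cancel, pow_succ, mul_right_comm, ← mul_pow]; simp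
  unfold rowFactorReduced raiseSqReduced rowFactor couplingFactor
  rw [h1, h2, h3, mul_mul_mul_comm ((-1 : ℝ) ^ j), hs]
  simp only [div_eq_mul_inv, mul_inv]
  ring

/-- The identity behind the recursion `f_j^+ = [E_j, f_{j+1}^+]` for matrix elements. Writing `e`
for the integer `l m i' j - l m i (j + 1)`, the left-hand side is `(|e - 1| - |e|) √(…)`. -/
theorem raise_step {m₁ : ℕ → ℕ → ℤ} (h : IsGZPattern n p m) (hi : 1 ≤ i) (hij1 : i ≤ j + 1)
    (hi' : 1 ≤ i') (hij : i' ≤ j) (hjn : j < n) (hlow : ∀ a b, b ≤ j → m₁ a b = m a b)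
    (hrow : ∀ a, m₁ a (j + 1) = m a (j + 1) + if a = i then 1 else 0)
    (hr : IsGZPattern n p (shiftOne m₁ 1 i' j)) :
    √(raiseSq n p j m₁ i') * √(rowFactor m (j + 1) i) -
      √(rowFactor (shiftOne m 1 i' j) (j + 1) i) * √(raiseSq n p j m i') =
      S i i' * (√(rowFactor m j i') * √(couplingFactor m j i' i)) := by
  set A := rowFactorReduced m j i i' with hA
  set C := raiseSqReduced m j i i' with hC
  set e : ℤ := m i' j - i' - (m i (j + 1) - i) with he
  have hle : l m i' j - l m i (j + 1) = (e : ℝ) := by rw [l_cast, l_cast, he]; push_cast; ring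
  have x1 : raiseSq n p j m₁ i' = ((e : ℝ) - 1) * C := by
    rw [raiseSq_eq_reduced (m := m) (t := 1) hi hij1 hjn hlow hrow, hle]; push_cast; rfl
  have x2 : raiseSq n p j m i' = (e : ℝ) * C := by
    rw [raiseSq_eq_reduced (m := m) (t := 0) hi hij1 hjn (fun _ _ _ => rfl) (by simp), hle]
    push_cast; rw [sub_zero]
  have a1 : rowFactor m (j + 1) i = ((e : ℝ) - 1) * A := by
    have := rowFactor_eq_reduced (m := m) (i := i) 0 hi' hij
    rw [shiftOne_zero] at this
    rw [this, ← hle]; push_cast; ring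
  have a2 : rowFactor (shiftOne m 1 i' j) (j + 1) i = (e : ℝ) * A := by
    rw [rowFactor_eq_reduced 1 hi' hij, ← hle]; push_cast; ring
  have hAC : √(rowFactor m j i') * √(couplingFactor m j i' i) = √(A * C) := by
    rw [← Real.sqrt_mul (rowFactor_nonneg h hi' hij hjn.le), ← reduced_mul_reduced hi hij1 hi' hij]
  rw [hAC, x1, x2, a1, a2]
  -- the radicands are nonnegative, so that `A` and `C` are nonpositive for `e ≤ 0` and nonnegative
  -- for `e ≥ 1`; in the two cases `|e - 1| - |e|` is `1` and `-1`
  rcases le_or_gt e 0 with hle0 | hgt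
  · have heR : (e : ℝ) ≤ 0 := by exact_mod_cast hle0
    have hS : S i i' = 1 := by
      unfold S; rw [if_pos]
      by_contra hlt
      have s1 := (h.between i' j hi' hij hjn).1
      have s2 := h.antitone (i := i' + 1) (j := i) (k := j + 1) (by omega) (by omega) hij1 hjn
      omega
    have hv := isGZPattern_raise_last h hi' hij hjn hlow hrow hr (by omega)
    have y1 := raiseSq_nonneg hv hi' hij hjn.le
    have y2 := rowFactor_nonneg h hi hij1 hjn
    rw [x1] at y1
    rw [a1] at y2
    have hC0 : 0 ≤ -C := by nlinarith
    have hA0 : 0 ≤ -A := by nlinarith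
    have s1 : ∀ u : ℝ, 0 ≤ u → ∀ z, √(-u * z) = √u * √(-z) := by
      intro u hu z; rw [← Real.sqrt_mul hu]; congr 1; ring
    have hAC' : √(A * C) = √(-A) * √(-C) := by rw [← Real.sqrt_mul hA0]; congr 1; ring
    have e1 : ((e : ℝ) - 1) = -(1 - e) := by ring
    have e2 : (e : ℝ) = -(-e) := by ring
    have q1 := Real.mul_self_sqrt (by linarith : 0 ≤ (1 - e : ℝ))
    have q2 := Real.mul_self_sqrt (by linarith : 0 ≤ (-e : ℝ))
    rw [e1, s1 _ (by linarith), s1 _ (by linarith), e2, s1 _ (by linarith), s1 _ (by linarith),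
      hAC', hS, neg_neg]
    linear_combination √(-A) * √(-C) * (q1 - q2)
  · have heR : (1 : ℝ) ≤ e := by exact_mod_cast hgt
    have hS : S i i' = -1 := by
      unfold S; rw [if_neg]
      intro hlt
      have s1 := (h.between i' j hi' hij hjn).2
      have s2 := h.antitone (i := i) (j := i') (k := j + 1) hi hlt (by omega) hjn
      omega
    have hv := isGZPattern_raise_first h hi' hij hjn hlow hrow hr (by omega)
    have y1 := raiseSq_nonneg h hi' hij hjn.le
    have y2 := rowFactor_nonneg hv hi hij1 hjn
    rw [x2] at y1
    rw [a2] at y2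
    have hC0 : 0 ≤ C := by nlinarith
    have hA0 : 0 ≤ A := by nlinarith
    rw [Real.sqrt_mul (by linarith), Real.sqrt_mul (by linarith), Real.sqrt_mul (by linarith),
      Real.sqrt_mul (by linarith), Real.sqrt_mul hA0, hS]
    have q1 := Real.mul_self_sqrt (by linarith : 0 ≤ (e - 1 : ℝ))
    have q2 := Real.mul_self_sqrt (by linarith : 0 ≤ (e : ℝ))
    linear_combination √A * √C * (q1 - q2)

end Step

open Classical in
/-- The matrix elements of `f_j^+`, by downward induction on `j` from `f_j^+ = [E_j, f_{j+1}^+]`.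
Both orders of the two factors lead to the same pattern, and `raise_step` combines their
contributions. -/
theorem vectorMat_apply {n p j : ℕ} (hj : 1 ≤ j) (hjn : j ≤ n) (m' m : GZPattern n p) :
    vectorMat n p j m' m = ∑ i : RowPath j n,
      if m'.1 = shiftPath m.1 1 i then raiseCoeff p m.1 i else 0 := by
  have H := isChevalleySystem_model (hj.trans hjn) p
  induction j, hj, hjn using downward_induction generalizing m' m with
  | last hn =>
    rw [H.a_last, raiseMat, Matrix.of_apply]
    rw [← RowPath.sum_top hn
      (fun i => if m'.1 = shiftOne m.1 1 i n then √(raiseSq n p n m.1 i) else 0)]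
    refine Finset.sum_congr rfl fun i _ => ?_
    have hi := Finset.mem_Icc.mp (i.idx_mem (by simp : n ∈ Finset.Icc n n))
    rw [shiftPath_top, ← raiseLastCoeff_eq m.2 hi.1 hi.2]
    congr 1
    unfold raiseCoeff raiseLastCoeff
    simp
  | step j hj hjn ih =>
    rw [H.a_rec j hj hjn, Ring.lie_def, Matrix.sub_apply, Matrix.mul_apply, Matrix.mul_apply]
    simp only [ih, raiseMat, Matrix.of_apply, Finset.sum_mul_sum]
    rw [RowPath.sum_cons hjn.le, Finset.sum_comm]
    have c1 : ∑ q : GZPattern n p, ∑ i : RowPath (j + 1) n, ∑ i' ∈ Finset.Icc 1 j,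
        (if m'.1 = shiftPath q.1 1 i then raiseCoeff p q.1 i else 0) *
          (if q.1 = shiftOne m.1 1 i' j then √(raiseSq n p j m.1 i') else 0) =
        ∑ i' ∈ Finset.Icc 1 j, ∑ i : RowPath (j + 1) n, ∑ q : GZPattern n p,
        (if m'.1 = shiftPath q.1 1 i then raiseCoeff p q.1 i else 0) *
          (if q.1 = shiftOne m.1 1 i' j then √(raiseSq n p j m.1 i') else 0) := by
      rw [Finset.sum_comm, Finset.sum_congr rfl fun i _ => Finset.sum_comm, Finset.sum_comm]
    rw [c1, Finset.sum_congr rfl fun i' _ => Finset.sum_comm, ← Finset.sum_sub_distrib,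
      ← Finset.sum_coe_sort (Finset.Icc 1 j)]
    refine Finset.sum_congr rfl fun i' _ => ?_
    rw [← Finset.sum_sub_distrib]
    refine Finset.sum_congr rfl fun i _ => ?_
    have hi' := Finset.mem_Icc.mp i'.2
    have hi := Finset.mem_Icc.mp (i.idx_mem (by simp; omega : j + 1 ∈ Finset.Icc (j + 1) n))
    have hlow : ∀ a b, b ≤ j → shiftPath m.1 1 i a b = m.1 a b := by
      intro a b hb; rw [shiftPath_apply, if_neg (by simp; omega), add_zero]
    have hrow : ∀ a, shiftPath m.1 1 i a (j + 1) = m.1 a (j + 1) +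
        if a = i.idx (j + 1) then 1 else 0 := by
      intro a; rw [shiftPath_apply]; simp [show j + 1 ≤ n from hjn]
    have hcomm : ∀ q : ℕ → ℕ → ℤ, shiftPath (shiftOne q 1 i' j) 1 i =
        shiftOne (shiftPath q 1 i) 1 i' j := by
      intro q; funext a b; simp only [shiftPath_apply, shiftOne_apply]; ring
    rw [shiftPath_cons hjn.le]
    by_cases hT : m'.1 = shiftOne (shiftPath m.1 1 i) 1 i' j
    · rw [if_pos hT]
      have hr : IsGZPattern n p (shiftOne (shiftPath m.1 1 i) 1 i' j) := hT ▸ m'.2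
      have t1 : ∑ q : GZPattern n p,
          (if m'.1 = shiftOne q.1 1 i' j then √(raiseSq n p j q.1 i') else 0) *
            (if q.1 = shiftPath m.1 1 i then raiseCoeff p m.1 i else 0) =
          √(raiseSq n p j (shiftPath m.1 1 i) i') * raiseCoeff p m.1 i := by
        by_cases hv : IsGZPattern n p (shiftPath m.1 1 i)
        · rw [Finset.sum_eq_single ⟨_, hv⟩, if_pos hT, if_pos rfl]
          · intro q _ hq
            rw [if_neg (fun h => hq (Subtype.ext h)) (c := q.1 = _), mul_zero]
          · exact fun h => absurd (Finset.mem_univ _) h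
        -- if the intermediate array is not a pattern, the coefficient of the omitted term vanishes
        · have hd : m.1 i' j - i' = m.1 (i.idx (j + 1)) (j + 1) - i.idx (j + 1) + 1 := by
            by_contra hd
            exact hv (isGZPattern_raise_last m.2 hi'.1 hi'.2 hjn hlow hrow hr hd)
          have hz : rowFactor m.1 (j + 1) (i.idx (j + 1)) = 0 := by
            have := rowFactor_eq_reduced (m := m.1) (i := i.idx (j + 1)) 0 hi'.1 hi'.2
            rw [shiftOne_zero] at this
            rw [this, l_cast, l_cast, hd]; push_cast; ring
          rw [raiseCoeff_eq, hz, Real.sqrt_zero, zero_mul, mul_zero]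
          refine Finset.sum_eq_zero fun q _ => ?_
          rw [if_neg (c := q.1 = _), mul_zero]
          intro h; exact hv (h ▸ q.2)
      have t2 : ∑ q : GZPattern n p,
          (if m'.1 = shiftPath q.1 1 i then raiseCoeff p q.1 i else 0) *
            (if q.1 = shiftOne m.1 1 i' j then √(raiseSq n p j m.1 i') else 0) =
          raiseCoeff p (shiftOne m.1 1 i' j) i * √(raiseSq n p j m.1 i') := by
        by_cases hv : IsGZPattern n p (shiftOne m.1 1 i' j)
        · rw [Finset.sum_eq_single ⟨_, hv⟩, if_pos (hT.trans (hcomm _).symm), if_pos rfl]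
          · intro q _ hq
            rw [if_neg (fun h => hq (Subtype.ext h)) (c := q.1 = _), mul_zero]
          · exact fun h => absurd (Finset.mem_univ _) h
        · rw [raiseSq_eq_zero m.2 hi'.1 hi'.2 hjn.le hv, Real.sqrt_zero, mul_zero]
          simp
      rw [t1, t2, raiseCoeff_eq, raiseCoeff_eq, raiseCoeff_eq, raiseTail_shiftOne hjn,
        raiseTail_cons hjn, RowPath.idx_cons_self hjn.le]
      have key := raise_step m.2 hi.1 hi.2 hi'.1 hi'.2 hjn hlow hrow hr
      linear_combination raiseTail p m.1 i * key
    · rw [if_neg hT, Finset.sum_eq_zero, Finset.sum_eq_zero, sub_zero]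
      · intro q _
        split_ifs with h1 h2
        · rw [h1, h2, hcomm] at hT; exact absurd rfl hT
        all_goals simp
      · intro q _
        split_ifs with h1 h2
        · rw [h1, h2] at hT; exact absurd rfl hT
        all_goals simp

/-- The coefficient of a lowering term is that of the raising term that leads back, in accordance
with `f_j^- = (f_j^+)ᵀ`. -/
theorem lowerCoeff_eq {j n p : ℕ} (hj : 1 ≤ j) (hjn : j ≤ n) (m : ℕ → ℕ → ℤ) (i : RowPath j n) :
    lowerCoeff p m i = raiseCoeff p (shiftPath m (-1) i) i := by
  have hself : ∀ a, a ∈ Finset.Icc j n →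
      l (shiftPath m (-1) i) (i.idx a) a = l m (i.idx a) a - 1 := by
    intro a ha; unfold l; rw [shiftPath_apply, if_pos ⟨ha, rfl⟩]; push_cast; ring
  have hne : ∀ a k, k ≠ i.idx a → l (shiftPath m (-1) i) k a = l m k a := by
    intro a k hk; unfold l; rw [shiftPath_apply, if_neg (fun h => hk h.2), add_zero]
  have hlow : ∀ k, l (shiftPath m (-1) i) k (j - 1) = l m k (j - 1) := by
    intro k; unfold l; rw [shiftPath_apply, if_neg (by simp; omega), add_zero]
  have hprod : ∀ a (g : ℝ → ℝ), ∏ k ∈ (Finset.Icc 1 a).erase (i.idx a),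
      g (l (shiftPath m (-1) i) k a) = ∏ k ∈ (Finset.Icc 1 a).erase (i.idx a), g (l m k a) :=
    fun a g => Finset.prod_congr rfl fun k hk => by rw [hne a k (Finset.ne_of_mem_erase hk)]
  unfold lowerCoeff raiseCoeff
  congr 1
  · congr 1
    · congr 2
      rw [hself j (by rw [Finset.mem_Icc]; omega)]
      simp only [hlow]
      rw [hprod j (fun z => z - (l m (i.idx j) j - 1))]
      congr 1
      · exact Finset.prod_congr rfl fun k _ => by ring
      · exact Finset.prod_congr rfl fun k _ => by ring
    · refine Finset.prod_congr rfl fun a ha => ?_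
      rw [Finset.mem_Ico] at ha
      rw [hself a (by rw [Finset.mem_Icc]; omega), hself (a + 1) (by rw [Finset.mem_Icc]; omega),
        hprod a (fun z => z - (l m (i.idx (a + 1)) (a + 1) - 1) - 1),
        hprod (a + 1) (fun z => z - (l m (i.idx a) a - 1)),
        hprod (a + 1) (fun z => z - (l m (i.idx (a + 1)) (a + 1) - 1)),
        hprod a (fun z => z - (l m (i.idx a) a - 1) - 1)]
      congr 2
      · congr 1
        · exact Finset.prod_congr rfl fun k _ => by ring
        · exact Finset.prod_congr rfl fun k _ => by ring
      · congr 1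
        · exact Finset.prod_congr rfl fun k _ => by ring
        · exact Finset.prod_congr rfl fun k _ => by ring
  · congr 1
    funext a
    rw [shiftPath_apply, Function.update_apply]
    by_cases h : a = i.idx n
    · subst h; simp [hjn]; ring
    · simp [h]

/-! ### Real matrices acting through an orthonormal basis -/

section RealOp

variable {ι : Type*} [Fintype ι] [DecidableEq ι]
  {W : Type*} [NormedAddCommGroup W] [InnerProductSpace ℂ W]

/-- The operator whose matrix in the orthonormal basis `e` is the real matrix `A`. -/
noncomputable def realOp (e : OrthonormalBasis ι ℂ W) : Matrix ι ι ℝ →ₐ[ℝ] Module.End ℂ W :=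
  ((Matrix.toLinAlgEquiv e.toBasis).toAlgHom.restrictScalars ℝ).comp
    (Algebra.ofId ℝ ℂ).mapMatrix

variable (e : OrthonormalBasis ι ℂ W)

theorem realOp_eq (A : Matrix ι ι ℝ) :
    realOp e A = Matrix.toLin e.toBasis e.toBasis (A.map (algebraMap ℝ ℂ)) := rfl

theorem realOp_lie (A B : Matrix ι ι ℝ) : realOp e ⁅A, B⁆ = ⁅realOp e A, realOp e B⁆ := by
  rw [Ring.lie_def, Ring.lie_def, map_sub, map_mul, map_mul]

theorem realOp_smul (t : ℝ) (A : Matrix ι ι ℝ) : realOp e (t • A) = (t : ℂ) • realOp e A := by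
  rw [map_smul]; ext v; simp

theorem realOp_basis (A : Matrix ι ι ℝ) (i : ι) :
    realOp e A (e i) = ∑ j, (A j i : ℂ) • e j := by
  rw [realOp_eq]
  have := Matrix.toLin_self e.toBasis e.toBasis (A.map (algebraMap ℝ ℂ)) i
  simpa using this

theorem realOp_repr (A : Matrix ι ι ℝ) (u : W) (i : ι) :
    e.repr (realOp e A u) i = ∑ j, (A i j : ℂ) * e.repr u j := by
  have h : realOp e A u = ∑ j, e.repr u j • realOp e A (e j) := by
    conv_lhs => rw [← e.sum_repr u]
    simp
  rw [h]
  simp only [realOp_basis, Finset.smul_sum, smul_smul]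
  rw [Finset.sum_comm]
  simp only [← Finset.sum_smul]
  have : ∀ c : ι → ℂ, e.repr (∑ j, c j • e j) i = c i := by
    intro c
    simp [Pi.single_apply]
  rw [this]
  exact Finset.sum_congr rfl fun j _ => mul_comm _ _

theorem realOp_adjoint (A : Matrix ι ι ℝ) (u v : W) :
    inner ℂ (realOp e A u) v = inner ℂ u (realOp e A.transpose v) := by
  rw [← e.repr.inner_map_map, ← e.repr.inner_map_map u]
  simp only [PiLp.inner_apply, realOp_repr, RCLike.inner_apply, map_sum, map_mul, Finset.mul_sum,
    Finset.sum_mul, Complex.conj_ofReal, Matrix.transpose_apply]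
  rw [Finset.sum_comm]
  exact Finset.sum_congr rfl fun i _ => Finset.sum_congr rfl fun j _ => by ring

end RealOp

/-! ### The model is a parafermion Fock space -/

section Fock

variable {n p : ℕ} {m : ℕ → ℕ → ℤ}

/-- The weights lie between those of the zero pattern and those of the pattern with all entries `p`:
by interlacing, the row sums of two consecutive rows differ by an amount between `0` and `p`. -/
theorem IsGZPattern.weightVal_mem (h : IsGZPattern n p m) {k : ℕ} (hk : 1 ≤ k) (hkn : k ≤ n) :
    -(p : ℝ) / 2 ≤ weightVal p m k ∧ weightVal p m k ≤ (p : ℝ) / 2 := by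
  unfold weightVal
  obtain ⟨c, rfl⟩ : ∃ c, k = c + 1 := ⟨k - 1, by omega⟩
  rw [Nat.add_sub_cancel]
  constructor
  · rw [Finset.sum_Icc_succ_top (by omega)]
    have h1 : ∑ q ∈ Finset.Icc 1 c, (m q c : ℝ) ≤ ∑ q ∈ Finset.Icc 1 c, (m q (c + 1) : ℝ) :=
      Finset.sum_le_sum fun q hq => by
        rw [Finset.mem_Icc] at hq
        exact_mod_cast (h.between q c hq.1 hq.2 hkn).2
    have h2 : (0 : ℝ) ≤ m (c + 1) (c + 1) := by exact_mod_cast h.nonneg _ _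
    linarith
  · have e1 : ∑ q ∈ Finset.Icc 1 (c + 1), (m q (c + 1) : ℝ) =
        m 1 (c + 1) + ∑ q ∈ Finset.Icc 1 c, (m (q + 1) (c + 1) : ℝ) := by
      rw [← Finset.Ico_succ_right_eq_Icc, ← Finset.Ico_succ_right_eq_Icc,
        Finset.sum_eq_sum_Ico_succ_bot (by simp)]
      congr 1
      exact (Finset.sum_Ico_add' (fun q => (m q (c + 1) : ℝ)) 1 (c + 1) 1).symm
    have h1 : ∑ q ∈ Finset.Icc 1 c, (m (q + 1) (c + 1) : ℝ) ≤ ∑ q ∈ Finset.Icc 1 c, (m q c : ℝ) :=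
      Finset.sum_le_sum fun q hq => by
        rw [Finset.mem_Icc] at hq
        exact_mod_cast (h.between q c hq.1 hq.2 hkn).1
    have h2 : (m 1 (c + 1) : ℝ) ≤ p := by exact_mod_cast h.le _ _
    rw [e1]
    linarith

theorem weightVal_zero (p k : ℕ) : weightVal p (fun _ _ => 0) k = -(p : ℝ) / 2 := by
  unfold weightVal; simp

theorem weightMat_lie_apply (k : ℕ) (A : Matrix (GZPattern n p) (GZPattern n p) ℝ)
    (m' m : GZPattern n p) :
    ⁅weightMat n p k, A⁆ m' m = (weightVal p m'.1 k - weightVal p m.1 k) * A m' m := by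
  rw [Ring.lie_def, Matrix.sub_apply, weightMat, Matrix.diagonal_mul, Matrix.mul_diagonal]
  ring

/-- An operator that lowers some weight kills the vacuum. -/
theorem apply_zero_eq_zero_of_weight {k : ℕ} (hk : 1 ≤ k) (hkn : k ≤ n)
    {A : Matrix (GZPattern n p) (GZPattern n p) ℝ} (hA : ⁅weightMat n p k, A⁆ = -A)
    (m' : GZPattern n p) : A m' (GZPattern.zero n p) = 0 := by
  have h1 := weightMat_lie_apply k A m' (GZPattern.zero n p)
  have h2 := (m'.2.weightVal_mem hk hkn).1
  rw [hA, Matrix.neg_apply, show (GZPattern.zero n p).1 = fun _ _ => 0 from rfl,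
    weightVal_zero] at h1
  have h3 : (weightVal p m'.1 k + p / 2 + 1) * A m' (GZPattern.zero n p) = 0 := by linarith
  rcases mul_eq_zero.mp h3 with h | h
  · linarith
  · exact h

theorem lie_weightMat_transpose {j l : ℕ} (hj : 1 ≤ j) (hjn : j ≤ n) (hl : 1 ≤ l)
    (hln : l ≤ n) : ⁅weightMat n p j, (vectorMat n p l).transpose⁆ =
      -((if j = l then (1 : ℝ) else 0) • (vectorMat n p l).transpose) := by
  have H := isChevalleySystem_model (hj.trans hjn) p
  have h1 := congrArg Matrix.transpose (H.weight_a hj hjn hl hln)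
  rw [transpose_lie, H.symm, Matrix.transpose_smul] at h1
  rw [← lie_skew, h1]

variable {W : Type*} [NormedAddCommGroup W] [InnerProductSpace ℂ W]

/-- The operators `f_{j+1}^±` in an orthonormal basis indexed by patterns. -/
noncomputable def modelOp (e : OrthonormalBasis (GZPattern n p) ℂ W) (j : Fin n) (ξ : ℤˣ) :
    Module.End ℂ W :=
  realOp e (if ξ = 1 then vectorMat n p (j + 1) else (vectorMat n p (j + 1)).transpose)

variable (e : OrthonormalBasis (GZPattern n p) ℂ W)

theorem modelOp_one (j : Fin n) : modelOp e j 1 = realOp e (vectorMat n p (j + 1)) := rfl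

theorem modelOp_neg_one (j : Fin n) :
    modelOp e j (-1) = realOp e (vectorMat n p (j + 1)).transpose := by
  unfold modelOp; rw [if_neg (by decide)]

theorem modelOp_adjoint (j : Fin n) (ξ : ℤˣ) (u v : W) :
    inner ℂ (modelOp e j ξ u) v = inner ℂ u (modelOp e j (-ξ) v) := by
  rcases Int.units_eq_one_or ξ with rfl | rfl
  · rw [modelOp_one, modelOp_neg_one, realOp_adjoint]
  · rw [neg_neg, modelOp_one, modelOp_neg_one, realOp_adjoint, Matrix.transpose_transpose]

theorem modelOp_triple (j k l : Fin n) (ξ η ε : ℤˣ) :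
    ⁅⁅modelOp e j ξ, modelOp e k η⁆, modelOp e l ε⁆ =
      ((1 / 2 : ℂ) * (((ε : ℤ) : ℂ) - ((η : ℤ) : ℂ)) ^ 2 * (if k = l then 1 else 0)) •
        modelOp e j ξ -
      ((1 / 2 : ℂ) * (((ε : ℤ) : ℂ) - ((ξ : ℤ) : ℂ)) ^ 2 * (if j = l then 1 else 0)) •
        modelOp e k η := by
  have H := isChevalleySystem_model (n := n) (by have := j.2; omega) p
  have := H.triple (j := j + 1) (k := k + 1) (l := l + 1) (by omega) (by omega) (by omega)
    (by omega) (by omega) (by omega) ξ η ε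
    (g := fun k ξ => if ξ = 1 then vectorMat n p k else (vectorMat n p k).transpose)
    (fun k => if_pos rfl) (fun k => if_neg (by decide))
  have := congrArg (realOp e) this
  rw [realOp_lie, realOp_lie, map_sub, realOp_smul, realOp_smul] at this
  simp only [add_left_inj, Fin.val_inj] at this
  unfold modelOp
  rw [this]
  push_cast
  simp only [apply_ite (Complex.ofReal), Complex.ofReal_one, Complex.ofReal_zero]

theorem modelOp_annihilate (j : Fin n) : modelOp e j (-1) (e (GZPattern.zero n p)) = 0 := by
  rw [modelOp_neg_one, realOp_basis]
  refine Finset.sum_eq_zero fun m _ => ?_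
  have h0 : ⁅weightMat n p (j + 1), (vectorMat n p (j + 1)).transpose⁆ =
      -(vectorMat n p (j + 1)).transpose := by
    rw [lie_weightMat_transpose (by omega) (by omega) (by omega) (by omega), if_pos rfl, one_smul]
  rw [apply_zero_eq_zero_of_weight (by omega) (by omega) h0, Complex.ofReal_zero, zero_smul]

theorem realOp_weightMat (k : ℕ) (m : GZPattern n p) :
    realOp e (weightMat n p k) (e m) = (weightVal p m.1 k : ℂ) • e m := by
  rw [realOp_basis, Finset.sum_eq_single m]
  · rw [weightMat, Matrix.diagonal_apply_eq]
  · intro b _ hb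
    rw [weightMat, Matrix.diagonal_apply_ne _ hb, Complex.ofReal_zero, zero_smul]
  · exact fun h => absurd (Finset.mem_univ _) h

theorem modelOp_order (j k : Fin n) : ⁅modelOp e j (-1), modelOp e k 1⁆ (e (GZPattern.zero n p)) =
    ((p : ℂ) * (if j = k then 1 else 0)) • e (GZPattern.zero n p) := by
  have H := isChevalleySystem_model (n := n) (by have := j.2; omega) p
  rw [modelOp_one, modelOp_neg_one, ← realOp_lie]
  by_cases hjk : j = k
  · subst hjk
    rw [← lie_skew, H.lie_a_b (by omega) (by omega), map_neg, realOp_smul, LinearMap.neg_apply,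
      LinearMap.smul_apply, realOp_weightMat, show (GZPattern.zero n p).1 = fun _ _ => 0 from rfl,
      weightVal_zero, if_pos rfl, smul_smul, ← neg_smul]
    congr 1
    push_cast
    ring
  · rw [if_neg hjk, mul_zero, zero_smul, realOp_basis]
    refine Finset.sum_eq_zero fun m _ => ?_
    have hne : (j : ℕ) + 1 ≠ k + 1 := fun h => hjk (Fin.ext (by omega))
    have h0 : ⁅weightMat n p (j + 1), ⁅(vectorMat n p (j + 1)).transpose, vectorMat n p (k + 1)⁆⁆ =
        -⁅(vectorMat n p (j + 1)).transpose, vectorMat n p (k + 1)⁆ := by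
      rw [leibniz_lie, lie_weightMat_transpose (by omega) (by omega) (by omega) (by omega),
        if_pos rfl, one_smul, H.weight_a (by omega) (by omega) (by omega) (by omega), if_neg hne,
        zero_smul, lie_zero, add_zero, neg_lie]
    rw [apply_zero_eq_zero_of_weight (by omega) (by omega) h0, Complex.ofReal_zero, zero_smul]

end Fock

/-! ### Irreducibility of the model -/

section Irreducible

variable {n p : ℕ} {W : Type*} [NormedAddCommGroup W] [InnerProductSpace ℂ W]
  (e : OrthonormalBasis (GZPattern n p) ℂ W)

open Classical in
theorem repr_raiseMat_transpose (k : ℕ) (v : W) (m : GZPattern n p) :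
    e.repr (realOp e (raiseMat n p k).transpose v) m = ∑ i ∈ Finset.Icc 1 k,
      if h : IsGZPattern n p (shiftOne m.1 1 i k) then
        (√(raiseSq n p k m.1 i) : ℂ) * e.repr v ⟨_, h⟩ else 0 := by
  rw [realOp_repr]
  simp only [Matrix.transpose_apply, raiseMat, Matrix.of_apply, Complex.ofReal_sum,
    Finset.sum_mul]
  rw [Finset.sum_comm]
  refine Finset.sum_congr rfl fun i _ => ?_
  split_ifs with h
  · rw [Finset.sum_eq_single ⟨_, h⟩]
    · rw [if_pos rfl]
    · intro q _ hq
      rw [if_neg (fun h' => hq (Subtype.ext h')), Complex.ofReal_zero, zero_mul]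
    · exact fun h => absurd (Finset.mem_univ _) h
  · refine Finset.sum_eq_zero fun q _ => ?_
    rw [if_neg (fun h' : q.1 = _ => h (by rw [← h']; exact q.2)), Complex.ofReal_zero, zero_mul]

/-- If `v` is killed by the lowering operator of row `k`, and on the support of `v` every entry
`(i, k - 1)` equals the entry `(i + 1, k)`, then no entry of row `k` can be lowered on the support:
lowering one and raising another entry leaves the support, so nothing cancels. -/
theorem not_lower_of_killed {k : ℕ} (hkn : k ≤ n) {v : W}
    (hv : realOp e (raiseMat n p k).transpose v = 0)
    (hs : ∀ m : GZPattern n p, e.repr v m ≠ 0 → ∀ i, 1 ≤ i → i < k → m.1 i (k - 1) = m.1 (i + 1) k)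
    (m : GZPattern n p) (hm : e.repr v m ≠ 0) {i : ℕ} (hi : 1 ≤ i) (hik : i ≤ k) :
    ¬ IsGZPattern n p (shiftOne m.1 (-1) i k) := by
  intro hlow
  have hback : shiftOne (shiftOne m.1 (-1) i k) 1 i k = m.1 := by
    rw [shiftOne_shiftOne_self]; simp [shiftOne_zero]
  have h0 := repr_raiseMat_transpose e k v ⟨_, hlow⟩
  rw [hv, map_zero, Finset.sum_eq_single i] at h0
  · have hval : IsGZPattern n p (shiftOne (shiftOne m.1 (-1) i k) 1 i k) := by
      rw [hback]; exact m.2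
    rw [dif_pos hval] at h0
    have hpos := raiseSq_pos hlow hi hik hkn hval
    have hm' : (⟨_, hval⟩ : GZPattern n p) = m := Subtype.ext hback
    rw [hm'] at h0
    have h0' : ((√(raiseSq n p k (shiftOne m.1 (-1) i k) i) : ℝ) : ℂ) * e.repr v m = 0 := h0.symm
    rcases mul_eq_zero.mp h0' with h | h
    · have := Real.sqrt_pos.mpr hpos
      exact this.ne' (by exact_mod_cast h)
    · exact hm h
  · intro q hq hqi
    rw [Finset.mem_Icc] at hq
    split_ifs with h
    · suffices hz : e.repr v ⟨_, h⟩ = 0 by rw [hz, mul_zero]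
      by_contra hne
      have ev : ∀ a b, shiftOne (shiftOne m.1 (-1) i k) 1 q k a b =
          m.1 a b + (if a = i ∧ b = k then -1 else 0) + if a = q ∧ b = k then 1 else 0 := by
        intro a b; rw [shiftOne_apply, shiftOne_apply]
      have key : ∀ r, 1 ≤ r → r < k → (if r + 1 = i then (-1 : ℤ) else 0) +
          (if r + 1 = q then 1 else 0) = 0 := by
        intro r hr hrk
        have s1 := hs m hm r hr hrk
        have s2 := hs _ hne r hr hrk
        simp only [ev] at s2
        rw [if_neg (fun h => by omega), if_neg (fun h => by omega)] at s2
        simp only [and_true] at s2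
        omega
      rcases Nat.lt_or_ge 1 i with h1 | h1
      · have := key (i - 1) (by omega) (by omega)
        rw [if_pos (by omega), if_neg (by omega)] at this
        omega
      · have := key (q - 1) (by omega) (by omega)
        rw [if_neg (by omega), if_pos (by omega)] at this
        omega
    · rfl
  · intro h; exact absurd (Finset.mem_Icc.mpr ⟨hi, hik⟩) h

/-- On the support of a vector killed by all lowering operators, the rows below the top are
determined by the top row; the proof goes up row by row. -/
theorem support_of_killed {v : W}
    (hv : ∀ k, 1 ≤ k → k ≤ n → realOp e (raiseMat n p k).transpose v = 0) :
    ∀ k, k < n → ∀ m : GZPattern n p, e.repr v m ≠ 0 → ∀ i, 1 ≤ i → i ≤ k →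
      m.1 i k = m.1 (i + 1) (k + 1) := by
  intro k
  induction k with
  | zero => intro _ m _ i h1 h2; omega
  | succ k ih =>
    intro hk m hm i hi hik
    have h1 := not_lower_of_killed e hk.le (hv _ (by omega) hk.le)
      (fun m hm i hi hik => ih (by omega) m hm i hi (by omega)) m hm hi hik
    rw [m.2.lower_iff hi hik hk.le] at h1
    have h2 := (m.2.between i (k + 1) hi hik (by omega)).1
    by_contra hne
    refine h1 ⟨fun h3 => ?_, fun _ => by omega, fun h => by omega⟩
    have h4 := ih (by omega) m hm i hi (by omega)
    have h5 := m.2.antitone (i := i + 1) (j := i + 1) (k := k + 2) (by omega) le_rfl (by omega) hk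
    have h6 := (m.2.between (i + 1) (k + 1) (by omega) (by omega) (by omega)).2
    rw [Nat.add_sub_cancel]
    omega

/-- A vector killed by all lowering operators is supported on the zero pattern: in addition to
`support_of_killed`, no entry of the top row can be lowered. -/
theorem eq_zero_of_killed {v : W}
    (hv : ∀ k, 1 ≤ k → k ≤ n → realOp e (raiseMat n p k).transpose v = 0)
    (m : GZPattern n p) (hm : e.repr v m ≠ 0) : m = GZPattern.zero n p := by
  rcases Nat.eq_zero_or_pos n with h0 | hn
  · apply Subtype.ext
    funext a b
    exact m.2.supp a b (by omega)
  have hs := fun m hm i (hi : 1 ≤ i) (hik : i < n) =>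
    support_of_killed e hv (n - 1) (by omega) m hm i hi (by omega)
  rw [Nat.sub_add_cancel hn] at hs
  have hno := fun i (hi : 1 ≤ i) (hin : i ≤ n) =>
    not_lower_of_killed e le_rfl (hv n hn le_rfl) hs m hm hi hin
  have htop : ∀ d i, 1 ≤ i → i + d = n → m.1 i n = 0 := by
    intro d
    induction d with
    | zero =>
      intro i hi hd
      have h1 := hno i hi (by omega)
      rw [m.2.lower_iff hi (by omega) le_rfl] at h1
      by_contra hne
      have := m.2.nonneg i n
      exact h1 ⟨fun h => by omega, fun h => by omega, fun _ _ => by omega⟩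
    | succ d ih =>
      intro i hi hd
      have h1 := hno i hi (by omega)
      rw [m.2.lower_iff hi (by omega) le_rfl] at h1
      by_contra hne
      have h2 := m.2.nonneg i n
      have h3 := hs m hm i hi (by omega)
      have h4 := ih (i + 1) (by omega) (by omega)
      exact h1 ⟨fun h => by omega, fun h => by omega, fun _ _ => by omega⟩
  apply Subtype.ext
  funext a b
  show m.1 a b = 0
  by_cases hab : 1 ≤ a ∧ a ≤ b ∧ b ≤ n
  · have up : ∀ d b, a ≤ b → b + d = n → m.1 a b ≤ m.1 a n := by
      intro d
      induction d with
      | zero => intro b _ hd; rw [show b = n by omega]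
      | succ d ih =>
        intro b hb hd
        exact (m.2.between a b hab.1 hb (by omega)).2.trans (ih (b + 1) (by omega) (by omega))
    have h1 := up (n - b) b hab.2.1 (by omega)
    rw [htop (n - a) a hab.1 (by omega)] at h1
    exact le_antisymm h1 (m.2.nonneg _ _)
  · exact m.2.supp a b hab

/-- The sum of the entries of an array. -/
def entrySum (n : ℕ) (m : ℕ → ℕ → ℤ) : ℤ :=
  ∑ b ∈ Finset.range (n + 1), ∑ a ∈ Finset.range (n + 1), m a b

theorem entrySum_shiftOne {m : ℕ → ℕ → ℤ} {i k : ℕ} (hik : i ≤ k) (hkn : k ≤ n) :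
    entrySum n (shiftOne m 1 i k) = entrySum n m + 1 := by
  unfold entrySum
  simp only [shiftOne_apply, Finset.sum_add_distrib]
  congr 1
  rw [Finset.sum_eq_single k, Finset.sum_eq_single i]
  · simp
  · intro a _ ha; simp [ha]
  · intro h; exact absurd (Finset.mem_range.mpr (by omega)) h
  · intro b _ hb; simp [hb]
  · intro h; exact absurd (Finset.mem_range.mpr (by omega)) h

theorem IsGZPattern.entrySum_nonneg {m : ℕ → ℕ → ℤ} (h : IsGZPattern n p m) : 0 ≤ entrySum n m :=
  Finset.sum_nonneg fun _ _ => Finset.sum_nonneg fun _ _ => h.nonneg _ _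

/-- A nonzero subspace stable under the lowering operators contains the vacuum: a vector in it
supported in minimal degree is killed by the lowering operators. -/
theorem zero_mem_of_invariant {U : Submodule ℂ W} (hU : U ≠ ⊥)
    (hinv : ∀ k, 1 ≤ k → k ≤ n → ∀ u ∈ U, realOp e (raiseMat n p k).transpose u ∈ U) :
    e (GZPattern.zero n p) ∈ U := by
  classical
  obtain ⟨u₀, hu₀, hne₀⟩ := U.ne_bot_iff.mp hU
  -- `d` is a strict bound for the degrees in the support of a nonzero vector of `U`
  have hex : ∃ d : ℕ, ∃ u ∈ U, u ≠ 0 ∧ ∀ m, e.repr u m ≠ 0 → entrySum n m.1 < d := by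
    refine ⟨(∑ m : GZPattern n p, entrySum n m.1).toNat + 1, u₀, hu₀, hne₀, fun m _ => ?_⟩
    have : entrySum n m.1 ≤ ∑ m : GZPattern n p, entrySum n m.1 :=
      Finset.single_le_sum (f := fun m : GZPattern n p => entrySum n m.1)
        (fun m _ => m.2.entrySum_nonneg) (Finset.mem_univ m)
    omega
  obtain ⟨u, hu, hne, hsupp⟩ := Nat.find_spec hex
  have hkill : ∀ k, 1 ≤ k → k ≤ n → realOp e (raiseMat n p k).transpose u = 0 := by
    intro k hk hkn
    by_contra hk0
    have hd : Nat.find hex ≠ 0 := by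
      intro h0
      apply hne
      rw [h0] at hsupp
      rw [← e.repr.map_eq_zero_iff]
      ext m
      by_contra hm
      have := hsupp m hm
      have := m.2.entrySum_nonneg
      omega
    refine Nat.find_min hex (m := Nat.find hex - 1) (by omega) ⟨_, hinv k hk hkn u hu, hk0, ?_⟩
    intro m hm
    rw [repr_raiseMat_transpose] at hm
    obtain ⟨i, hi, hi0⟩ := Finset.exists_ne_zero_of_sum_ne_zero hm
    rw [Finset.mem_Icc] at hi
    split_ifs at hi0 with h
    · have := hsupp _ (right_ne_zero_of_mul hi0)
      simp only [entrySum_shiftOne hi.2 hkn] at this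
      omega
    · exact absurd rfl hi0
  have hall := eq_zero_of_killed e hkill
  have hrep : u = e.repr u (GZPattern.zero n p) • e (GZPattern.zero n p) := by
    conv_lhs => rw [← e.sum_repr u]
    refine Finset.sum_eq_single _ (fun b _ hb => ?_) (fun h => absurd (Finset.mem_univ _) h)
    by_contra h
    exact hb (hall b (fun h' => h (by rw [h', zero_smul])))
  have hc : e.repr u (GZPattern.zero n p) ≠ 0 := by
    intro h; rw [h, zero_smul] at hrep; exact hne hrep
  rw [hrep] at hu
  exact (U.smul_mem_iff hc).mp hu

/-- The lowering matrices are obtained from the `f_j^±`: `E_nᵀ = f_n^-` and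
`2 E_kᵀ = [f_{k+1}^+, f_k^-]`. -/
theorem invariant_raiseMat {U : Submodule ℂ W}
    (hinv : ∀ j ξ, ∀ u ∈ U, modelOp e j ξ u ∈ U) {k : ℕ} (hk : 1 ≤ k) (hkn : k ≤ n) {u : W}
    (hu : u ∈ U) : realOp e (raiseMat n p k).transpose u ∈ U := by
  have H := isChevalleySystem_model (hk.trans hkn) p
  have up : ∀ j, 1 ≤ j → j ≤ n → ∀ u ∈ U, realOp e (vectorMat n p j) u ∈ U := by
    intro j hj hjn u hu
    have := hinv ⟨j - 1, by omega⟩ 1 u hu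
    rw [modelOp_one] at this
    rwa [Fin.val_mk, Nat.sub_add_cancel hj] at this
  have down : ∀ j, 1 ≤ j → j ≤ n → ∀ u ∈ U, realOp e (vectorMat n p j).transpose u ∈ U := by
    intro j hj hjn u hu
    have := hinv ⟨j - 1, by omega⟩ (-1) u hu
    rw [modelOp_neg_one] at this
    rwa [Fin.val_mk, Nat.sub_add_cancel hj] at this
  rcases hkn.eq_or_lt with rfl | hlt
  · rw [← H.a_last]
    exact down k hk le_rfl u hu
  · have h1 := congrArg Matrix.transpose (H.E_eq hk hlt)
    rw [transpose_lie, Matrix.transpose_smul, Matrix.transpose_transpose] at h1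
    have h2 : (raiseMat n p k).transpose =
        (1 / 2 : ℝ) • ⁅vectorMat n p (k + 1), (vectorMat n p k).transpose⁆ := by
      rw [← h1, smul_smul]; norm_num
    rw [h2, realOp_smul, realOp_lie, Ring.lie_def]
    exact U.smul_mem _ (U.sub_mem (up _ (by omega) hlt _ (down _ hk hkn _ hu))
      (down _ hk hkn _ (up _ (by omega) hlt _ hu)))

/-- An invariant subspace and its orthogonal complement cannot both contain the vacuum. -/
theorem modelOp_irreducible (U : Submodule ℂ W) (hinv : ∀ j ξ, ∀ u ∈ U, modelOp e j ξ u ∈ U) :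
    U = ⊥ ∨ U = ⊤ := by
  have : FiniteDimensional ℂ W := e.toBasis.finiteDimensional_of_finite
  by_contra! hcon
  have h1 := zero_mem_of_invariant e hcon.1 fun k hk hkn u hu => invariant_raiseMat e hinv hk hkn hu
  have hinv' : ∀ j ξ, ∀ u ∈ Uᗮ, modelOp e j ξ u ∈ Uᗮ := by
    intro j ξ u hu
    rw [Submodule.mem_orthogonal'] at hu ⊢
    intro w hw
    rw [modelOp_adjoint]
    exact hu _ (hinv _ _ _ hw)
  have h2 := zero_mem_of_invariant e (U := Uᗮ)
    (fun h => hcon.2 (Submodule.orthogonal_eq_bot_iff.mp h))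
    fun k hk hkn u hu => invariant_raiseMat e hinv' hk hkn hu
  have h3 := (Submodule.mem_orthogonal U _).mp h2 _ h1
  rw [inner_self_eq_zero] at h3
  exact e.orthonormal.ne_zero _ h3

theorem isFockSpace_model : IsFockSpace n p W (modelOp e) (e (GZPattern.zero n p)) where
  triple := modelOp_triple e
  vac_norm := by
    rw [inner_self_eq_norm_sq_to_K, e.orthonormal.norm_eq_one]; simp
  annihilate := modelOp_annihilate e
  adjoint := modelOp_adjoint e
  order := modelOp_order e
  irreducible U _ := modelOp_irreducible e U

end Irreducible

/-! ### Uniqueness of the Fock space -/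

section CreationSpan

variable {n : ℕ} {M : Type*} [AddCommGroup M] [Module ℂ M]

/-- The span of the vectors obtained from `v` by applying products of the operators `F j 1`. -/
def creationSpan (F : Fin n → ℤˣ → Module.End ℂ M) (v : M) : Submodule ℂ M :=
  Submodule.span ℂ (Set.range fun L : List (Fin n) => L.foldr (fun j x => F j 1 x) v)

variable {F : Fin n → ℤˣ → Module.End ℂ M} {v : M}

theorem word_mem_creationSpan (L : List (Fin n)) :
    L.foldr (fun j x => F j 1 x) v ∈ creationSpan F v := Submodule.subset_span ⟨L, rfl⟩

theorem self_mem_creationSpan : v ∈ creationSpan F v := word_mem_creationSpan []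

theorem apply_mem_creationSpan {T : Module.End ℂ M}
    (hT : ∀ L : List (Fin n), T (L.foldr (fun j x => F j 1 x) v) ∈ creationSpan F v) {u : M}
    (hu : u ∈ creationSpan F v) : T u ∈ creationSpan F v := by
  have : creationSpan F v ≤ (creationSpan F v).comap T := by
    refine Submodule.span_le.mpr ?_
    rintro _ ⟨L, rfl⟩
    exact hT L
  exact this hu

theorem plus_mem_creationSpan (j : Fin n) {u : M} (hu : u ∈ creationSpan F v) :
    F j 1 u ∈ creationSpan F v :=
  apply_mem_creationSpan (fun L => word_mem_creationSpan (j :: L)) hu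

/-- `creationSpan` is stable under the annihilation operators: move them to the right through the
creation operators. Only those triple relations that express `[[F j (-1), F k 1], F l 1]` enter. -/
theorem minus_mem_creationSpan
    (triple : ∀ j k l : Fin n,
      ⁅⁅F j (-1), F k 1⁆, F l 1⁆ = -((if j = l then (2 : ℂ) else 0) • F k 1))
    (annihilate : ∀ j, F j (-1) v = 0)
    (order : ∀ j k, ∃ c : ℂ, ⁅F j (-1), F k 1⁆ v = c • v) (j : Fin n) {u : M}
    (hu : u ∈ creationSpan F v) : F j (-1) u ∈ creationSpan F v := by
  -- the commutators `[F j (-1), F k 1]` already preserve the space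
  have hD : ∀ j k, ∀ L : List (Fin n),
      ⁅F j (-1), F k 1⁆ (L.foldr (fun j x => F j 1 x) v) ∈ creationSpan F v := by
    intro j k L
    induction L with
    | nil =>
      obtain ⟨c, hc⟩ := order j k
      rw [List.foldr_nil, hc]
      exact Submodule.smul_mem _ _ self_mem_creationSpan
    | cons l L ih =>
      have h1 := LinearMap.congr_fun (triple j k l) (L.foldr (fun j x => F j 1 x) v)
      rw [Ring.lie_def, LinearMap.sub_apply, Module.End.mul_apply, Module.End.mul_apply,
        sub_eq_iff_eq_add] at h1
      rw [List.foldr_cons, h1]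
      refine Submodule.add_mem _ ?_ (plus_mem_creationSpan _ ih)
      exact Submodule.neg_mem _ (Submodule.smul_mem _ _
        (plus_mem_creationSpan _ (word_mem_creationSpan L)))
  refine apply_mem_creationSpan (fun L => ?_) hu
  induction L with
  | nil => rw [List.foldr_nil, annihilate]; exact Submodule.zero_mem _
  | cons l L ih =>
    have h1 : F j (-1) (F l 1 (L.foldr (fun j x => F j 1 x) v)) =
        ⁅F j (-1), F l 1⁆ (L.foldr (fun j x => F j 1 x) v) +
          F l 1 (F j (-1) (L.foldr (fun j x => F j 1 x) v)) := by
      rw [Ring.lie_def, LinearMap.sub_apply, Module.End.mul_apply, Module.End.mul_apply,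
        sub_add_cancel]
    rw [List.foldr_cons, h1]
    exact Submodule.add_mem _ (hD _ _ _) (plus_mem_creationSpan _ ih)

end CreationSpan

section Uniqueness

variable {n p : ℕ} {V W : Type*} [NormedAddCommGroup V] [InnerProductSpace ℂ V]
  [NormedAddCommGroup W] [InnerProductSpace ℂ W] {f : Fin n → ℤˣ → Module.End ℂ V}
  {g : Fin n → ℤˣ → Module.End ℂ W} {v₀ : V} {w₀ : W}

theorem IsFockSpace.triple_minus_plus (h : IsFockSpace n p V f v₀) (j k l : Fin n) :
    ⁅⁅f j (-1), f k 1⁆, f l 1⁆ = -((if j = l then (2 : ℂ) else 0) • f k 1) := by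
  rw [h.triple]
  by_cases hjl : j = l <;> simp [hjl]
  norm_num

theorem IsFockSpace.minus_mem (h : IsFockSpace n p V f v₀) (j : Fin n) {u : V}
    (hu : u ∈ creationSpan f v₀) : f j (-1) u ∈ creationSpan f v₀ :=
  minus_mem_creationSpan h.triple_minus_plus h.annihilate (fun j k => ⟨_, h.order j k⟩) j hu

/-- Irreducibility concerns closed subspaces only, whence the hypothesis; it holds when the span is
finite-dimensional. -/
theorem IsFockSpace.creationSpan_eq_top (h : IsFockSpace n p V f v₀)
    (hc : IsClosed (creationSpan f v₀ : Set V)) : creationSpan f v₀ = ⊤ := by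
  refine (h.irreducible _ hc fun j ξ u hu => ?_).resolve_left fun h0 => ?_
  · rcases Int.units_eq_one_or ξ with rfl | rfl
    · exact plus_mem_creationSpan j hu
    · exact h.minus_mem j hu
  · have h1 : v₀ ∈ creationSpan f v₀ := self_mem_creationSpan
    rw [h0, Submodule.mem_bot] at h1
    have := h.vac_norm
    rw [h1, inner_zero_left] at this
    exact zero_ne_one this

/-- A vector killed by the annihilation operators is a multiple of the vacuum: its component
orthogonal to the vacuum is orthogonal to everything created from the vacuum. -/
theorem IsFockSpace.vacuum_unique (h : IsFockSpace n p V f v₀) (ht : creationSpan f v₀ = ⊤) {v : V}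
    (hv : ∀ j, f j (-1) v = 0) : ∃ c : ℂ, v = c • v₀ := by
  refine ⟨inner ℂ v₀ v, sub_eq_zero.mp ?_⟩
  set u := v - (inner ℂ v₀ v : ℂ) • v₀ with hu
  have hu0 : ∀ j, f j (-1) u = 0 := by
    intro j; rw [hu, map_sub, map_smul, hv, h.annihilate, smul_zero, sub_zero]
  have hle : creationSpan f v₀ ≤ (ℂ ∙ u)ᗮ := by
    refine Submodule.span_le.mpr ?_
    rintro _ ⟨L, rfl⟩
    rw [SetLike.mem_coe, Submodule.mem_orthogonal_singleton_iff_inner_left]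
    cases L with
    | nil =>
      show inner ℂ v₀ u = 0
      rw [hu, inner_sub_right, inner_smul_right, h.vac_norm, mul_one, sub_self]
    | cons j L =>
      show inner ℂ (f j 1 (L.foldr (fun j x => f j 1 x) v₀)) u = 0
      rw [h.adjoint, hu0, inner_zero_right]
  rw [ht] at hle
  have := hle (Submodule.mem_top : u ∈ ⊤)
  rwa [Submodule.mem_orthogonal_singleton_iff_inner_left, inner_self_eq_zero] at this

/-- The graph of the identification of two Fock spaces: what is created from the pair of vacua in
their product. -/
def fockGraph (f : Fin n → ℤˣ → Module.End ℂ V) (g : Fin n → ℤˣ → Module.End ℂ W) (v₀ : V)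
    (w₀ : W) : Submodule ℂ (V × W) :=
  creationSpan (fun j ξ => (f j ξ).prodMap (g j ξ)) (v₀, w₀)

theorem fockGraph_word (L : List (Fin n)) :
    L.foldr (fun j x => ((f j 1).prodMap (g j 1)) x) (v₀, w₀) =
      (L.foldr (fun j x => f j 1 x) v₀, L.foldr (fun j x => g j 1 x) w₀) := by
  induction L with
  | nil => rfl
  | cons j L ih => rw [List.foldr_cons, ih]; rfl

theorem fockGraph_plus_mem (j : Fin n) {u : V × W} (hu : u ∈ fockGraph f g v₀ w₀) :
    (f j 1 u.1, g j 1 u.2) ∈ fockGraph f g v₀ w₀ :=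
  plus_mem_creationSpan (F := fun j ξ => (f j ξ).prodMap (g j ξ)) j hu

theorem fockGraph_minus_mem (hf : IsFockSpace n p V f v₀) (hg : IsFockSpace n p W g w₀)
    (j : Fin n) {u : V × W} (hu : u ∈ fockGraph f g v₀ w₀) :
    (f j (-1) u.1, g j (-1) u.2) ∈ fockGraph f g v₀ w₀ := by
  refine minus_mem_creationSpan (F := fun j ξ => (f j ξ).prodMap (g j ξ)) (fun j k l => ?_)
    (fun j => ?_) (fun j k => ?_) j hu
  · refine LinearMap.ext fun x => Prod.ext ?_ ?_
    · exact LinearMap.congr_fun (hf.triple_minus_plus j k l) x.1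
    · exact LinearMap.congr_fun (hg.triple_minus_plus j k l) x.2
  · exact Prod.ext (hf.annihilate j) (hg.annihilate j)
  · exact ⟨_, Prod.ext (hf.order j k) (hg.order j k)⟩

/-- The inner products of created vectors agree in the two spaces: creation operators are moved to
the other side, where they annihilate. -/
theorem fockGraph_inner (hf : IsFockSpace n p V f v₀) (hg : IsFockSpace n p W g w₀)
    {u u' : V × W} (hu : u ∈ fockGraph f g v₀ w₀) (hu' : u' ∈ fockGraph f g v₀ w₀) :
    (inner ℂ u.1 u'.1 : ℂ) = inner ℂ u.2 u'.2 := by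
  have vac : ∀ u' ∈ fockGraph f g v₀ w₀, (inner ℂ v₀ u'.1 : ℂ) = inner ℂ w₀ u'.2 := by
    intro u' hu'
    refine Submodule.span_induction ?_ ?_ ?_ ?_ hu'
    · rintro _ ⟨L, rfl⟩
      simp only [fockGraph_word]
      cases L with
      | nil => exact hf.vac_norm.trans hg.vac_norm.symm
      | cons j L =>
        rw [List.foldr_cons, List.foldr_cons]
        have h1 := hf.adjoint j (-1) v₀ (L.foldr (fun j x => f j 1 x) v₀)
        have h2 := hg.adjoint j (-1) w₀ (L.foldr (fun j x => g j 1 x) w₀)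
        rw [hf.annihilate, inner_zero_left, neg_neg] at h1
        rw [hg.annihilate, inner_zero_left, neg_neg] at h2
        rw [← h1, ← h2]
    · simp
    · intro x y _ _ hx hy
      simp only [Prod.fst_add, Prod.snd_add, inner_add_right, hx, hy]
    · intro c x _ hx
      simp only [Prod.smul_fst, Prod.smul_snd, inner_smul_right, hx]
  refine Submodule.span_induction (p := fun u _ => ∀ u' ∈ fockGraph f g v₀ w₀,
    (inner ℂ u.1 u'.1 : ℂ) = inner ℂ u.2 u'.2) ?_ ?_ ?_ ?_ hu u' hu'
  · rintro _ ⟨L, rfl⟩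
    simp only [fockGraph_word]
    induction L with
    | nil => exact vac
    | cons j L ih =>
      intro u' hu'
      rw [List.foldr_cons, List.foldr_cons, hf.adjoint, hg.adjoint]
      exact ih _ (fockGraph_minus_mem hf hg j hu')
  · simp
  · intro x y _ _ hx hy u' hu'
    simp only [Prod.fst_add, Prod.snd_add, inner_add_left, hx u' hu', hy u' hu']
  · intro c x _ hx u' hu'
    simp only [Prod.smul_fst, Prod.smul_snd, inner_smul_left, hx u' hu']

theorem fockGraph_norm (hf : IsFockSpace n p V f v₀) (hg : IsFockSpace n p W g w₀)
    {u : V × W} (hu : u ∈ fockGraph f g v₀ w₀) : ‖u.1‖ = ‖u.2‖ := by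
  have h := fockGraph_inner hf hg hu hu
  rw [inner_self_eq_norm_sq_to_K, inner_self_eq_norm_sq_to_K] at h
  have h' : ‖u.1‖ ^ 2 = ‖u.2‖ ^ 2 := by exact_mod_cast h
  exact (sq_eq_sq₀ (norm_nonneg _) (norm_nonneg _)).mp h'

theorem map_fst_fockGraph :
    (fockGraph f g v₀ w₀).map (LinearMap.fst ℂ V W) = creationSpan f v₀ := by
  unfold fockGraph creationSpan
  rw [Submodule.map_span, ← Set.range_comp]
  congr 2
  funext L
  exact congrArg Prod.fst (fockGraph_word L)

theorem map_snd_fockGraph :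
    (fockGraph f g v₀ w₀).map (LinearMap.snd ℂ V W) = creationSpan g w₀ := by
  unfold fockGraph creationSpan
  rw [Submodule.map_span, ← Set.range_comp]
  congr 2
  funext L
  exact congrArg Prod.snd (fockGraph_word L)

/-- Two Fock spaces of the same order, one of them finite-dimensional, are isomorphic. -/
theorem IsFockSpace.exists_equiv [FiniteDimensional ℂ V] (hf : IsFockSpace n p V f v₀)
    (hg : IsFockSpace n p W g w₀) : creationSpan g w₀ = ⊤ ∧
      ∃ Φ : V ≃ₗᵢ[ℂ] W, Φ v₀ = w₀ ∧ ∀ j ξ v, Φ (f j ξ v) = g j ξ (Φ v) := by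
  set Γ := fockGraph f g v₀ w₀ with hΓ
  have inj1 : Function.Injective ((LinearMap.fst ℂ V W).domRestrict Γ) := by
    rw [injective_iff_map_eq_zero]
    rintro ⟨u, hu⟩ h0
    have h1 : u.1 = 0 := h0
    have h2 := fockGraph_norm hf hg hu
    rw [h1, norm_zero] at h2
    exact Subtype.ext (Prod.ext h1 (norm_eq_zero.mp h2.symm))
  have inj2 : Function.Injective ((LinearMap.snd ℂ V W).domRestrict Γ) := by
    rw [injective_iff_map_eq_zero]
    rintro ⟨u, hu⟩ h0
    have h1 : u.2 = 0 := h0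
    have h2 := fockGraph_norm hf hg hu
    rw [h1, norm_zero] at h2
    exact Subtype.ext (Prod.ext (norm_eq_zero.mp h2) h1)
  have : FiniteDimensional ℂ Γ := FiniteDimensional.of_injective _ inj1
  have htV : creationSpan f v₀ = ⊤ :=
    hf.creationSpan_eq_top (Submodule.closed_of_finiteDimensional _)
  have htW : creationSpan g w₀ = ⊤ := by
    have : FiniteDimensional ℂ (creationSpan g w₀) := by
      rw [← map_snd_fockGraph (f := f) (v₀ := v₀)]; infer_instance
    exact hg.creationSpan_eq_top (Submodule.closed_of_finiteDimensional _)
  have sur1 : Function.Surjective ((LinearMap.fst ℂ V W).domRestrict Γ) := by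
    intro v
    have : v ∈ Γ.map (LinearMap.fst ℂ V W) := by rw [hΓ, map_fst_fockGraph, htV]; trivial
    obtain ⟨u, hu, rfl⟩ := this
    exact ⟨⟨u, hu⟩, rfl⟩
  have sur2 : Function.Surjective ((LinearMap.snd ℂ V W).domRestrict Γ) := by
    intro w
    have : w ∈ Γ.map (LinearMap.snd ℂ V W) := by rw [hΓ, map_snd_fockGraph, htW]; trivial
    obtain ⟨u, hu, rfl⟩ := this
    exact ⟨⟨u, hu⟩, rfl⟩
  let e1 := LinearEquiv.ofBijective _ ⟨inj1, sur1⟩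
  let e2 := LinearEquiv.ofBijective _ ⟨inj2, sur2⟩
  have hmem : ∀ v, (v, e2 (e1.symm v)) ∈ Γ := by
    intro v
    have h1 : e1 (e1.symm v) = v := e1.apply_symm_apply v
    have h2 : (e1.symm v).1 = (v, e2 (e1.symm v)) := Prod.ext h1 rfl
    rw [← h2]
    exact (e1.symm v).2
  have huniq : ∀ v w, (v, w) ∈ Γ → e2 (e1.symm v) = w := by
    intro v w hvw
    have h1 : e1 ⟨(v, w), hvw⟩ = v := rfl
    have h2 : e1.symm v = ⟨(v, w), hvw⟩ := by rw [LinearEquiv.symm_apply_eq, h1]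
    rw [h2]; rfl
  refine ⟨htW, ⟨e1.symm.trans e2, fun v => (fockGraph_norm hf hg (hmem v)).symm⟩, ?_, ?_⟩
  · exact huniq _ _ self_mem_creationSpan
  · intro j ξ v
    refine huniq _ _ ?_
    rcases Int.units_eq_one_or ξ with rfl | rfl
    · exact fockGraph_plus_mem j (hmem v)
    · exact fockGraph_minus_mem hf hg j (hmem v)

theorem modelOp_map (e : OrthonormalBasis (GZPattern n p) ℂ V) (Φ : V ≃ₗᵢ[ℂ] W) (j : Fin n)
    (ξ : ℤˣ) (v : V) : modelOp (e.map Φ) j ξ (Φ v) = Φ (modelOp e j ξ v) := by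
  have : modelOp (e.map Φ) j ξ ∘ₗ Φ.toLinearEquiv.toLinearMap =
      Φ.toLinearEquiv.toLinearMap ∘ₗ modelOp e j ξ := by
    refine e.toBasis.ext fun m => ?_
    rw [OrthonormalBasis.coe_toBasis]
    show modelOp (e.map Φ) j ξ (Φ (e m)) = Φ (modelOp e j ξ (e m))
    unfold modelOp
    rw [← OrthonormalBasis.map_apply, realOp_basis, realOp_basis, map_sum]
    simp only [map_smul, OrthonormalBasis.map_apply]
  exact LinearMap.congr_fun this v

/-- Every Fock space has an orthonormal basis indexed by patterns in which it is the model. -/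
theorem IsFockSpace.exists_basis (hg : IsFockSpace n p W g w₀) : creationSpan g w₀ = ⊤ ∧
    ∃ e : OrthonormalBasis (GZPattern n p) ℂ W, g = modelOp e ∧ e (GZPattern.zero n p) = w₀ := by
  obtain ⟨ht, Φ, hΦ0, hΦ⟩ :=
    (isFockSpace_model (EuclideanSpace.basisFun (GZPattern n p) ℂ)).exists_equiv hg
  refine ⟨ht, (EuclideanSpace.basisFun (GZPattern n p) ℂ).map Φ, ?_, ?_⟩
  · funext j ξ
    refine LinearMap.ext fun w => ?_
    obtain ⟨v, rfl⟩ := Φ.surjective w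
    rw [← hΦ, modelOp_map]
  · rw [OrthonormalBasis.map_apply, hΦ0]

end Uniqueness

/-! ### The representation of `so(2n+1)` -/

section So

variable {n : ℕ}

theorem dual_inl (a : Fin n ⊕ Fin n) : dual (Sum.inl a : SoIdx n) = Sum.inl a.swap := by
  rcases a with a | a <;> rfl

theorem dual_mid : dual (mid : SoIdx n) = mid := rfl

theorem inl_eq_mid (a : Fin n ⊕ Fin n) : ((Sum.inl a : SoIdx n) = mid) = False := by simp

theorem mid_eq_inl (a : Fin n ⊕ Fin n) : ((mid : SoIdx n) = Sum.inl a) = False := by simp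

theorem so_val_add (X Y : so n) : (X + Y).1 = X.1 + Y.1 := rfl

theorem so_val_sub (X Y : so n) : (X - Y).1 = X.1 - Y.1 := rfl

theorem so_val_neg (X : so n) : (-X).1 = -X.1 := rfl

theorem so_val_smul (c : ℂ) (X : so n) : (c • X).1 = c • X.1 := rfl

theorem so_val_lie (X Y : so n) : ⁅X, Y⁆.1 = X.1 * Y.1 - Y.1 * X.1 := rfl

theorem so_val_sum {ι : Type*} (s : Finset ι) (X : ι → so n) :
    (∑ i ∈ s, X i).1 = ∑ i ∈ s, (X i).1 := map_sum (so n).subtype X s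

theorem elt_val (u v : SoIdx n) : (elt u v).1 =
    Matrix.single u v 1 - Matrix.single (dual v) (dual u) 1 := rfl

/-- The elements `√2 (e_{a,2n+1} - e_{2n+1,a'})`, which are `f_j^+` for `a = j` and `-f_j^-` for
`a = n + j`. -/
noncomputable def shortElt (a : Fin n ⊕ Fin n) : so n := ((√2 : ℝ) : ℂ) • elt (Sum.inl a) mid

theorem single_mul_single_ite {ι : Type*} [Fintype ι] [DecidableEq ι] (a b c d : ι) :
    Matrix.single a b (1 : ℂ) * Matrix.single c d 1 = if b = c then Matrix.single a d 1 else 0 := by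
  split_ifs with h
  · subst h; rw [Matrix.single_mul_single_same, mul_one]
  · rw [Matrix.single_mul_single_of_ne _ _ _ _ h]

theorem sqrt_two_mul_self : ((√2 : ℝ) : ℂ) * ((√2 : ℝ) : ℂ) = 2 := by
  rw [← Complex.ofReal_mul, Real.mul_self_sqrt (by norm_num)]; norm_num

theorem lie_elt_mid (a b : Fin n ⊕ Fin n) :
    ⁅(elt (Sum.inl a) mid : so n), elt (Sum.inl b) mid⁆ = -elt (Sum.inl a) (Sum.inl b.swap) := by
  apply Subtype.ext
  rw [so_val_lie, so_val_neg]
  simp only [elt_val, dual_inl, dual_mid, inl_eq_mid, mid_eq_inl, sub_mul, mul_sub,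
    single_mul_single_ite, Sum.swap_swap, if_true, if_false, Sum.inl.injEq]
  have : (a.swap = b) ↔ (b.swap = a) := by
    constructor <;> (intro h; rw [← h, Sum.swap_swap])
  simp only [this]
  split_ifs <;> abel

theorem lie_shortElt (a b : Fin n ⊕ Fin n) :
    ⁅shortElt a, shortElt b⁆ = (-2 : ℂ) • elt (Sum.inl a) (Sum.inl b.swap) := by
  unfold shortElt
  rw [smul_lie, lie_smul, smul_smul, sqrt_two_mul_self, lie_elt_mid, smul_neg, neg_smul]

theorem lie_elt_shortElt (a b c : Fin n ⊕ Fin n) :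
    ⁅elt (Sum.inl a) (Sum.inl b.swap), shortElt c⁆ =
      (if b.swap = c then (1 : ℂ) else 0) • shortElt a -
        (if a.swap = c then (1 : ℂ) else 0) • shortElt b := by
  unfold shortElt
  rw [lie_smul, smul_comm _ (Complex.ofReal √2), smul_comm _ (Complex.ofReal √2), ← smul_sub]
  congr 1
  apply Subtype.ext
  rw [so_val_lie, so_val_sub, so_val_smul, so_val_smul]
  simp only [elt_val, dual_inl, dual_mid, inl_eq_mid, mid_eq_inl, sub_mul, mul_sub,
    single_mul_single_ite, Sum.swap_swap, if_false, Sum.inl.injEq]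
  have h1 : (c.swap = a) ↔ (a.swap = c) := by
    constructor <;> (intro h; rw [← h, Sum.swap_swap])
  have h2 : (c.swap = b) ↔ (b.swap = c) := by
    constructor <;> (intro h; rw [← h, Sum.swap_swap])
  simp only [h1, h2, ite_smul, one_smul, zero_smul]
  split_ifs <;> abel

theorem lie_lie_shortElt (a b c : Fin n ⊕ Fin n) : ⁅⁅shortElt a, shortElt b⁆, shortElt c⁆ =
    (if a.swap = c then (2 : ℂ) else 0) • shortElt b -
      (if b.swap = c then (2 : ℂ) else 0) • shortElt a := by
  rw [lie_shortElt, smul_lie, lie_elt_shortElt, smul_sub, smul_smul, smul_smul]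
  split_ifs <;> simp
  abel

/-- An element of `so(2n+1)` in terms of the `elt`. Every off-diagonal pair of entries is counted
twice in the double sum, whence the factor `1 / 2`. -/
theorem sum_elt (X : so n) : X = (∑ a : Fin n ⊕ Fin n, X.1 (Sum.inl a) mid • elt (Sum.inl a) mid) +
    (1 / 2 : ℂ) • ∑ a : Fin n ⊕ Fin n, ∑ b : Fin n ⊕ Fin n,
      X.1 (Sum.inl a) (Sum.inl b) • elt (Sum.inl a) (Sum.inl b) := by
  have hX := (mem_so_iff_entries X.1).mp X.2
  apply Subtype.ext
  rw [so_val_add, so_val_smul]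
  simp only [so_val_sum, so_val_smul, elt_val, dual_inl, dual_mid]
  ext i j
  simp only [Matrix.add_apply, Matrix.smul_apply, Matrix.sum_apply, Matrix.sub_apply,
    Matrix.single_apply, smul_eq_mul]
  have hsw : ∀ a b : Fin n ⊕ Fin n, (a.swap = b) ↔ (a = b.swap) := by
    intro a b
    constructor
    · intro h; rw [← h, Sum.swap_swap]
    · intro h; rw [h, Sum.swap_swap]
  rcases i with i | i <;> rcases j with j | j
  · have h1 := hX (Sum.inl j) (Sum.inl i.swap)
    rw [dual_inl, dual_inl, Sum.swap_swap] at h1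
    simp only [Sum.inl.injEq, reduceCtorEq, and_false, false_and, if_false, sub_zero, mul_zero,
      Finset.sum_const_zero, zero_add, hsw, mul_sub, Finset.sum_sub_distrib, mul_ite, mul_one,
      ite_and, Finset.sum_ite_eq', Finset.mem_univ, if_true]
    have e1 : ∑ a : Fin n ⊕ Fin n, ∑ b : Fin n ⊕ Fin n, (if a = i then
        if b = j then X.1 (Sum.inl a) (Sum.inl b) else 0 else 0) = X.1 (Sum.inl i) (Sum.inl j) := by
      rw [Finset.sum_eq_single i] <;> simp +contextual
    rw [e1]
    linear_combination (1 / 2 : ℂ) * h1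
  · simp
  · have h1 : X.1 mid (Sum.inl j) = -X.1 (dual (Sum.inl j)) mid := hX (Sum.inl j) mid
    rw [dual_inl] at h1
    simp [hsw]
    exact h1
  · have h1 := hX mid mid
    simp
    have h2 : X.1 mid mid = -X.1 mid mid := h1
    linear_combination (1 / 2 : ℂ) * h2

variable {W : Type*} [AddCommGroup W] [Module ℂ W]

/-- The linear map underlying the representation of `so(2n+1)` given by operators `Y a` in the place
of `shortElt a`. The coefficients come from `sum_elt` and from
`⁅shortElt a, shortElt b⁆ = -2 elt a b'`, where `b'` is the dual index. -/
noncomputable def soLinear (Y : Fin n ⊕ Fin n → Module.End ℂ W) : so n →ₗ[ℂ] Module.End ℂ W where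
  toFun X := ((√2 : ℝ) : ℂ)⁻¹ • (∑ a : Fin n ⊕ Fin n, X.1 (Sum.inl a) mid • Y a) -
    (1 / 4 : ℂ) • ∑ a : Fin n ⊕ Fin n, ∑ b : Fin n ⊕ Fin n,
      X.1 (Sum.inl a) (Sum.inl b) • ⁅Y a, Y b.swap⁆
  map_add' X X' := by
    simp only [so_val_add, Matrix.add_apply, add_smul, Finset.sum_add_distrib, smul_add]
    abel
  map_smul' c X := by
    simp only [so_val_smul, Matrix.smul_apply, smul_eq_mul, mul_smul, RingHom.id_apply]
    simp only [← Finset.smul_sum]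
    rw [smul_sub, smul_comm c, smul_comm c]

theorem soLinear_apply (Y : Fin n ⊕ Fin n → Module.End ℂ W) (X : so n) :
    soLinear Y X = ((√2 : ℝ) : ℂ)⁻¹ • (∑ a : Fin n ⊕ Fin n, X.1 (Sum.inl a) mid • Y a) -
    (1 / 4 : ℂ) • ∑ a : Fin n ⊕ Fin n, ∑ b : Fin n ⊕ Fin n,
      X.1 (Sum.inl a) (Sum.inl b) • ⁅Y a, Y b.swap⁆ := rfl

theorem soLinear_shortElt (Y : Fin n ⊕ Fin n → Module.End ℂ W) (a : Fin n ⊕ Fin n) :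
    soLinear Y (shortElt a) = Y a := by
  have h2 : ((√2 : ℝ) : ℂ) ≠ 0 := by
    intro h
    have := sqrt_two_mul_self
    rw [h] at this
    norm_num at this
  rw [shortElt, map_smul, soLinear_apply]
  simp only [elt_val, dual_inl, dual_mid, inl_eq_mid, mid_eq_inl, Matrix.sub_apply,
    Matrix.single_apply, Sum.inl.injEq, and_false, false_and, if_false, sub_zero, zero_smul,
        Finset.sum_const_zero,
    smul_zero, and_true, ite_smul, one_smul, Finset.sum_ite_eq, Finset.mem_univ, if_true]
  rw [smul_smul, mul_inv_cancel₀ h2, one_smul]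

theorem soLinear_lie_shortElt (Y : Fin n ⊕ Fin n → Module.End ℂ W) (a b : Fin n ⊕ Fin n) :
    soLinear Y ⁅shortElt a, shortElt b⁆ = ⁅Y a, Y b⁆ := by
  rw [lie_shortElt, map_smul, soLinear_apply]
  simp only [elt_val, dual_inl, Matrix.sub_apply, Matrix.single_apply, Sum.inl.injEq,
    reduceCtorEq, and_false, if_false, sub_zero, zero_smul, Finset.sum_const_zero,
    smul_zero, zero_sub, Sum.swap_swap, sub_smul, Finset.sum_sub_distrib]
  have e1 : ∀ u v : Fin n ⊕ Fin n, ∑ c : Fin n ⊕ Fin n, ∑ d : Fin n ⊕ Fin n,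
      (if u = c ∧ v = d then (1 : ℂ) else 0) • ⁅Y c, Y d.swap⁆ = ⁅Y u, Y v.swap⁆ := by
    intro u v
    rw [Finset.sum_eq_single u, Finset.sum_eq_single v]
    · rw [if_pos ⟨rfl, rfl⟩, one_smul]
    · intro d _ hd; rw [if_neg (fun h => hd h.2.symm), zero_smul]
    · exact fun h => absurd (Finset.mem_univ _) h
    · intro c _ hc
      exact Finset.sum_eq_zero fun d _ => by rw [if_neg (fun h => hc h.1.symm), zero_smul]
    · exact fun h => absurd (Finset.mem_univ _) h
  rw [e1, e1, Sum.swap_swap, Sum.swap_swap, ← lie_skew (Y b) (Y a), sub_neg_eq_add, ← two_smul ℂ,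
      smul_neg, smul_smul,
    smul_smul, ← neg_smul]
  norm_num

/-- If the operators `Y a` satisfy the same triple relations as the elements `shortElt a`, then
`soLinear Y` is a homomorphism: the elements whose brackets it respects form a Lie subalgebra. -/
theorem soLinear_lie {Y : Fin n ⊕ Fin n → Module.End ℂ W}
    (hY : ∀ a b c, ⁅⁅Y a, Y b⁆, Y c⁆ =
      (if a.swap = c then (2 : ℂ) else 0) • Y b - (if b.swap = c then (2 : ℂ) else 0) • Y a)
    (X X' : so n) : soLinear Y ⁅X, X'⁆ = ⁅soLinear Y X, soLinear Y X'⁆ := by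
  have h2 : ((√2 : ℝ) : ℂ) ≠ 0 := by
    intro h
    have := sqrt_two_mul_self
    rw [h] at this
    norm_num at this
  -- every submodule that contains the generators and their brackets is everything
  have span : ∀ P : Submodule ℂ (so n), (∀ a, shortElt a ∈ P) →
      (∀ a b, ⁅(shortElt a : so n), (shortElt b : so n)⁆ ∈ P) → ∀ X, X ∈ P := by
    intro P h1 h3 X
    rw [sum_elt X]
    refine P.add_mem (P.sum_mem fun a _ => P.smul_mem _ ?_)
      (P.smul_mem _ (P.sum_mem fun a _ => P.sum_mem fun b _ => P.smul_mem _ ?_))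
    · have := h1 a
      rwa [shortElt, P.smul_mem_iff h2] at this
    · have := h3 a b.swap
      rwa [lie_shortElt, Sum.swap_swap, P.smul_mem_iff (by norm_num)] at this
  -- the elements whose brackets with all others are respected
  let P : Submodule ℂ (so n) :=
    { carrier := {X | ∀ X', soLinear Y ⁅X, X'⁆ = ⁅soLinear Y X, soLinear Y X'⁆}
      add_mem' := by
        intro X₁ X₂ h1 h2 X'
        rw [add_lie, map_add, map_add, add_lie, h1, h2]
      zero_mem' := by intro X'; rw [zero_lie, map_zero, zero_lie]
      smul_mem' := by intro c X h X'; rw [smul_lie, map_smul, map_smul, smul_lie, h] }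
  have hshort : ∀ a, shortElt a ∈ P := by
    intro a
    let Q : Submodule ℂ (so n) :=
      { carrier := {X' | soLinear Y ⁅(shortElt a : so n), X'⁆ = ⁅soLinear Y (shortElt a),
          soLinear Y X'⁆}
        add_mem' := by
          intro X₁ X₂ (h1 : _ = _) (h2 : _ = _)
          show _ = _
          rw [lie_add, map_add, map_add, lie_add, h1, h2]
        zero_mem' := by show _ = _; rw [lie_zero, map_zero, lie_zero]
        smul_mem' := by
          intro c X (h : _ = _)
          show _ = _
          rw [lie_smul, map_smul, map_smul, lie_smul, h] }
    refine span Q (fun b => ?_) (fun b c => ?_)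
    · show _ = _
      rw [soLinear_lie_shortElt, soLinear_shortElt, soLinear_shortElt]
    · show _ = _
      rw [← lie_skew, map_neg, lie_lie_shortElt, map_sub, map_smul, map_smul,
        soLinear_lie_shortElt, soLinear_shortElt, soLinear_shortElt, soLinear_shortElt,
        ← lie_skew (Y a), hY]
  refine span P hshort (fun a b => ?_) X X'
  intro Z
  rw [lie_lie, map_sub, hshort a, hshort b, hshort a, hshort b, hshort a, lie_lie]

/-- The operators in the place of `shortElt a`. -/
def shortOp (f : Fin n → ℤˣ → Module.End ℂ W) : Fin n ⊕ Fin n → Module.End ℂ W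
  | Sum.inl j => f j 1
  | Sum.inr j => -f j (-1)

theorem paraElt_one (j : Fin n) : paraElt j 1 = shortElt (Sum.inl j) := rfl

theorem paraElt_neg_one (j : Fin n) : paraElt j (-1) = -shortElt (Sum.inr j) := by
  unfold paraElt shortElt
  rw [if_neg (by decide), ← smul_neg]
  congr 1
  apply Subtype.ext
  rw [so_val_neg, elt_val, elt_val, neg_sub]
  rfl

end So

section Representation

variable {n p : ℕ} {W : Type*} [NormedAddCommGroup W] [InnerProductSpace ℂ W]

theorem IsFockSpace.shortOp_triple {f : Fin n → ℤˣ → Module.End ℂ W} {vac : W}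
    (h : IsFockSpace n p W f vac) (a b c : Fin n ⊕ Fin n) :
    ⁅⁅shortOp f a, shortOp f b⁆, shortOp f c⁆ =
      (if a.swap = c then (2 : ℂ) else 0) • shortOp f b -
        (if b.swap = c then (2 : ℂ) else 0) • shortOp f a := by
  rcases a with a | a <;> rcases b with b | b <;> rcases c with c | c <;>
    simp only [shortOp, neg_lie, lie_neg, h.triple, Sum.swap_inl, Sum.swap_inr, Sum.inl.injEq,
      Sum.inr.injEq, reduceCtorEq, if_false] <;>
    by_cases h1 : a = c <;> by_cases h2 : b = c <;> simp [h1, h2] <;> norm_num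

/-- The representation of `so(2n+1)` on a Fock space. -/
noncomputable def IsFockSpace.rep {f : Fin n → ℤˣ → Module.End ℂ W} {vac : W}
    (h : IsFockSpace n p W f vac) : so n →ₗ⁅ℂ⁆ Module.End ℂ W :=
  { soLinear (shortOp f) with map_lie' := fun {X X'} => soLinear_lie h.shortOp_triple X X' }

variable {f : Fin n → ℤˣ → Module.End ℂ W} {vac : W}

theorem IsFockSpace.rep_shortElt (h : IsFockSpace n p W f vac) (a : Fin n ⊕ Fin n) :
    h.rep (shortElt a) = shortOp f a := soLinear_shortElt _ a

theorem IsFockSpace.rep_paraElt (h : IsFockSpace n p W f vac) (j : Fin n) (ξ : ℤˣ) :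
    h.rep (paraElt j ξ) = f j ξ := by
  rcases Int.units_eq_one_or ξ with rfl | rfl
  · rw [paraElt_one, h.rep_shortElt]; rfl
  · rw [paraElt_neg_one, map_neg, h.rep_shortElt, shortOp, neg_neg]

theorem IsFockSpace.rep_cartan (h : IsFockSpace n p W f vac) (j : Fin n) :
    h.rep (cartan j) = (1 / 2 : ℂ) • ⁅f j 1, f j (-1)⁆ := by
  have h1 := lie_shortElt (Sum.inl j : Fin n ⊕ Fin n) (Sum.inr j)
  have h2 : (cartan j : so n) = (-1 / 2 : ℂ) • ⁅shortElt (Sum.inl j), shortElt (Sum.inr j)⁆ := by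
    rw [h1, smul_smul, Sum.swap_inr, cartan]; norm_num
  rw [h2, map_smul, LieHom.map_lie, h.rep_shortElt, h.rep_shortElt, shortOp, shortOp, lie_neg,
    smul_neg, ← neg_smul]
  norm_num

variable (e : OrthonormalBasis (GZPattern n p) ℂ W)

theorem rep_cartan_basis (k : Fin n) (m : GZPattern n p) :
    (isFockSpace_model e).rep (cartan k) (e m) = (weightVal p m.1 (k + 1) : ℂ) • e m := by
  have H := isChevalleySystem_model (n := n) (by have := k.2; omega) p
  rw [IsFockSpace.rep_cartan, modelOp_one, modelOp_neg_one, ← realOp_lie,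
    H.lie_a_b (by omega) (by omega), realOp_smul, smul_smul, LinearMap.smul_apply, realOp_weightMat]
  norm_num

theorem isIrreducibleRep_model : IsIrreducibleRep (isFockSpace_model e).rep := by
  refine ⟨⟨e (GZPattern.zero n p), 0, e.orthonormal.ne_zero _⟩, fun U hU => ?_⟩
  refine modelOp_irreducible e U fun j ξ u hu => ?_
  have := hU (paraElt j ξ) u hu
  rwa [IsFockSpace.rep_paraElt] at this

/-- The pattern all of whose entries are `p`. -/
def GZPattern.full (n p : ℕ) : GZPattern n p :=
  ⟨fun i j => if 1 ≤ i ∧ i ≤ j ∧ j ≤ n then p else 0, by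
    constructor
    · intro i j h; rw [if_neg h]
    · intro i j; split_ifs <;> positivity
    · intro i j h1 h2 h3; rw [if_pos (by omega), if_pos (by omega), if_pos (by omega)]; simp
    · split_ifs <;> simp⟩

theorem weightVal_full {k : ℕ} (hk : 1 ≤ k) (hkn : k ≤ n) :
    weightVal p (GZPattern.full n p).1 k = (p : ℝ) / 2 := by
  unfold weightVal GZPattern.full
  have h : ∀ j, j ≤ n → ∑ q ∈ Finset.Icc 1 j,
      (((if 1 ≤ q ∧ q ≤ j ∧ j ≤ n then (p : ℤ) else 0) : ℤ) : ℝ) = j * p := by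
    intro j hj
    rw [Finset.sum_congr rfl (g := fun _ => (p : ℝ)) fun q hq => by
      rw [Finset.mem_Icc] at hq; rw [if_pos (by omega)]; simp]
    simp
  simp only
  rw [h k hkn, h (k - 1) (by omega), Nat.cast_sub hk]
  push_cast
  ring

/-- Elements that raise some weight kill the basis vector of the full pattern, whose weights are
maximal. -/
theorem rep_full_eq_zero (j : Fin n) {X : so n} (hX : ⁅(cartan j : so n), X⁆ = X) :
    (isFockSpace_model e).rep X (e (GZPattern.full n p)) = 0 := by
  set ρ := (isFockSpace_model e).rep
  set w := ρ X (e (GZPattern.full n p)) with hw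
  have h1 : ρ (cartan j) w = ((p / 2 + 1 : ℝ) : ℂ) • w := by
    have h2 := LinearMap.congr_fun (congrArg ρ hX) (e (GZPattern.full n p))
    rw [LieHom.map_lie, Ring.lie_def, LinearMap.sub_apply, Module.End.mul_apply,
      Module.End.mul_apply, rep_cartan_basis, weightVal_full (by omega) (by omega), map_smul,
      sub_eq_iff_eq_add] at h2
    rw [hw, h2]
    push_cast
    rw [add_smul, one_smul, add_comm]
  rw [← e.repr.map_eq_zero_iff]
  ext m
  have h3 : e.repr (ρ (cartan j) w) m = (weightVal p m.1 (j + 1) : ℂ) * e.repr w m := by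
    have H := isChevalleySystem_model (n := n) (by have := j.2; omega) p
    have : ρ (cartan j) = realOp e (weightMat n p (j + 1)) := by
      refine e.toBasis.ext fun m => ?_
      rw [OrthonormalBasis.coe_toBasis, rep_cartan_basis, realOp_weightMat]
    rw [this, realOp_repr, Finset.sum_eq_single m]
    · rw [weightMat, Matrix.diagonal_apply_eq]
    · intro b _ hb
      rw [weightMat, Matrix.diagonal_apply_ne _ hb.symm, Complex.ofReal_zero, zero_mul]
    · exact fun h => absurd (Finset.mem_univ _) h
  rw [h1, map_smul] at h3
  have h4 : (((p / 2 + 1 : ℝ) : ℂ) - (weightVal p m.1 (j + 1) : ℂ)) * e.repr w m = 0 := by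
    rw [sub_mul, ← h3]; simp
  rcases mul_eq_zero.mp h4 with h5 | h5
  · have h6 := (m.2.weightVal_mem (k := j + 1) (by omega) (by omega)).2
    have h7 : (p / 2 + 1 : ℝ) - weightVal p m.1 (j + 1) = 0 := by exact_mod_cast h5
    linarith
  · exact h5

theorem lie_cartan_short (j : Fin n) : ⁅(cartan j : so n), elt (lo j) mid⁆ = elt (lo j) mid := by
  apply Subtype.ext
  rw [so_val_lie]
  simp only [cartan, elt_val, dual_inl, dual_mid, inl_eq_mid, mid_eq_inl, sub_mul, mul_sub,
    single_mul_single_ite, Sum.swap_inl, if_true, if_false, Sum.inl.injEq, reduceCtorEq]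
  abel

theorem lie_cartan_minus {j k : Fin n} (hjk : j ≠ k) :
    ⁅(cartan j : so n), elt (lo j) (lo k)⁆ = elt (lo j) (lo k) := by
  apply Subtype.ext
  rw [so_val_lie]
  simp only [cartan, elt_val, dual_inl, sub_mul, mul_sub, hjk, hjk.symm,
    single_mul_single_ite, Sum.swap_inl, if_true, if_false, Sum.inl.injEq, Sum.inr.injEq,
    reduceCtorEq]
  abel

theorem lie_cartan_plus {j k : Fin n} (hjk : j ≠ k) :
    ⁅(cartan j : so n), elt (lo j) (hi k)⁆ = elt (lo j) (hi k) := by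
  apply Subtype.ext
  rw [so_val_lie]
  simp only [cartan, elt_val, dual_inl, sub_mul, mul_sub, hjk, hjk.symm,
    single_mul_single_ite, Sum.swap_inl, Sum.swap_inr, if_true, if_false, Sum.inl.injEq,
    Sum.inr.injEq, reduceCtorEq]
  abel

theorem isHighestWeightVector_full :
    IsHighestWeightVector (isFockSpace_model e).rep (fun _ => (p : ℂ) / 2)
      (e (GZPattern.full n p)) where
  ne_zero := e.orthonormal.ne_zero _
  weight j := by
    rw [rep_cartan_basis, weightVal_full (by omega) (by omega)]; push_cast; rfl
  short j := rep_full_eq_zero e j (lie_cartan_short j)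
  minus j _ h := rep_full_eq_zero e j (lie_cartan_minus h.ne)
  plus j _ h := rep_full_eq_zero e j (lie_cartan_plus h.ne)

/-! ### The matrix elements in the basis of patterns -/

theorem modelOp_one_basis (j : Fin n) (m : GZPattern n p) :
    modelOp e j 1 (e m) = ∑ i : RowPath ((j : ℕ) + 1) n,
      ((raiseCoeff p m.1 i : ℝ) : ℂ) • ket e (shiftPath m.1 1 i) := by
  classical
  rw [modelOp_one, realOp_basis]
  have hv := vectorMat_apply (n := n) (p := p) (j := j + 1) (by omega) (by omega)
  simp only [hv, Complex.ofReal_sum,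
    Finset.sum_smul]
  rw [Finset.sum_comm]
  refine Finset.sum_congr rfl fun i _ => ?_
  unfold ket
  split_ifs with h
  · rw [Finset.sum_eq_single ⟨_, h⟩]
    · rw [if_pos rfl]
    · intro q _ hq
      rw [if_neg (fun h' => hq (Subtype.ext h')), Complex.ofReal_zero, zero_smul]
    · exact fun h => absurd (Finset.mem_univ _) h
  · rw [smul_zero]
    refine Finset.sum_eq_zero fun q _ => ?_
    rw [if_neg (fun h' : q.1 = _ => h (by rw [← h']; exact q.2)), Complex.ofReal_zero, zero_smul]

theorem shiftPath_neg_one_eq_iff {j n : ℕ} {m m' : ℕ → ℕ → ℤ} (i : RowPath j n) :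
    m = shiftPath m' 1 i ↔ m' = shiftPath m (-1) i := by
  constructor <;>
  · rintro rfl
    funext a b
    unfold shiftPath
    split_ifs <;> ring

theorem modelOp_neg_one_basis (j : Fin n) (m : GZPattern n p) :
    modelOp e j (-1) (e m) = ∑ i : RowPath ((j : ℕ) + 1) n,
      ((lowerCoeff p m.1 i : ℝ) : ℂ) • ket e (shiftPath m.1 (-1) i) := by
  classical
  rw [modelOp_neg_one, realOp_basis]
  have hv := vectorMat_apply (n := n) (p := p) (j := j + 1) (by omega) (by omega)
  simp only [Matrix.transpose_apply, hv, Complex.ofReal_sum, Finset.sum_smul]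
  rw [Finset.sum_comm]
  refine Finset.sum_congr rfl fun i _ => ?_
  unfold ket
  rw [lowerCoeff_eq (by omega) (j.2 : (j : ℕ) + 1 ≤ n)]
  simp only [shiftPath_neg_one_eq_iff]
  split_ifs with h
  · rw [Finset.sum_eq_single ⟨_, h⟩]
    · rw [if_pos rfl]
    · intro q _ hq
      rw [if_neg (fun h' => hq (Subtype.ext h')), Complex.ofReal_zero, zero_smul]
    · exact fun h => absurd (Finset.mem_univ _) h
  · rw [smul_zero]
    refine Finset.sum_eq_zero fun q _ => ?_
    rw [if_neg (fun h' : q.1 = _ => h (by rw [← h']; exact q.2)), Complex.ofReal_zero, zero_smul]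

theorem modelOp_one_basis_last (j : Fin n) (m : GZPattern n p) (hj : (j : ℕ) + 1 = n) :
    modelOp e j 1 (e m) = ∑ i ∈ Finset.Icc 1 n,
      ((raiseLastCoeff n p m.1 i : ℝ) : ℂ) • ket e (shiftOne m.1 1 i n) := by
  rw [modelOp_one_basis]
  have hn : 1 ≤ n := by omega
  rw [← RowPath.sum_top hn (fun i =>
    ((raiseLastCoeff n p m.1 i : ℝ) : ℂ) • ket e (shiftOne m.1 1 i n))]
  have key : ∀ q, q = n → ∑ i : RowPath q n, ((raiseCoeff p m.1 i : ℝ) : ℂ) •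
      ket e (shiftPath m.1 1 i) = ∑ i : RowPath n n, ((raiseLastCoeff n p m.1 (i.idx n) : ℝ) : ℂ) •
        ket e (shiftOne m.1 1 (i.idx n) n) := by
    rintro q rfl
    refine Finset.sum_congr rfl fun i _ => ?_
    rw [shiftPath_top]
    unfold raiseCoeff raiseLastCoeff
    simp
  exact key _ hj

theorem modelOp_neg_one_basis_last (j : Fin n) (m : GZPattern n p) (hj : (j : ℕ) + 1 = n) :
    modelOp e j (-1) (e m) = ∑ i ∈ Finset.Icc 1 n,
      ((lowerLastCoeff n p m.1 i : ℝ) : ℂ) • ket e (shiftOne m.1 (-1) i n) := by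
  rw [modelOp_neg_one_basis]
  have hn : 1 ≤ n := by omega
  rw [← RowPath.sum_top hn (fun i =>
    ((lowerLastCoeff n p m.1 i : ℝ) : ℂ) • ket e (shiftOne m.1 (-1) i n))]
  have key : ∀ q, q = n → ∑ i : RowPath q n, ((lowerCoeff p m.1 i : ℝ) : ℂ) •
      ket e (shiftPath m.1 (-1) i) = ∑ i : RowPath n n,
        ((lowerLastCoeff n p m.1 (i.idx n) : ℝ) : ℂ) • ket e (shiftOne m.1 (-1) (i.idx n) n) := by
    rintro q rfl
    refine Finset.sum_congr rfl fun i _ => ?_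
    rw [shiftPath_top]
    unfold lowerCoeff lowerLastCoeff
    simp
  exact key _ hj

end Representation

/-! ### Counting patterns by their top row -/

/-- `m` is a Gelfand–Zetlin pattern whose top row is given by the strictly increasing coordinates
`x 0 < … < x (n - 1)`, where `x i = m (n - i) n + i`. -/
structure IsTriangle (n : ℕ) (x : Fin n → ℕ) (m : ℕ → ℕ → ℤ) : Prop where
  supp : ∀ i j, ¬ (1 ≤ i ∧ i ≤ j ∧ j ≤ n) → m i j = 0
  nonneg : ∀ i j, 0 ≤ m i j
  between : ∀ i j, 1 ≤ i → i ≤ j → j + 1 ≤ n → m (i + 1) (j + 1) ≤ m i j ∧ m i j ≤ m i (j + 1)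
  top : ∀ i : Fin n, m (n - i) n = (x i : ℤ) - (i : ℕ)

theorem finite_isTriangle (n : ℕ) (x : Fin n → ℕ) : {m | IsTriangle n x m}.Finite := by
  set P := ∑ i, x i with hP
  have hsub : {m | IsTriangle n x m} ⊆ Set.range (fun q : GZPattern n P => q.1) := by
    intro m hm
    refine ⟨⟨m, ⟨hm.supp, hm.nonneg, hm.between, ?_⟩⟩, rfl⟩
    rcases Nat.eq_zero_or_pos n with h0 | hn
    · rw [hm.supp 1 n (by omega)]; positivity
    · have h1 := hm.top ⟨n - 1, by omega⟩
      have h2 : x ⟨n - 1, by omega⟩ ≤ P :=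
        Finset.single_le_sum (f := x) (fun _ _ => Nat.zero_le _) (Finset.mem_univ _)
      simp only [show n - (n - 1) = 1 by omega] at h1
      omega
  exact (Set.finite_range _).subset hsub

/-- The finite set of patterns with a given top row. -/
noncomputable def triangles (n : ℕ) (x : Fin n → ℕ) : Finset (ℕ → ℕ → ℤ) :=
  (finite_isTriangle n x).toFinset

theorem mem_triangles {n : ℕ} {x : Fin n → ℕ} {m : ℕ → ℕ → ℤ} :
    m ∈ triangles n x ↔ IsTriangle n x m := by
  unfold triangles; rw [Set.Finite.mem_toFinset]; rfl

theorem strictMono_fin_le {n : ℕ} {x : Fin n → ℕ} (hx : StrictMono x) (i : Fin n) :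
    (i : ℕ) ≤ x i := by
  obtain ⟨i, hi⟩ := i
  induction i with
  | zero => exact Nat.zero_le _
  | succ i ih =>
    have h1 := ih (by omega)
    have h2 : x ⟨i, by omega⟩ < x ⟨i + 1, hi⟩ := hx (by rw [Fin.lt_def]; simp)
    simp only at h1 ⊢
    omega

/-- The strictly increasing coordinates of row `n`. -/
def rowCoord (n : ℕ) (m : ℕ → ℕ → ℤ) (i : Fin n) : ℕ := (m (n - i) n + (i : ℕ)).toNat

theorem rowCoord_cast {n : ℕ} {m : ℕ → ℕ → ℤ} (h : ∀ i j, 0 ≤ m i j) (i : Fin n) :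
    (rowCoord n m i : ℤ) = m (n - i) n + (i : ℕ) := by
  unfold rowCoord
  rw [Int.toNat_of_nonneg]
  have := h (n - i) n
  positivity

/-- Add a row on top of an array. -/
def addRow {n : ℕ} (x : Fin (n + 1) → ℕ) (m : ℕ → ℕ → ℤ) : ℕ → ℕ → ℤ := fun a b =>
  if h : b = n + 1 ∧ 1 ≤ a ∧ a ≤ n + 1 then
    (x ⟨n + 1 - a, by omega⟩ : ℤ) - (n + 1 - a : ℕ) else m a b

theorem addRow_of_ne {n : ℕ} (x : Fin (n + 1) → ℕ) (m : ℕ → ℕ → ℤ) {a b : ℕ} (hb : b ≠ n + 1) :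
    addRow x m a b = m a b := dif_neg fun h => hb h.1

theorem addRow_top {n : ℕ} (x : Fin (n + 1) → ℕ) (m : ℕ → ℕ → ℤ) (i : Fin (n + 1)) :
    addRow x m (n + 1 - i) (n + 1) = (x i : ℤ) - (i : ℕ) := by
  unfold addRow
  rw [dif_pos (by omega)]
  have h : n + 1 - (n + 1 - (i : ℕ)) = i := by omega
  simp only [h]

theorem isTriangle_addRow {n : ℕ} {x : Fin (n + 1) → ℕ} (hx : StrictMono x) {y : Fin n → ℕ}
    (hy : ∀ i : Fin n, x i.castSucc ≤ y i ∧ y i < x i.succ) {m : ℕ → ℕ → ℤ}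
    (hm : IsTriangle n y m) : IsTriangle (n + 1) x (addRow x m) := by
  constructor
  · intro i j h
    unfold addRow
    rw [dif_neg (by omega)]
    exact hm.supp i j (by omega)
  · intro i j
    unfold addRow
    split_ifs with h
    · have := strictMono_fin_le hx ⟨n + 1 - i, by omega⟩
      simp only at this
      omega
    · exact hm.nonneg i j
  · intro a b ha hab hb
    rcases Nat.lt_or_ge b n with hbn | hbn
    · rw [addRow_of_ne _ _ (by omega), addRow_of_ne _ _ (by omega), addRow_of_ne _ _ (by omega)]
      exact hm.between a b ha hab (by omega)
    · obtain rfl : b = n := by omega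
      have h1 := hy ⟨b - a, by omega⟩
      have h2 := hm.top ⟨b - a, by omega⟩
      have h3 := addRow_top x m (Fin.castSucc ⟨b - a, by omega⟩)
      have h4 := addRow_top x m (Fin.succ ⟨b - a, by omega⟩)
      rw [addRow_of_ne _ _ (by omega : b ≠ b + 1)]
      simp only [Fin.val_castSucc, Fin.val_succ, show b - (b - a) = a by omega,
        show b + 1 - (b - a) = a + 1 by omega, show b + 1 - (b - a + 1) = a by omega] at h2 h3 h4
      rw [h2, h3, h4]
      push_cast
      omega
  · exact addRow_top x m

/-- Removing the top row: the coordinates `y` of the next row satisfy `x i ≤ y i < x (i + 1)`. -/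
theorem card_triangles_succ {n : ℕ} {x : Fin (n + 1) → ℕ} (hx : StrictMono x) :
    (triangles (n + 1) x).card = ∑ y ∈ Fintype.piFinset fun i : Fin n =>
      Finset.Ico (x i.castSucc) (x i.succ), (triangles n y).card := by
  classical
  rw [Finset.card_eq_sum_card_fiberwise (f := rowCoord n)]
  · refine Finset.sum_congr rfl fun y hy => ?_
    rw [Fintype.mem_piFinset] at hy
    simp only [Finset.mem_Ico] at hy
    refine Finset.card_nbij' (fun m a b => if b ≤ n then m a b else 0) (addRow x) ?_ ?_ ?_ ?_
    · intro m hm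
      rw [Finset.mem_coe, Finset.mem_filter, mem_triangles] at hm
      rw [Finset.mem_coe, mem_triangles]
      obtain ⟨hm, rfl⟩ := hm
      refine ⟨?_, ?_, ?_, ?_⟩ <;> beta_reduce
      · intro i j h
        split_ifs with hj
        · exact hm.supp i j (by omega)
        · rfl
      · intro i j
        split_ifs
        · exact hm.nonneg i j
        · exact le_rfl
      · intro i j hi hij hj
        rw [if_pos (by omega), if_pos (by omega), if_pos (by omega)]
        exact hm.between i j hi hij (by omega)
      · intro i
        rw [if_pos le_rfl, rowCoord_cast hm.nonneg]
        ring
    · intro m hm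
      rw [Finset.mem_coe, mem_triangles] at hm
      rw [Finset.mem_coe, Finset.mem_filter, mem_triangles]
      refine ⟨isTriangle_addRow hx hy hm, ?_⟩
      funext i
      have h1 := rowCoord_cast (isTriangle_addRow hx hy hm).nonneg i
      rw [addRow_of_ne _ _ (by omega), hm.top] at h1
      omega
    · intro m hm
      rw [Finset.mem_coe, Finset.mem_filter, mem_triangles] at hm
      obtain ⟨hm, -⟩ := hm
      funext a b
      unfold addRow
      beta_reduce
      split_ifs with h1 h2
      · obtain ⟨rfl, -, -⟩ := h1
        have := hm.top ⟨n + 1 - a, by omega⟩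
        simp only [show n + 1 - (n + 1 - a) = a by omega] at this
        rw [this]
      · rfl
      · rw [hm.supp a b (by omega)]
    · intro m hm
      rw [Finset.mem_coe, mem_triangles] at hm
      funext a b
      simp only
      split_ifs with h
      · exact addRow_of_ne _ _ (by omega)
      · rw [hm.supp a b (by omega)]
  · intro m hm
    rw [Finset.mem_coe, mem_triangles] at hm
    rw [Finset.mem_coe, Fintype.mem_piFinset]
    intro i
    have h1 := rowCoord_cast (n := n) hm.nonneg i
    have h2 := hm.between (n - i) n (by omega) (by omega) le_rfl
    have h3 := hm.top i.castSucc
    have h4 := hm.top i.succ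
    rw [Fin.val_castSucc, show n + 1 - (i : ℕ) = n - i + 1 by omega] at h3
    rw [Fin.val_succ, show n + 1 - ((i : ℕ) + 1) = n - i by omega] at h4
    rw [Finset.mem_Ico]
    push_cast at h4
    omega

/-- The number of patterns with a given top row (the Weyl dimension formula for `gl(n)`). Summing
each variable over its interval turns the determinant for `n - 1` rows into that for `n` rows. -/
theorem card_triangles (n : ℕ) (x : Fin n → ℕ) (hx : StrictMono x) :
    ((triangles n x).card : ℚ) =
      (Matrix.of fun i j : Fin n => ((x i).choose j : ℚ)).det := by
  induction n with
  | zero =>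
    rw [Matrix.det_isEmpty]
    have : triangles 0 x = {fun _ _ => 0} := by
      ext m
      rw [mem_triangles, Finset.mem_singleton]
      constructor
      · intro h
        funext a b
        exact h.supp a b (by omega)
      · rintro rfl
        exact ⟨by simp, by simp, by simp, fun i => i.elim0⟩
    rw [this]; simp
  | succ n ih =>
    rw [card_triangles_succ hx]
    push_cast
    have h1 : ∀ y ∈ Fintype.piFinset fun i : Fin n => Finset.Ico (x i.castSucc) (x i.succ),
        ((triangles n y).card : ℚ) = (Matrix.of fun i j : Fin n => ((y i).choose j : ℚ)).det := by
      intro y hy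
      rw [Fintype.mem_piFinset] at hy
      simp only [Finset.mem_Ico] at hy
      refine ih y fun a b hab => ?_
      have h2 : x a.succ ≤ x b.castSucc := hx.monotone (by
        rw [Fin.le_def, Fin.val_succ, Fin.val_castSucc]; exact hab)
      exact (hy a).2.trans_le (h2.trans (hy b).1)
    rw [Finset.sum_congr rfl h1]
    -- the determinant is multilinear in its rows, and each row depends on one variable only
    have h2 := (Matrix.detRowAlternating (R := ℚ) (n := Fin n)).toMultilinearMap.map_sum_finset
      (fun _ t => fun j : Fin n => (t.choose j : ℚ))
      (fun i : Fin n => Finset.Ico (x i.castSucc) (x i.succ))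
    have h3 : ∀ y : Fin n → ℕ, (Matrix.of fun i j : Fin n => ((y i).choose j : ℚ)).det =
        (Matrix.detRowAlternating (R := ℚ) (n := Fin n)).toMultilinearMap
          (fun i => fun j : Fin n => ((y i).choose j : ℚ)) := fun y => rfl
    rw [Finset.sum_congr rfl fun y _ => h3 y, ← h2]
    have h4 : ∀ i j : Fin n, (∑ t ∈ Finset.Ico (x i.castSucc) (x i.succ),
        fun j : Fin n => (t.choose j : ℚ)) j =
        ((x i.succ).choose (j + 1) : ℚ) - (x i.castSucc).choose (j + 1) := by
      intro i j
      rw [Finset.sum_apply]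
      have hle : x i.castSucc ≤ x i.succ := hx.monotone (Fin.castSucc_lt_succ (i := i)).le
      rw [← Finset.sum_Ico_sub (fun t => (t.choose (j + 1) : ℚ)) hle]
      refine Finset.sum_congr rfl fun t _ => ?_
      rw [Nat.choose_succ_succ']
      push_cast
      ring
    -- subtracting from each row the preceding one leaves a first column with a single entry `1`
    have h5 : (Matrix.of fun i j : Fin (n + 1) => ((x i).choose j : ℚ)).det =
        (Matrix.of fun i j : Fin (n + 1) => (Fin.cases ((x 0).choose j : ℚ)
          (fun i => ((x i.succ).choose j : ℚ) - (x i.castSucc).choose j) i : ℚ)).det :=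
      Matrix.det_eq_of_forall_row_eq_smul_add_pred (fun _ => 1) (fun j => rfl)
        (fun i j => by simp)
    rw [h5, Matrix.det_succ_column_zero, Fin.sum_univ_succ,
      Finset.sum_eq_zero fun i _ => by simp]
    simp only [Matrix.of_apply, Fin.cases_zero, Fin.val_zero, pow_zero, Nat.choose_zero_right,
      Nat.cast_one, one_mul, add_zero]
    show Matrix.det _ = Matrix.det _
    congr 1
    ext i j
    rw [h4]
    simp [Matrix.submatrix_apply]

/-- The strictly increasing `n`-tuples of natural numbers below `N`. -/
noncomputable def increasing (n N : ℕ) : Finset (Fin n → ℕ) :=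
  open Classical in {x ∈ Fintype.piFinset fun _ : Fin n => Finset.range N | StrictMono x}

theorem mem_increasing {n N : ℕ} {x : Fin n → ℕ} :
    x ∈ increasing n N ↔ (∀ i, x i < N) ∧ StrictMono x := by
  unfold increasing
  rw [Finset.mem_filter, Fintype.mem_piFinset]
  simp only [Finset.mem_range]

theorem card_GZPattern_eq_sum (n p : ℕ) : Fintype.card (GZPattern n p) =
    ∑ x ∈ increasing n (n + p), (triangles n x).card := by
  classical
  rw [← Finset.card_univ, Finset.card_eq_sum_card_fiberwise (f := fun m => rowCoord n m.1)
    (t := increasing n (n + p))]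
  · refine Finset.sum_congr rfl fun x hx => ?_
    rw [mem_increasing] at hx
    refine Finset.card_bij (fun m _ => m.1) ?_ (fun _ _ _ _ h => Subtype.ext h) ?_
    · intro m hm
      rw [Finset.mem_filter] at hm
      rw [mem_triangles]
      refine ⟨m.2.supp, m.2.nonneg, m.2.between, fun i => ?_⟩
      have := rowCoord_cast (n := n) m.2.nonneg i
      rw [hm.2] at this
      omega
    · intro m hm
      rw [mem_triangles] at hm
      refine ⟨⟨m, hm.supp, hm.nonneg, hm.between, ?_⟩, ?_, rfl⟩
      · rcases Nat.eq_zero_or_pos n with h0 | hn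
        · rw [hm.supp 1 n (by omega)]; positivity
        · have h1 := hm.top ⟨n - 1, by omega⟩
          have h2 := hx.1 ⟨n - 1, by omega⟩
          simp only [show n - (n - 1) = 1 by omega] at h1
          omega
      · refine Finset.mem_filter.mpr ⟨Finset.mem_univ _, ?_⟩
        funext i
        have h1 := rowCoord_cast (n := n) hm.nonneg i
        have h2 := hm.top i
        show rowCoord n m i = x i
        omega
  · intro m _
    rw [Finset.mem_coe, mem_increasing]
    have hc := rowCoord_cast (n := n) m.2.nonneg
    constructor
    · intro i
      have h1 := hc i
      have h2 := m.2.le (n - i) n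
      have h3 := i.2
      show rowCoord n m.1 i < n + p
      omega
    · intro i j hij
      have h1 := hc i
      have h2 := hc j
      have h3 := m.2.antitone (i := n - j) (j := n - i) (k := n) (by omega)
        (by rw [Fin.lt_def] at hij; omega) (by omega) le_rfl
      rw [Fin.lt_def] at hij
      show rowCoord n m.1 i < rowCoord n m.1 j
      omega

/-- The number of patterns as a sum of Vandermonde determinants. -/
theorem card_GZPattern_mul (n p : ℕ) :
    (∏ i : Fin n, ((i : ℕ).factorial : ℚ)) * Fintype.card (GZPattern n p) =
      ∑ x ∈ increasing n (n + p), (Matrix.vandermonde fun i => (x i : ℚ)).det := by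
  rw [card_GZPattern_eq_sum]
  push_cast
  rw [Finset.mul_sum]
  refine Finset.sum_congr rfl fun x hx => ?_
  rw [card_triangles n x (mem_increasing.mp hx).2,
    Matrix.det_eval_matrixOfPolynomials_eq_det_vandermonde (fun i => (x i : ℚ))
      (fun i => descPochhammer ℚ i) (fun i => descPochhammer_natDegree ℚ i)
      (fun i => monic_descPochhammer ℚ i), ← Matrix.det_mul_row]
  congr 1
  ext i j
  simp only [Matrix.of_apply]
  rw [descPochhammer_eval_eq_descFactorial, Nat.descFactorial_eq_factorial_mul_choose]
  push_cast
  rfl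

theorem card_GZPattern_zero (n : ℕ) : Fintype.card (GZPattern n 0) = 1 := by
  rw [Fintype.card_eq_one_iff]
  refine ⟨GZPattern.zero n 0, fun m => Subtype.ext ?_⟩
  funext a b
  exact le_antisymm (m.2.le a b) (m.2.nonneg a b)

theorem sum_increasing_succ {A : Type*} [AddCommMonoid A] (n N : ℕ) (F : (Fin (n + 1) → ℕ) → A) :
    ∑ x ∈ increasing (n + 1) (N + 1), F x = ∑ x ∈ increasing (n + 1) N, F x +
      ∑ x ∈ increasing n N, F (Fin.snoc x N) := by
  classical
  have hlast : ∀ x : Fin (n + 1) → ℕ, StrictMono x → ∀ M, x (Fin.last n) < M → ∀ i, x i < M :=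
    fun x hx M h i => (hx.monotone (Fin.le_last i)).trans_lt h
  rw [← Finset.sum_filter_add_sum_filter_not _ (fun x => x (Fin.last n) < N)]
  congr 1
  · refine Finset.sum_congr ?_ fun _ _ => rfl
    ext x
    rw [Finset.mem_filter, mem_increasing, mem_increasing]
    constructor
    · exact fun h => ⟨hlast x h.1.2 N h.2, h.1.2⟩
    · exact fun h => ⟨⟨fun i => (h.1 i).trans (Nat.lt_succ_self N), h.2⟩, h.1 _⟩
  · refine Finset.sum_nbij' (fun x i => x i.castSucc) (fun x => Fin.snoc x N) ?_ ?_ ?_ ?_ ?_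
    · intro x hx
      rw [Finset.mem_filter, mem_increasing] at hx
      rw [mem_increasing]
      have h1 := hx.1.1 (Fin.last n)
      have h2 : x (Fin.last n) = N := by omega
      refine ⟨fun i => ?_, fun i j hij => hx.1.2 (by simpa using hij)⟩
      rw [← h2]
      exact hx.1.2 (Fin.castSucc_lt_last i)
    · intro x hx
      rw [mem_increasing] at hx
      rw [Finset.mem_filter, mem_increasing]
      refine ⟨⟨fun i => ?_, fun i j hij => ?_⟩, by rw [Fin.snoc_last]; omega⟩
      · refine Fin.lastCases ?_ (fun i => ?_) i
        · rw [Fin.snoc_last]; omega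
        · rw [Fin.snoc_castSucc]; exact (hx.1 i).trans (Nat.lt_succ_self N)
      · induction j using Fin.lastCases with
        | last =>
          obtain ⟨i, rfl⟩ := Fin.exists_castSucc_eq.mpr hij.ne
          rw [Fin.snoc_last, Fin.snoc_castSucc]
          exact hx.1 i
        | cast j =>
          obtain ⟨i, rfl⟩ := Fin.exists_castSucc_eq.mpr (hij.trans (Fin.castSucc_lt_last j)).ne
          rw [Fin.snoc_castSucc, Fin.snoc_castSucc]
          exact hx.2 (by simpa using hij)
    · intro x hx
      rw [Finset.mem_filter, mem_increasing] at hx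
      have h1 := hx.1.1 (Fin.last n)
      have h2 : x (Fin.last n) = N := by omega
      funext i
      refine Fin.lastCases ?_ (fun i => ?_) i
      · rw [Fin.snoc_last, h2]
      · rw [Fin.snoc_castSucc]
    · intro x _
      funext i
      rw [Fin.snoc_castSucc]
    · intro x hx
      rw [Finset.mem_filter, mem_increasing] at hx
      have h1 := hx.1.1 (Fin.last n)
      have h2 : x (Fin.last n) = N := by omega
      congr 1
      funext i
      refine Fin.lastCases ?_ (fun i => ?_) i
      · rw [Fin.snoc_last, h2]
      · rw [Fin.snoc_castSucc]

theorem increasing_succ_zero (n : ℕ) : increasing (n + 1) 0 = ∅ := by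
  ext x
  rw [mem_increasing]
  constructor
  · intro h; exact absurd (h.1 0) (Nat.not_lt_zero _)
  · intro h; exact absurd h (Finset.notMem_empty _)

theorem increasing_zero (N : ℕ) : increasing 0 N = {fun i => i.elim0} := by
  ext x
  rw [mem_increasing, Finset.mem_singleton]
  exact ⟨fun _ => Subsingleton.elim _ _, fun _ => ⟨fun i => i.elim0, fun i => i.elim0⟩⟩

/-! ### Sums of determinants over increasing tuples -/

section Exterior

open ExteriorAlgebra

variable {V : Type*} [AddCommGroup V] [Module ℚ V]

theorem ιMulti_snoc {n : ℕ} (v : Fin n → V) (w : V) :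
    ιMulti ℚ (n + 1) (Fin.snoc v w : Fin (n + 1) → V) = ιMulti ℚ n v * ι ℚ w := by
  rw [ιMulti_apply, ιMulti_apply, List.ofFn_succ', List.concat_eq_append, List.prod_append,
    List.prod_singleton]
  simp only [Fin.snoc_castSucc, Fin.snoc_last]

/-- The elementary symmetric expression of degree `n` in the anticommuting elements `t 0`, …,
`t (N - 1)`. -/
noncomputable def elemSum (t : ℕ → V) (n N : ℕ) : ExteriorAlgebra ℚ V :=
  ∑ x ∈ increasing n N, ιMulti ℚ n fun i => t (x i)

theorem elemSum_succ (t : ℕ → V) (n N : ℕ) :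
    elemSum t (n + 1) (N + 1) = elemSum t (n + 1) N + elemSum t n N * ι ℚ (t N) := by
  unfold elemSum
  rw [sum_increasing_succ, Finset.sum_mul]
  congr 1
  refine Finset.sum_congr rfl fun x _ => ?_
  rw [← ιMulti_snoc]
  congr 1
  funext i
  refine Fin.lastCases ?_ (fun i => ?_) i
  · rw [Fin.snoc_last, Fin.snoc_last]
  · rw [Fin.snoc_castSucc, Fin.snoc_castSucc]

theorem elemSum_zero_left (t : ℕ → V) (N : ℕ) : elemSum t 0 N = 1 := by
  unfold elemSum; rw [increasing_zero, Finset.sum_singleton, ιMulti_zero_apply]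

theorem elemSum_succ_zero (t : ℕ → V) (n : ℕ) : elemSum t (n + 1) 0 = 0 := by
  unfold elemSum; rw [increasing_succ_zero, Finset.sum_empty]

/-- The sum of `t x * t y` over `x < y < N`. -/
noncomputable def pairSum (t : ℕ → V) (N : ℕ) : ExteriorAlgebra ℚ V :=
  ∑ y ∈ Finset.range N, ι ℚ (∑ x ∈ Finset.range y, t x) * ι ℚ (t y)

theorem ι_mul_ι_comm (a b : V) : ι ℚ a * ι ℚ b = -(ι ℚ b * ι ℚ a) :=
  eq_neg_of_add_eq_zero_left (ι_add_mul_swap a b)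

theorem commute_ι_mul_ι (a b c : V) : Commute (ι ℚ a * ι ℚ b) (ι ℚ c) := by
  show ι ℚ a * ι ℚ b * ι ℚ c = ι ℚ c * (ι ℚ a * ι ℚ b)
  rw [mul_assoc, ι_mul_ι_comm b c, mul_neg, ← mul_assoc, ι_mul_ι_comm a c, neg_mul, neg_neg,
    mul_assoc]

theorem commute_pairSum_ι (t : ℕ → V) (N : ℕ) (c : V) : Commute (pairSum t N) (ι ℚ c) :=
  Commute.sum_left _ _ _ fun _ _ => commute_ι_mul_ι _ _ _

theorem add_pow_of_mul_self_eq_zero {A : Type*} [Ring A] {a z : A} (h : Commute a z)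
    (hz : z * z = 0) (r : ℕ) : (a + z) ^ (r + 1) = a ^ (r + 1) + (r + 1 : ℕ) * (a ^ r * z) := by
  induction r with
  | zero => simp
  | succ r ih =>
    rw [pow_succ, ih, add_mul, mul_add, mul_add, ← pow_succ]
    have h1 : a ^ r * z * a = a ^ (r + 1) * z := by
      rw [mul_assoc, ← h.eq, ← mul_assoc, ← pow_succ]
    have h2 : a ^ r * z * z = 0 := by rw [mul_assoc, hz, mul_zero]
    rw [mul_assoc _ (a ^ r * z) a, mul_assoc _ (a ^ r * z) z, h1, h2, mul_zero, add_zero]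
    push_cast
    simp only [add_mul, one_mul]
    abel

theorem mul_add_pow_of_mul_eq_zero {A : Type*} [Ring A] {a b z : A} (h : Commute a z)
    (hz : b * z = 0) (r : ℕ) : b * (a + z) ^ r = b * a ^ r := by
  induction r with
  | zero => simp
  | succ r ih =>
    rw [pow_succ, ← mul_assoc, ih, mul_add, mul_assoc, ← pow_succ, mul_assoc b, (h.pow_left r).eq,
      ← mul_assoc, hz, zero_mul, add_zero]

/-- The elementary symmetric expressions in anticommuting variables are divided powers: with
`Θ = ∑ t x` and `Ω = ∑_{x < y} t x * t y`, those of degree `2r` and `2r+1` are `Ω^r / r!` and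
`Θ Ω^r / r!`. -/
theorem factorial_mul_elemSum (t : ℕ → V) (N : ℕ) : ∀ r : ℕ,
    (r.factorial : ExteriorAlgebra ℚ V) * elemSum t (2 * r) N = pairSum t N ^ r ∧
    (r.factorial : ExteriorAlgebra ℚ V) * elemSum t (2 * r + 1) N =
      ι ℚ (∑ x ∈ Finset.range N, t x) * pairSum t N ^ r := by
  induction N with
  | zero =>
    intro r
    constructor
    · cases r with
      | zero => rw [mul_zero, elemSum_zero_left, pow_zero]; simp
      | succ r =>
        rw [show 2 * (r + 1) = 2 * r + 1 + 1 by ring, elemSum_succ_zero, mul_zero]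
        simp [pairSum]
    · rw [elemSum_succ_zero, mul_zero]; simp
  | succ N ih =>
    intro r
    set T := ∑ x ∈ Finset.range N, t x with hT
    -- passing from `N` to `N + 1` adds the nilpotent `Z` to the bivector
    set Z := ι ℚ T * ι ℚ (t N) with hZdef
    have hΩ : pairSum t (N + 1) = pairSum t N + Z := by
      unfold pairSum; rw [Finset.sum_range_succ]
    have hc : Commute (pairSum t N) Z :=
      (commute_pairSum_ι t N _).mul_right (commute_pairSum_ι t N _)
    have hZ : Z * Z = 0 := by
      rw [hZdef, ← mul_assoc, (commute_ι_mul_ι T (t N) T).eq, ← mul_assoc, ι_sq_zero, zero_mul,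
        zero_mul]
    constructor
    · cases r with
      | zero => rw [mul_zero, elemSum_zero_left, pow_zero]; simp
      | succ r =>
        have e1 := (ih (r + 1)).1
        have e2 := (ih r).2
        rw [show 2 * (r + 1) = 2 * r + 1 + 1 by ring] at e1 ⊢
        rw [elemSum_succ, mul_add, e1, hΩ, add_pow_of_mul_self_eq_zero hc hZ, Nat.factorial_succ]
        congr 1
        push_cast
        rw [mul_assoc, ← mul_assoc _ _ (ι ℚ (t N)), e2, ← ((commute_pairSum_ι t N T).pow_left r).eq,
          mul_assoc _ (ι ℚ T)]
    · rw [elemSum_succ, mul_add, (ih r).2, ← mul_assoc, (ih r).1, Finset.sum_range_succ, map_add,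
        ← hT, ((commute_pairSum_ι t N (t N)).pow_left r).eq, ← add_mul, hΩ]
      refine (mul_add_pow_of_mul_eq_zero hc ?_ r).symm
      rw [hZdef, add_mul, ← mul_assoc, ι_sq_zero, zero_mul, zero_add,
        ← (commute_ι_mul_ι T (t N) (t N)).eq, mul_assoc, ι_sq_zero, mul_zero]

end Exterior

section TopForm

open ExteriorAlgebra

variable {n : ℕ}

/-- The linear functional on the exterior algebra of `ℚ^n` that is the determinant in degree `n` and
zero in the other degrees. -/
noncomputable def topForm (n : ℕ) : ExteriorAlgebra ℚ (Fin n → ℚ) →ₗ[ℚ] ℚ :=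
  liftAlternating fun k => if h : k = n then h ▸ Matrix.detRowAlternating else 0

theorem topForm_ιMulti (v : Fin n → Fin n → ℚ) :
    topForm n (ιMulti ℚ n v) = (Matrix.of v).det := by
  unfold topForm
  rw [liftAlternating_apply_ιMulti, dif_pos rfl]
  rfl

theorem topForm_ιMulti_of_ne {k : ℕ} (hk : k ≠ n) (v : Fin k → Fin n → ℚ) :
    topForm n (ιMulti ℚ k v) = 0 := by
  unfold topForm
  rw [liftAlternating_apply_ιMulti, dif_neg hk]
  rfl

/-- The diagonal map with entries `c`. -/
def diagMap (c : Fin n → ℚ) : (Fin n → ℚ) →ₗ[ℚ] (Fin n → ℚ) where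
  toFun v i := c i * v i
  map_add' v w := by funext i; simp [mul_add]
  map_smul' a v := by funext i; simp [mul_left_comm]

/-- Rescaling the coordinates by `c` multiplies the top form by `∏ c i`. -/
theorem topForm_map (c : Fin n → ℚ) (w : ExteriorAlgebra ℚ (Fin n → ℚ)) :
    topForm n (ExteriorAlgebra.map (diagMap c) w) = (∏ i, c i) * topForm n w := by
  have : (topForm n) ∘ₗ (ExteriorAlgebra.map (diagMap c)).toLinearMap = (∏ i, c i) • topForm n := by
    refine lhom_ext fun k => ?_
    ext v
    show topForm n (ExteriorAlgebra.map (diagMap c) (ιMulti ℚ k v)) =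
      (∏ i, c i) * topForm n (ιMulti ℚ k v)
    rw [map_apply_ιMulti]
    by_cases hk : k = n
    · subst hk
      rw [topForm_ιMulti, topForm_ιMulti, ← Matrix.det_mul_row]
      rfl
    · rw [topForm_ιMulti_of_ne hk, topForm_ιMulti_of_ne hk, mul_zero]
  exact LinearMap.congr_fun this w

theorem topForm_elemSum (t : ℕ → Fin n → ℚ) (N : ℕ) : topForm n (elemSum t n N) =
    ∑ x ∈ increasing n N, (Matrix.of fun i => t (x i)).det := by
  unfold elemSum
  rw [map_sum]
  exact Finset.sum_congr rfl fun x _ => topForm_ιMulti _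

/-- The bivector with coefficients `K`. -/
noncomputable def bivector (K : Fin n → Fin n → ℚ) : ExteriorAlgebra ℚ (Fin n → ℚ) :=
  ∑ i, ∑ j, K i j • (ι ℚ (Pi.single i (1 : ℚ)) * ι ℚ (Pi.single j 1))

theorem ι_mul_ι_eq (v w : Fin n → ℚ) : ι ℚ v * ι ℚ w = bivector fun i j => v i * w j := by
  have h : ∀ u : Fin n → ℚ, ι ℚ u = ∑ i, u i • ι ℚ (Pi.single i (1 : ℚ)) := by
    intro u
    conv_lhs => rw [← Finset.univ_sum_single u]
    rw [map_sum]
    refine Finset.sum_congr rfl fun i _ => ?_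
    rw [← map_smul, ← Pi.single_smul, smul_eq_mul, mul_one]
  rw [h v, h w, Finset.sum_mul_sum]
  unfold bivector
  refine Finset.sum_congr rfl fun i _ => Finset.sum_congr rfl fun j _ => ?_
  rw [smul_mul_smul_comm]

theorem bivector_add (K K' : Fin n → Fin n → ℚ) :
    bivector K + bivector K' = bivector fun i j => K i j + K' i j := by
  unfold bivector
  simp only [add_smul, Finset.sum_add_distrib]

theorem bivector_sub (K K' : Fin n → Fin n → ℚ) :
    bivector K - bivector K' = bivector fun i j => K i j - K' i j := by
  unfold bivector
  simp only [sub_smul, Finset.sum_sub_distrib]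

theorem bivector_swap (K : Fin n → Fin n → ℚ) :
    bivector (fun i j => K j i) = -bivector K := by
  unfold bivector
  rw [Finset.sum_comm, ← Finset.sum_neg_distrib]
  refine Finset.sum_congr rfl fun i _ => ?_
  rw [← Finset.sum_neg_distrib]
  refine Finset.sum_congr rfl fun j _ => ?_
  rw [ι_mul_ι_comm, smul_neg]

theorem map_bivector (c : Fin n → ℚ) (K : Fin n → Fin n → ℚ) :
    ExteriorAlgebra.map (diagMap c) (bivector K) = bivector fun i j => c i * c j * K i j := by
  have h : ∀ i, diagMap c (Pi.single i 1) = c i • (Pi.single i 1 : Fin n → ℚ) := by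
    intro i
    funext k
    by_cases hk : k = i
    · subst hk; simp [diagMap]
    · simp [diagMap, hk]
  unfold bivector
  simp only [map_sum, map_smul, map_mul, map_apply_ι, h, smul_mul_smul_comm, smul_smul]
  refine Finset.sum_congr rfl fun i _ => Finset.sum_congr rfl fun j _ => ?_
  congr 1
  ring

/-- The antisymmetric pairing `∑_{x < y} (φ x ψ y - φ y ψ x)`. -/
def skewPairing (N : ℕ) (φ ψ : ℕ → ℚ) : ℚ :=
  ∑ y ∈ Finset.range N, ∑ x ∈ Finset.range y, (φ x * ψ y - φ y * ψ x)

theorem two_mul_pairSum (t : ℕ → Fin n → ℚ) (N : ℕ) : 2 * pairSum t N =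
    bivector fun i j => skewPairing N (fun x => t x i) (fun x => t x j) := by
  set K : Fin n → Fin n → ℚ :=
    fun i j => ∑ y ∈ Finset.range N, ∑ x ∈ Finset.range y, t x i * t y j with hK
  have h : pairSum t N = bivector K := by
    unfold pairSum
    simp only [ι_mul_ι_eq]
    unfold bivector
    rw [Finset.sum_comm]
    refine Finset.sum_congr rfl fun i _ => ?_
    rw [Finset.sum_comm]
    refine Finset.sum_congr rfl fun j _ => ?_
    rw [← Finset.sum_smul]
    simp only [hK, Finset.sum_apply, Finset.sum_mul]
  have h2 := bivector_swap K
  have h3 : bivector K + bivector (fun i j => -K j i) = 2 * pairSum t N := by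
    have h4 : bivector (fun i j => -K j i) = bivector K := by
      have : bivector (fun i j => -K j i) = -bivector (fun i j => K j i) := by
        unfold bivector; simp only [neg_smul, Finset.sum_neg_distrib]
      rw [this, h2, neg_neg]
    rw [h4, ← h, two_mul]
  rw [← h3, bivector_add]
  congr 1
  funext i j
  simp only [hK, skewPairing, Finset.sum_sub_distrib]
  rw [sub_eq_add_neg]
  congr 2
  exact Finset.sum_congr rfl fun y _ => Finset.sum_congr rfl fun x _ => mul_comm _ _

/-- If the pairings of the functions `t · i` have the form `c i c j K i j`, then their sums of
determinants of even size are proportional to `∏ c i`. -/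
theorem sum_det_even {r : ℕ} (t : ℕ → Fin (2 * r) → ℚ) (N : ℕ) (c : Fin (2 * r) → ℚ)
    (K : Fin (2 * r) → Fin (2 * r) → ℚ)
    (h : ∀ i j, skewPairing N (fun x => t x i) (fun x => t x j) = c i * c j * K i j) :
    (2 ^ r * r.factorial : ℚ) * ∑ x ∈ increasing (2 * r) N, (Matrix.of fun i => t (x i)).det =
      (∏ i, c i) * topForm (2 * r) (bivector K ^ r) := by
  rw [← topForm_map, map_pow, map_bivector]
  simp only [← h]
  rw [← two_mul_pairSum, (Commute.ofNat_left 2 _).mul_pow, ← (factorial_mul_elemSum t N r).1,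
    ← topForm_elemSum, ← smul_eq_mul, ← map_smul]
  congr 1
  rw [Algebra.smul_def]
  simp [mul_assoc, map_ofNat]

theorem commute_bivector_ι (K : Fin n → Fin n → ℚ) (v : Fin n → ℚ) :
    Commute (bivector K) (ι ℚ v) :=
  Commute.sum_left _ _ _ fun _ _ => Commute.sum_left _ _ _ fun _ _ =>
    (commute_ι_mul_ι _ _ _).smul_left _

/-- The analogue of `sum_det_even` for determinants of odd size: the pairings matter only modulo
multiples of the sums `∑ t · i`. -/
theorem sum_det_odd {r : ℕ} (t : ℕ → Fin (2 * r + 1) → ℚ) (N : ℕ) (c d κ : Fin (2 * r + 1) → ℚ)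
    (s : ℚ) (K : Fin (2 * r + 1) → Fin (2 * r + 1) → ℚ)
    (hs : ∀ i, ∑ x ∈ Finset.range N, t x i = s * (c i * κ i))
    (h : ∀ i j, skewPairing N (fun x => t x i) (fun x => t x j) = c i * c j * K i j +
      (d i * (∑ x ∈ Finset.range N, t x j) - (∑ x ∈ Finset.range N, t x i) * d j)) :
    (2 ^ r * r.factorial : ℚ) * ∑ x ∈ increasing (2 * r + 1) N, (Matrix.of fun i => t (x i)).det =
      s * (∏ i, c i) * topForm (2 * r + 1) (ι ℚ κ * bivector K ^ r) := by
  set T := ∑ x ∈ Finset.range N, t x with hT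
  have hTi : ∀ i, ∑ x ∈ Finset.range N, t x i = T i := fun i => by rw [hT, Finset.sum_apply]
  have hTD : T = s • diagMap c κ := by
    funext i; rw [← hTi, hs]; rfl
  have hpair : 2 * pairSum t N =
      bivector (fun i j => c i * c j * K i j) + (ι ℚ d * ι ℚ T - ι ℚ T * ι ℚ d) := by
    rw [two_mul_pairSum, ι_mul_ι_eq, ι_mul_ι_eq, bivector_sub, bivector_add]
    congr 1
    funext i j
    rw [h, hTi, hTi]
  -- multiples of `T` in the bivector do not matter, because the power is multiplied by `T`
  have hz : ι ℚ T * (ι ℚ d * ι ℚ T - ι ℚ T * ι ℚ d) = 0 := by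
    rw [mul_sub, ← mul_assoc, ← mul_assoc, (commute_ι_mul_ι T d T).eq, ← mul_assoc, sub_self]
  have hcomm : Commute (bivector fun i j => c i * c j * K i j)
      (ι ℚ d * ι ℚ T - ι ℚ T * ι ℚ d) :=
    ((commute_bivector_ι _ _).mul_right (commute_bivector_ι _ _)).sub_right
      ((commute_bivector_ι _ _).mul_right (commute_bivector_ι _ _))
  have h1 : (2 ^ r * r.factorial : ℚ) • elemSum t (2 * r + 1) N =
      s • ExteriorAlgebra.map (diagMap c) (ι ℚ κ * bivector K ^ r) := by
    rw [map_mul, map_pow, map_bivector, map_apply_ι, ← smul_mul_assoc, ← map_smul, ← hTD,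
      ← mul_add_pow_of_mul_eq_zero hcomm hz, ← hpair, (Commute.ofNat_left 2 _).mul_pow,
      ← mul_assoc, ((Commute.ofNat_right (ι ℚ T) 2).pow_right r).eq, mul_assoc,
      ← (factorial_mul_elemSum t N r).2, Algebra.smul_def]
    simp [mul_assoc, map_ofNat]
  have h2 := congrArg (topForm (2 * r + 1)) h1
  rw [map_smul, map_smul, smul_eq_mul, smul_eq_mul, topForm_map, topForm_elemSum] at h2
  rw [h2, mul_assoc]

end TopForm

/-! ### Polynomials adapted to the pairing -/

section Polynomials

open Polynomial

/-- The degree and the leading coefficient of the difference `g (x + 1) - g x`. -/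
theorem diff_coeff {g : ℚ[X]} {d : ℕ} (hg : g.natDegree ≤ d + 1) :
    (g.comp (X + C 1) - g).natDegree ≤ d ∧
      (g.comp (X + C 1) - g).coeff d = (d + 1) * g.coeff (d + 1) := by
  have hco : ∀ k, d ≤ k → (g.comp (X + C 1)).coeff k = g.coeff k + (k + 1) * g.coeff (k + 1) := by
    intro k hk
    have h1 := taylor_coeff (1 : ℚ) g k
    rw [taylor_apply] at h1
    have h2 : (hasseDeriv k g).natDegree < 2 := by
      refine (natDegree_hasseDeriv_le g k).trans_lt ?_
      omega
    rw [h1, eval_eq_sum_range' h2, Finset.sum_range_succ, Finset.sum_range_one, hasseDeriv_coeff,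
      hasseDeriv_coeff]
    simp [add_comm 1 k]
  constructor
  · rw [natDegree_le_iff_coeff_eq_zero]
    intro k hk
    rw [coeff_sub, hco k hk.le, coeff_eq_zero_of_natDegree_lt (by omega : g.natDegree < k + 1)]
    ring
  · rw [coeff_sub, hco d le_rfl]
    ring

/-- The mean of a polynomial and its translate can be prescribed, without changing the leading
coefficient. -/
theorem exists_add_shift (d : ℕ) : ∀ g : ℚ[X], g.natDegree ≤ d →
    ∃ f : ℚ[X], f.natDegree ≤ d ∧ f.coeff d = g.coeff d ∧ f + f.comp (X + C 1) = 2 * g := by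
  induction d with
  | zero =>
    intro g hg
    refine ⟨g, hg, rfl, ?_⟩
    rw [eq_C_of_natDegree_le_zero hg, C_comp, two_mul]
  | succ d ih =>
    intro g hg
    obtain ⟨f, hf1, -, hf3⟩ := ih _ (diff_coeff hg).1
    refine ⟨g - C (1 / 2) * f, ?_, ?_, ?_⟩
    · exact (natDegree_sub_le _ _).trans
        (max_le hg ((natDegree_C_mul_le _ _).trans (hf1.trans (Nat.le_succ d))))
    · rw [coeff_sub, coeff_C_mul, coeff_eq_zero_of_natDegree_lt (by omega : f.natDegree < d + 1)]
      ring
    · rw [sub_comp, mul_comp, C_comp]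
      have h2 : (C (1 / 2) : ℚ[X]) * 2 = 1 := by
        rw [← C_ofNat, ← C_mul]; norm_num
      linear_combination (-C (1 / 2)) * hf3 - (g.comp (X + C 1) - g) * h2

theorem add_shift_unique {f : ℚ[X]} (hf : f + f.comp (X + C 1) = 0) : f = 0 := by
  have h1 : f.comp (X + C 1) = -f := by linear_combination hf
  have h2 := congrArg leadingCoeff h1
  rw [leadingCoeff_comp (by rw [natDegree_X_add_C]; norm_num), leadingCoeff_X_add_C, one_pow,
    mul_one, leadingCoeff_neg] at h2
  exact leadingCoeff_eq_zero.mp (by linarith)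

/-- The monic polynomial `± (x + s) ⋯ (x + s - k + 1) (t - x) ⋯ (t - x - k + 1)`. -/
noncomputable def bump (k : ℕ) (s t : ℚ) : ℚ[X] :=
  (descPochhammer ℚ k).comp (X + C s) * (ascPochhammer ℚ k).comp (X + C (-t))

theorem bump_eval (k : ℕ) (s t x : ℚ) : (bump k s t).eval x =
    (-1) ^ k * ((descPochhammer ℚ k).eval (x + s) * (descPochhammer ℚ k).eval (t - x)) := by
  unfold bump
  rw [eval_mul, eval_comp, eval_comp]
  simp only [eval_add, eval_X, eval_C]
  rw [show x + -t = -(t - x) by ring, ascPochhammer_eval_neg_eq_descPochhammer]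
  ring

theorem bump_symm (k : ℕ) (s t : ℚ) : (bump k s t).comp (C (t - s) - X) = bump k s t := by
  refine Polynomial.funext fun x => ?_
  rw [eval_comp, bump_eval, bump_eval]
  simp only [eval_sub, eval_C, eval_X]
  rw [show t - s - x + s = t - x by ring, show t - (t - s - x) = x + s by ring]
  ring

theorem bump_coeff (k : ℕ) (s t : ℚ) : (bump k s t).natDegree ≤ 2 * k ∧
    (bump k s t).coeff (2 * k) = 1 := by
  have h1 : ((descPochhammer ℚ k).comp (X + C s)).Monic :=
    (monic_descPochhammer ℚ k).comp_X_add_C s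
  have h2 : ((ascPochhammer ℚ k).comp (X + C (-t))).Monic :=
    (monic_ascPochhammer ℚ k).comp_X_add_C _
  have hd : (bump k s t).natDegree = 2 * k := by
    unfold bump
    rw [h1.natDegree_mul h2, natDegree_comp, natDegree_comp, natDegree_X_add_C, natDegree_X_add_C,
      descPochhammer_natDegree, ascPochhammer_natDegree]
    ring
  refine ⟨hd.le, ?_⟩
  rw [← hd]
  exact h1.mul h2

theorem bump_zero (s t : ℚ) : bump 0 s t = 1 := by
  unfold bump; simp

end Polynomials

section Sums

/-- The Vandermonde convolution in its upper indices. -/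
theorem sum_choose_mul_choose (T m q : ℕ) :
    ∑ i ∈ Finset.range (T + 1), i.choose m * (T - i).choose q = (T + 1).choose (m + q + 1) := by
  induction T generalizing q with
  | zero =>
    rw [Finset.sum_range_one, Nat.sub_zero]
    rcases Nat.eq_zero_or_pos m with rfl | hm
    · rcases Nat.eq_zero_or_pos q with rfl | hq
      · rfl
      · rw [Nat.choose_eq_zero_of_lt hq, Nat.choose_eq_zero_of_lt (by omega : 0 + 1 < 0 + q + 1),
          mul_zero]
    · rw [Nat.choose_eq_zero_of_lt hm, Nat.choose_eq_zero_of_lt (by omega : 0 + 1 < m + q + 1),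
        zero_mul]
  | succ T ih =>
    cases q with
    | zero =>
      have := ih 0
      rw [Finset.sum_range_succ]
      simp only [Nat.choose_zero_right, mul_one, add_zero] at this ⊢
      rw [this, Nat.choose_succ_succ' (T + 1) m, add_comm]
    | succ q =>
      rw [Finset.sum_range_succ, Nat.sub_self, Nat.choose_zero_succ, mul_zero, add_zero]
      have h : ∀ i ∈ Finset.range (T + 1), i.choose m * (T + 1 - i).choose (q + 1) =
          i.choose m * (T - i).choose q + i.choose m * (T - i).choose (q + 1) := by
        intro i hi
        rw [Finset.mem_range] at hi
        rw [Nat.succ_sub (by omega : i ≤ T), Nat.choose_succ_succ']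
        ring
      rw [Finset.sum_congr rfl h, Finset.sum_add_distrib, ih, ih,
        show m + (q + 1) + 1 = m + q + 1 + 1 by ring, Nat.choose_succ_succ' (T + 1)]

theorem sum_choose_shift {M a m : ℕ} (ham : a ≤ m) :
    ∑ j ∈ Finset.range (M + 1), (j + a).choose m * (M - j + a).choose m =
      (M + 2 * a + 1).choose (2 * m + 1) := by
  rw [two_mul m, ← sum_choose_mul_choose]
  have h0 : ∀ i, i < a → i.choose m = 0 := fun i hi => Nat.choose_eq_zero_of_lt (by omega)
  have split : ∀ F : ℕ → ℕ, ∑ i ∈ Finset.range (M + 2 * a + 1), F i =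
      ∑ i ∈ Finset.range a, F i + (∑ j ∈ Finset.range (M + 1), F (a + j) +
        ∑ j ∈ Finset.range a, F (a + (M + 1 + j))) := by
    intro F
    rw [show M + 2 * a + 1 = a + ((M + 1) + a) by ring, Finset.sum_range_add,
      Finset.sum_range_add (fun x => F (a + x))]
  have h2 : ∑ x ∈ Finset.range a, x.choose m * (M + 2 * a - x).choose m = 0 :=
    Finset.sum_eq_zero fun i hi => by rw [h0 i (Finset.mem_range.mp hi), zero_mul]
  rw [split, h2, zero_add]
  have h1 : ∑ x ∈ Finset.range a,
      (a + (M + 1 + x)).choose m * (M + 2 * a - (a + (M + 1 + x))).choose m = 0 :=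
    Finset.sum_eq_zero fun i hi => by
      rw [Finset.mem_range] at hi
      rw [h0 (M + 2 * a - (a + (M + 1 + i))) (by omega), mul_zero]
  rw [h1, add_zero]
  refine Finset.sum_congr rfl fun j hj => ?_
  rw [Finset.mem_range] at hj
  rw [add_comm j a, show M - j + a = M + 2 * a - (a + j) by omega]

theorem descPochhammer_mul_eval (x a b : ℕ) : (descPochhammer ℚ a).eval ((x : ℚ) + a) *
    (descPochhammer ℚ b).eval (x : ℚ) = ((a + b).factorial : ℚ) * (x + a).choose (a + b) := by
  rw [← Nat.cast_add, descPochhammer_eval_eq_descFactorial, descPochhammer_eval_eq_descFactorial]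
  have := Nat.descFactorial_mul_descFactorial (n := x + a) (k := a) (m := a + b) (by omega)
  rw [Nat.add_sub_cancel, Nat.add_sub_cancel_left, Nat.descFactorial_eq_factorial_mul_choose (x +
      a) (a + b)] at this
  rw [mul_comm]
  exact_mod_cast this

/-- The pairing to which those of the adapted polynomials reduce. It factors into a part depending
on `M` and `a`, a part depending on `M` and `b`, and a part independent of `M`. -/
theorem sum_bump_mul_bump {M a b : ℕ} (hb : 2 * b ≤ M) :
    ∑ j ∈ Finset.range (M + 1), (bump a a (M + a)).eval (j : ℚ) * (bump b 0 M).eval (j : ℚ) =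
      (M + 2 * a + 1).factorial * (1 / (M - 2 * b).factorial) *
        ((-1) ^ (a + b) * (a + b).factorial ^ 2 / (2 * (a + b) + 1).factorial) := by
  have h1 : ∀ j ∈ Finset.range (M + 1),
      (bump a a (M + a)).eval (j : ℚ) * (bump b 0 M).eval (j : ℚ) =
        (-1) ^ (a + b) * (a + b).factorial ^ 2 *
          (((j + a).choose (a + b) * (M - j + a).choose (a + b) : ℕ) : ℚ) := by
    intro j hj
    rw [Finset.mem_range] at hj
    have e1 := descPochhammer_mul_eval j a b
    have e2 := descPochhammer_mul_eval (M - j) a b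
    rw [Nat.cast_sub (by omega : j ≤ M)] at e2
    rw [bump_eval, bump_eval, add_zero, show (M : ℚ) + a - j = M - j + a by ring, pow_add]
    push_cast
    linear_combination (-1 : ℚ) ^ a * (-1) ^ b *
      ((descPochhammer ℚ a).eval ((M : ℚ) - j + a) * (descPochhammer ℚ b).eval ((M : ℚ) - j) * e1 +
        (a + b).factorial * (j + a).choose (a + b) * e2)
  rw [Finset.sum_congr rfl h1, ← Finset.mul_sum, ← Nat.cast_sum, sum_choose_shift (by omega),
    Nat.cast_choose ℚ (by omega : 2 * (a + b) + 1 ≤ M + 2 * a + 1),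
    show M + 2 * a + 1 - (2 * (a + b) + 1) = M - 2 * b by omega]
  field_simp

theorem skewPairing_swap (N : ℕ) (φ ψ : ℕ → ℚ) : skewPairing N φ ψ = -skewPairing N ψ φ := by
  unfold skewPairing
  simp only [← Finset.sum_neg_distrib]
  exact Finset.sum_congr rfl fun _ _ => Finset.sum_congr rfl fun _ _ => by ring

/-- Functions of the same parity under the reflection `x ↦ N - 1 - x` are orthogonal: the reflection
reverses the order, and so changes the sign of the pairing. -/
theorem skewPairing_eq_zero {N : ℕ} {φ ψ : ℕ → ℚ} (ε : ℚ) (hε : ε * ε = 1)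
    (hφ : ∀ x, x < N → φ (N - 1 - x) = ε * φ x) (hψ : ∀ x, x < N → ψ (N - 1 - x) = ε * ψ x) :
    skewPairing N φ ψ = 0 := by
  have key : ∀ f g : ℕ → ℚ, ∑ y ∈ Finset.range N, ∑ x ∈ Finset.range y, f x * g y =
      ∑ y ∈ Finset.range N, ∑ x ∈ Finset.range N, if x < y then f x * g y else 0 := by
    intro f g
    refine Finset.sum_congr rfl fun y hy => ?_
    rw [Finset.mem_range] at hy
    rw [← Finset.sum_filter]
    refine Finset.sum_congr ?_ fun _ _ => rfl
    ext x
    simp only [Finset.mem_range, Finset.mem_filter]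
    omega
  have h : skewPairing N φ ψ = ∑ y ∈ Finset.range N, ∑ x ∈ Finset.range y, φ x * ψ y -
      ∑ y ∈ Finset.range N, ∑ x ∈ Finset.range y, ψ x * φ y := by
    unfold skewPairing
    simp only [Finset.sum_sub_distrib]
    congr 1
    exact Finset.sum_congr rfl fun _ _ => Finset.sum_congr rfl fun _ _ => mul_comm _ _
  rw [h, sub_eq_zero, key, key]
  rw [← Finset.sum_range_reflect, Finset.sum_comm, ← Finset.sum_range_reflect]
  refine Finset.sum_congr rfl fun y hy => Finset.sum_congr rfl fun x hx => ?_
  rw [Finset.mem_range] at hx hy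
  rw [hφ y hy, hψ x hx]
  by_cases hxy : x < y
  · rw [if_pos hxy, if_pos (by omega)]
    linear_combination φ y * ψ x * hε
  · rw [if_neg hxy, if_neg (by omega)]

/-- Summation of one of the functions: only its partial sums enter the pairing. -/
theorem skewPairing_eq_sum (N : ℕ) (φ ψ : ℕ → ℚ) : skewPairing N ψ φ =
    ∑ y ∈ Finset.range N, φ y *
      (∑ x ∈ Finset.range y, ψ x + ∑ x ∈ Finset.range (y + 1), ψ x -
        ∑ x ∈ Finset.range N, ψ x) := by
  unfold skewPairing
  induction N with
  | zero => simp
  | succ N ih =>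
    rw [Finset.sum_range_succ, ih, Finset.sum_range_succ (fun y => φ y * _) N,
      Finset.sum_sub_distrib, ← Finset.sum_mul, ← Finset.mul_sum, Finset.sum_range_succ ψ N]
    have : ∀ y, φ y * (∑ x ∈ Finset.range y, ψ x + ∑ x ∈ Finset.range (y + 1), ψ x -
        (∑ x ∈ Finset.range N, ψ x + ψ N)) = φ y * (∑ x ∈ Finset.range y, ψ x +
          ∑ x ∈ Finset.range (y + 1), ψ x - ∑ x ∈ Finset.range N, ψ x) - φ y * ψ N :=
              fun y => by ring
    simp only [this]
    rw [Finset.sum_sub_distrib (s := Finset.range N), ← Finset.sum_mul]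
    ring

end Sums

section Adapted

open Polynomial

/-- A polynomial inherits the parity of the mean of it and its translate. -/
theorem reflect_of_add_shift {f g : ℚ[X]} {c ε : ℚ}
    (hf : ∀ x, f.eval x + f.eval (x + 1) = 2 * g.eval x)
    (hg : ∀ x, g.eval (c - 1 - x) = ε * g.eval x) (x : ℚ) : f.eval (c - x) = ε * f.eval x := by
  have h : f.comp (C c - X) - C ε * f = 0 := by
    refine add_shift_unique (Polynomial.funext fun y => ?_)
    simp only [eval_add, eval_sub, eval_comp, eval_mul, eval_C, eval_X, eval_zero]
    have h1 := hf (c - 1 - y)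
    rw [show c - 1 - y + 1 = c - y by ring, hg] at h1
    rw [show c - (y + 1) = c - 1 - y by ring]
    linear_combination h1 - ε * hf y
  have h2 := congrArg (eval x) h
  simp only [eval_sub, eval_comp, eval_mul, eval_C, eval_X, eval_zero] at h2
  linarith

theorem bump_reflect (k : ℕ) (s t c : ℚ) (hc : t - s = c) (x : ℚ) :
    (bump k s t).eval (c - x) = (bump k s t).eval x := by
  conv_rhs => rw [← bump_symm k s t, eval_comp]
  rw [hc]; simp

theorem bump_succ_eval_zero (k : ℕ) (t : ℚ) : (bump (k + 1) 0 t).eval 0 = 0 := by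
  rw [bump_eval, add_zero, descPochhammer_ne_zero_eval_zero _ (Nat.succ_ne_zero k), zero_mul,
    mul_zero]

theorem bump_succ_eval_self (k : ℕ) (t : ℚ) : (bump (k + 1) 0 t).eval t = 0 := by
  rw [bump_eval, sub_self, descPochhammer_ne_zero_eval_zero _ (Nat.succ_ne_zero k), mul_zero,
    mul_zero]

/-- The constants in the pairings of the adapted polynomials; they depend neither on the
summation range nor on the dimension. -/
noncomputable def pairConst (a b : ℕ) : ℚ :=
  (-1) ^ (a + b) * (a + b).factorial ^ 2 / (2 * (a + b) + 1).factorial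

/-- The matrix of the pairings of the adapted polynomials, up to a rescaling. -/
noncomputable def pairMatrix (i j : ℕ) : ℚ :=
  if Even i then if Even j then 0 else -(pairConst (i / 2) (j / 2 + 1) / (j / 2 + 1 : ℕ))
  else if Even j then pairConst (j / 2) (i / 2 + 1) / (i / 2 + 1 : ℕ) else 0

/-- The scale of the adapted polynomial of degree `i`. -/
noncomputable def scale (M i : ℕ) : ℚ :=
  if Even i then (M + i + 1).factorial else 1 / (M - i - 1).factorial

theorem sum_bump_mul_bump_succ {M a b : ℕ} (hb : 2 * b + 1 < M) :
    ∑ j ∈ Finset.range (M + 1),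
        (bump a a (M + a)).eval (j : ℚ) * (bump (b + 1) 0 M).eval (j : ℚ) =
      scale M (2 * a) * scale M (2 * b + 1) * pairConst a (b + 1) := by
  rw [sum_bump_mul_bump (by omega), scale, scale, if_pos (even_two_mul a),
    if_neg (Nat.not_even_iff_odd.mpr (odd_two_mul_add_one b)), pairConst,
    show M - 2 * (b + 1) = M - (2 * b + 1) - 1 by omega]

theorem sum_bump {M a : ℕ} : ∑ j ∈ Finset.range (M + 1), (bump a a (M + a)).eval (j : ℚ) =
      1 / M.factorial * (scale M (2 * a) * pairConst a 0) := by
  have h := sum_bump_mul_bump (M := M) (a := a) (b := 0) (Nat.zero_le _)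
  simp only [bump_zero, eval_one, mul_one] at h
  rw [h, scale, if_pos (even_two_mul a), pairConst, mul_zero, Nat.sub_zero]
  ring

theorem bump_eval_add_one (k : ℕ) (s t x : ℚ) :
    (bump k s t).eval (x + 1) = (bump k (s + 1) (t - 1)).eval x := by
  rw [bump_eval, bump_eval, show x + 1 + s = x + (s + 1) by ring,
    show t - (x + 1) = t - 1 - x by ring]

/-- The monic multiple of the difference of `bump (b + 1) 0 t`. -/
theorem exists_bump_diff (b : ℕ) (t : ℚ) : ∃ g : ℚ[X], g.natDegree ≤ 2 * b + 1 ∧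
    g.coeff (2 * b + 1) = 1 ∧ ∀ x, g.eval x * (2 * (b + 1)) =
      (bump (b + 1) 0 t).eval (x + 1) - (bump (b + 1) 0 t).eval x := by
  obtain ⟨hd, hc⟩ := bump_coeff (b + 1) 0 t
  generalize bump (b + 1) 0 t = R at hd hc ⊢
  obtain ⟨h1, h2⟩ := diff_coeff (d := 2 * b + 1) hd
  have hne : (2 * ((b : ℚ) + 1)) ≠ 0 := by positivity
  refine ⟨C (1 / (2 * ((b : ℚ) + 1))) * (R.comp (X + C 1) - R),
    (natDegree_C_mul_le _ _).trans h1, ?_, fun x => ?_⟩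
  · rw [coeff_C_mul, h2, show 2 * b + 1 + 1 = 2 * (b + 1) by ring, hc]
    push_cast
    field_simp
    ring
  · simp only [eval_mul, eval_C, eval_sub, eval_comp, eval_add, eval_X]
    field_simp

theorem bump_diff_reflect {b : ℕ} {t : ℚ} {g : ℚ[X]} (hg : ∀ x, g.eval x * (2 * (b + 1)) =
      (bump (b + 1) 0 t).eval (x + 1) - (bump (b + 1) 0 t).eval x) (x : ℚ) :
    g.eval (t - 1 - x) = -1 * g.eval x := by
  have hne : (2 * ((b : ℚ) + 1)) ≠ 0 := by positivity
  have e1 := hg (t - 1 - x)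
  rw [show t - 1 - x + 1 = t - x by ring, show t - 1 - x = t - (x + 1) by ring,
    bump_reflect _ _ _ _ (sub_zero _), bump_reflect _ _ _ _ (sub_zero _)] at e1
  rw [show t - 1 - x = t - (x + 1) by ring]
  refine mul_right_cancel₀ hne ?_
  linear_combination e1 + hg x

theorem sum_bump_diff {b : ℕ} {t : ℚ} {g : ℚ[X]} (hg : ∀ x, g.eval x * (2 * (b + 1)) =
      (bump (b + 1) 0 t).eval (x + 1) - (bump (b + 1) 0 t).eval x) (y : ℕ) :
    (∑ x ∈ Finset.range y, g.eval (x : ℚ)) * (2 * (b + 1)) = (bump (b + 1) 0 t).eval (y : ℚ) := by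
  induction y with
  | zero => simp [bump_succ_eval_zero]
  | succ y ih =>
    rw [Finset.sum_range_succ, add_mul, ih, hg]
    push_cast; ring

/-- Monic polynomials of all degrees adapted to the pairing over a range of length `N`, used when
the number of variables is even. Those of even degree are symmetric and those of odd degree
antisymmetric under `x ↦ N - 1 - x`, so that only the pairings between the two kinds remain. The
polynomial of degree `2b + 1` is a difference of `R = bump (b + 1) 0 N`, which vanishes at both ends
of the range, and that of degree `2a` is chosen so that its values at `j` and `j - 1` have mean
`bump a a (N + a)` at `j`; the pairing of the two is then `∑ (bump a a (N + a)) R / (b + 1)`. -/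
theorem exists_adapted_even (N : ℕ) : ∃ P : ℕ → ℚ[X],
    (∀ i, (P i).natDegree ≤ i ∧ (P i).coeff i = 1) ∧
    ∀ i j, i < N → j < N → skewPairing N (fun x => (P i).eval (x : ℚ))
      (fun x => (P j).eval (x : ℚ)) = scale N i * scale N j * pairMatrix i j := by
  have hF : ∀ a : ℕ, ∃ f : ℚ[X], f.natDegree ≤ 2 * a ∧ f.coeff (2 * a) = 1 ∧
      ∀ x, f.eval x + f.eval (x + 1) = 2 * (bump a a (N + a)).eval (x + 1) := by
    intro a
    obtain ⟨hd, hc⟩ := bump_coeff a (a + 1) (N + a - 1)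
    obtain ⟨f, h1, h2, h3⟩ := exists_add_shift (2 * a) _ hd
    refine ⟨f, h1, h2.trans hc, fun x => ?_⟩
    rw [bump_eval_add_one]
    have := congrArg (eval x) h3
    simpa [eval_comp] using this
  choose F hF1 hF2 hF3 using hF
  have hFs : ∀ a x, (F a).eval ((N : ℚ) - 1 - x) = 1 * (F a).eval x := by
    intro a x
    refine reflect_of_add_shift (g := bump a (a + 1) (N + a - 1)) (fun y => ?_) (fun y => ?_) x
    · rw [hF3, bump_eval_add_one]
    · rw [one_mul, show (N : ℚ) - 1 - 1 - y = N - 2 - y by ring]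
      exact bump_reflect _ _ _ _ (by ring) _
  choose G hG1 hG2 hG3 using fun b : ℕ => exists_bump_diff b (N : ℚ)
  have hGs : ∀ b x, (G b).eval ((N : ℚ) - 1 - x) = -1 * (G b).eval x :=
    fun b => bump_diff_reflect (hG3 b)
  have hcast : ∀ x, x < N → ((N - 1 - x : ℕ) : ℚ) = N - 1 - x := fun x hx => by
    rw [Nat.cast_sub (by omega), Nat.cast_sub (by omega), Nat.cast_one]
  have hGF : ∀ a b, 2 * b + 1 < N → skewPairing N (fun x => (G b).eval (x : ℚ))
      (fun x => (F a).eval (x : ℚ)) =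
        scale N (2 * a) * scale N (2 * b + 1) * (pairConst a (b + 1) / (b + 1 : ℕ)) := by
    intro a b hb
    have hne : (2 * ((b : ℚ) + 1)) ≠ 0 := by positivity
    set R := bump (b + 1) 0 (N : ℚ) with hR
    have hR0 : R.eval 0 = 0 := bump_succ_eval_zero _ _
    have hRN : R.eval (N : ℚ) = 0 := bump_succ_eval_self _ _
    have hsum := sum_bump_diff (hG3 b)
    rw [← hR] at hsum
    refine mul_right_cancel₀ hne ?_
    rw [skewPairing_eq_sum, Finset.sum_mul]
    have h1 : ∀ y ∈ Finset.range N, (F a).eval (y : ℚ) *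
        (∑ x ∈ Finset.range y, (G b).eval (x : ℚ) + ∑ x ∈ Finset.range (y + 1), (G b).eval (x : ℚ)
          - ∑ x ∈ Finset.range N, (G b).eval (x : ℚ)) * (2 * (b + 1)) =
        (F a).eval (y : ℚ) * R.eval (y : ℚ) +
          (F a).eval ((y + 1 : ℕ) - 1 : ℚ) * R.eval ((y + 1 : ℕ) : ℚ) := by
      intro y _
      have e3 := hsum N
      rw [hRN] at e3
      rw [show (((y + 1 : ℕ) : ℚ) - 1) = y by push_cast; ring]
      linear_combination (F a).eval (y : ℚ) * (hsum y + hsum (y + 1) - e3)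
    rw [Finset.sum_congr rfl h1, Finset.sum_add_distrib]
    have h2 : ∑ y ∈ Finset.range N, (F a).eval (y : ℚ) * R.eval (y : ℚ) =
        ∑ y ∈ Finset.range (N + 1), (F a).eval (y : ℚ) * R.eval (y : ℚ) := by
      rw [Finset.sum_range_succ, hRN, mul_zero, add_zero]
    have h3 : ∑ y ∈ Finset.range N, (F a).eval ((y + 1 : ℕ) - 1 : ℚ) * R.eval ((y + 1 : ℕ) : ℚ) =
        ∑ y ∈ Finset.range (N + 1), (F a).eval ((y : ℚ) - 1) * R.eval (y : ℚ) := by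
      rw [Finset.sum_range_succ' (fun y => (F a).eval ((y : ℚ) - 1) * R.eval (y : ℚ)),
          Nat.cast_zero,
        hR0, mul_zero, add_zero]
    rw [h2, h3, ← Finset.sum_add_distrib]
    have h4 : ∀ j ∈ Finset.range (N + 1), (F a).eval (j : ℚ) * R.eval (j : ℚ) +
        (F a).eval ((j : ℚ) - 1) * R.eval (j : ℚ) =
        2 * ((bump a a (N + a)).eval (j : ℚ) * R.eval (j : ℚ)) := by
      intro j _
      have := hF3 a ((j : ℚ) - 1)
      rw [sub_add_cancel] at this
      linear_combination R.eval (j : ℚ) * this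
    rw [Finset.sum_congr rfl h4, ← Finset.mul_sum, sum_bump_mul_bump_succ hb]
    push_cast
    field_simp
  refine ⟨fun i => if Even i then F (i / 2) else G (i / 2), fun i => ?_, fun i j hi hj => ?_⟩
  · dsimp only
    rcases Nat.even_or_odd' i with ⟨a, rfl | rfl⟩
    · rw [if_pos (even_two_mul a), show 2 * a / 2 = a by omega]
      exact ⟨hF1 a, hF2 a⟩
    · rw [if_neg (Nat.not_even_iff_odd.mpr (odd_two_mul_add_one a)),
        show (2 * a + 1) / 2 = a by omega]
      exact ⟨hG1 a, hG2 a⟩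
  · have ho : ∀ a, ¬ Even (2 * a + 1) := fun a => Nat.not_even_iff_odd.mpr (odd_two_mul_add_one a)
    unfold pairMatrix
    dsimp only
    rcases Nat.even_or_odd' i with ⟨a, rfl | rfl⟩ <;> rcases Nat.even_or_odd' j with ⟨b, rfl | rfl⟩
    · simp only [if_pos (even_two_mul _), mul_zero]
      exact skewPairing_eq_zero 1 (by norm_num) (fun x hx => by rw [hcast x hx, hFs])
        (fun x hx => by rw [hcast x hx, hFs])
    · simp only [if_pos (even_two_mul _), if_neg (ho _), show 2 * a / 2 = a by omega,
        show (2 * b + 1) / 2 = b by omega]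
      rw [skewPairing_swap, hGF a b hj]
      ring
    · simp only [if_pos (even_two_mul _), if_neg (ho _), show 2 * b / 2 = b by omega,
        show (2 * a + 1) / 2 = a by omega]
      rw [hGF b a hi]
      ring
    · simp only [if_neg (ho _), mul_zero]
      exact skewPairing_eq_zero (-1) (by norm_num) (fun x hx => by rw [hcast x hx, hGs])
        (fun x hx => by rw [hcast x hx, hGs])

end Adapted

section AdaptedOdd

open Polynomial

/-- The sums of the adapted polynomials over the summation range, up to a rescaling. -/
noncomputable def sumVector (i : ℕ) : ℚ := if Even i then pairConst (i / 2) 0 else 0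

/-- The antisymmetric adapted polynomials for `exists_adapted_odd`, with their partial sums. -/
theorem exists_adapted_odd_of_odd (M b : ℕ) : ∃ f : ℚ[X], f.natDegree ≤ 2 * b + 1 ∧
    f.coeff (2 * b + 1) = 1 ∧ (∀ x, f.eval ((M : ℚ) - x) = -1 * f.eval x) ∧
    ∀ y : ℕ, (∑ x ∈ Finset.range y, f.eval (x : ℚ) + ∑ x ∈ Finset.range (y + 1), f.eval (x : ℚ)) =
      f.eval 0 + (bump (b + 1) 0 M).eval (y : ℚ) / (b + 1 : ℕ) := by
  obtain ⟨g, hg1, hg2, hg3⟩ := exists_bump_diff b (M : ℚ)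
  obtain ⟨f, h1, h2, h3⟩ := exists_add_shift (2 * b + 1) g hg1
  have h4 : ∀ x, f.eval x + f.eval (x + 1) = 2 * g.eval x := fun x => by
    have := congrArg (eval x) h3
    simpa [eval_comp] using this
  refine ⟨f, h1, h2.trans hg2, fun x => reflect_of_add_shift h4 (bump_diff_reflect hg3) x,
    fun y => ?_⟩
  have hne : ((b : ℚ) + 1) ≠ 0 := by positivity
  have h5 : ∀ y : ℕ, ∑ x ∈ Finset.range y, f.eval (x : ℚ) +
      ∑ x ∈ Finset.range (y + 1), f.eval (x : ℚ) =
        f.eval 0 + 2 * ∑ x ∈ Finset.range y, g.eval (x : ℚ) := by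
    intro y
    induction y with
    | zero => simp
    | succ y ih =>
      rw [Finset.sum_range_succ _ (y + 1), Finset.sum_range_succ _ y,
        Finset.sum_range_succ (fun x : ℕ => g.eval (x : ℚ)) y] at *
      have := h4 y
      push_cast
      linear_combination ih + this
  rw [h5, ← sum_bump_diff hg3 y]
  push_cast
  field_simp

/-- Monic polynomials of all degrees adapted to the pairing over a range of length `M + 1`, used
when the number of variables is odd. Compared with `exists_adapted_even` the mean is moved from the
symmetric to the antisymmetric polynomials. The latter have sum zero, and twice the mean of two
consecutive partial sums is `bump (b + 1) 0 M / (b + 1)` up to a constant `d`, which contributes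
only multiples of the sums of the symmetric polynomials. -/
theorem exists_adapted_odd (M : ℕ) : ∃ (P : ℕ → ℚ[X]) (d : ℕ → ℚ),
    (∀ i, (P i).natDegree ≤ i ∧ (P i).coeff i = 1) ∧
    (∀ i, ∑ x ∈ Finset.range (M + 1), (P i).eval (x : ℚ) =
      1 / M.factorial * (scale M i * sumVector i)) ∧
    ∀ i j, (Odd i → i < M) → (Odd j → j < M) →
      skewPairing (M + 1) (fun x => (P i).eval (x : ℚ)) (fun x => (P j).eval (x : ℚ)) =
        scale M i * scale M j * pairMatrix i j +
          (d i * ∑ x ∈ Finset.range (M + 1), (P j).eval (x : ℚ) -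
            (∑ x ∈ Finset.range (M + 1), (P i).eval (x : ℚ)) * d j) := by
  choose G hG1 hG2 hG3 hG4 using exists_adapted_odd_of_odd M
  set F : ℕ → ℚ[X] := fun a => bump a a (M + a) with hF
  have hF1 : ∀ a, (F a).natDegree ≤ 2 * a ∧ (F a).coeff (2 * a) = 1 := fun a => bump_coeff _ _ _
  have hFs : ∀ a x, (F a).eval ((M : ℚ) - x) = 1 * (F a).eval x := fun a x => by
    rw [one_mul]; exact bump_reflect _ _ _ _ (by ring) _
  have hcast : ∀ x, x < M + 1 → ((M + 1 - 1 - x : ℕ) : ℚ) = M - x := fun x hx => by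
    rw [Nat.add_sub_cancel, Nat.cast_sub (by omega)]
  have hGsum : ∀ b, ∑ x ∈ Finset.range (M + 1), (G b).eval (x : ℚ) = 0 := by
    intro b
    have h1 := Finset.sum_range_reflect (fun x : ℕ => (G b).eval (x : ℚ)) (M + 1)
    have h2 : ∀ x ∈ Finset.range (M + 1), (G b).eval ((M + 1 - 1 - x : ℕ) : ℚ) =
        -1 * (G b).eval (x : ℚ) := fun x hx => by
      rw [hcast x (Finset.mem_range.mp hx), hG3]
    rw [Finset.sum_congr rfl h2, ← Finset.mul_sum] at h1
    linarith
  have hGF : ∀ a b, 2 * b + 1 < M → skewPairing (M + 1) (fun x => (G b).eval (x : ℚ))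
      (fun x => (F a).eval (x : ℚ)) =
        scale M (2 * a) * scale M (2 * b + 1) * (pairConst a (b + 1) / (b + 1 : ℕ)) +
          (G b).eval 0 * ∑ x ∈ Finset.range (M + 1), (F a).eval (x : ℚ) := by
    intro a b hb
    rw [skewPairing_eq_sum, hGsum, mul_div_assoc', ← sum_bump_mul_bump_succ hb, Finset.sum_div,
      Finset.mul_sum, ← Finset.sum_add_distrib]
    refine Finset.sum_congr rfl fun y _ => ?_
    rw [hG4, sub_zero]
    ring
  have ho : ∀ a, ¬ Even (2 * a + 1) := fun a => Nat.not_even_iff_odd.mpr (odd_two_mul_add_one a)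
  have hdiv : ∀ a, 2 * a / 2 = a := fun a => by omega
  have hdiv' : ∀ a, (2 * a + 1) / 2 = a := fun a => by omega
  refine ⟨fun i => if Even i then F (i / 2) else G (i / 2),
    fun i => if Even i then 0 else (G (i / 2)).eval 0, fun i => ?_, fun i => ?_,
    fun i j hi hj => ?_⟩
  · dsimp only
    rcases Nat.even_or_odd' i with ⟨a, rfl | rfl⟩
    · rw [if_pos (even_two_mul a), hdiv]
      exact hF1 a
    · rw [if_neg (ho a), hdiv']
      exact ⟨hG1 a, hG2 a⟩
  · unfold sumVector
    dsimp only
    rcases Nat.even_or_odd' i with ⟨a, rfl | rfl⟩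
    · simp only [if_pos (even_two_mul _), hdiv]
      exact sum_bump
    · simp only [if_neg (ho _), hdiv', hGsum, mul_zero]
  · unfold pairMatrix
    dsimp only
    rcases Nat.even_or_odd' i with ⟨a, rfl | rfl⟩ <;> rcases Nat.even_or_odd' j with ⟨b, rfl | rfl⟩
    · simp only [if_pos (even_two_mul _), mul_zero, zero_mul, sub_zero, add_zero]
      exact skewPairing_eq_zero 1 (by norm_num) (fun x hx => by rw [hcast x hx, hFs])
        (fun x hx => by rw [hcast x hx, hFs])
    · simp only [if_pos (even_two_mul _), if_neg (ho _), hdiv, hdiv', hGsum]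
      rw [skewPairing_swap, hGF a b (hj (odd_two_mul_add_one b))]
      ring
    · simp only [if_pos (even_two_mul _), if_neg (ho _), hdiv, hdiv', hGsum]
      rw [hGF b a (hi (odd_two_mul_add_one a))]
      ring
    · simp only [if_neg (ho _), mul_zero, hGsum, zero_mul, sub_zero, add_zero]
      exact skewPairing_eq_zero (-1) (by norm_num) (fun x hx => by rw [hcast x hx, hG3])
        (fun x hx => by rw [hcast x hx, hG3])

/-- The determinant of a family of monic polynomials is the Vandermonde determinant. -/
theorem det_monic {n : ℕ} (P : ℕ → ℚ[X]) (hP : ∀ i, (P i).natDegree ≤ i ∧ (P i).coeff i = 1)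
    (x : Fin n → ℕ) : (Matrix.of fun i (j : Fin n) => (P j).eval (x i : ℚ)).det =
      (Matrix.vandermonde fun i => (x i : ℚ)).det := by
  have hd : ∀ i, (P i).natDegree = i := fun i =>
    natDegree_eq_of_le_of_coeff_ne_zero (hP i).1 (by rw [(hP i).2]; exact one_ne_zero)
  exact (Matrix.det_eval_matrixOfPolynomials_eq_det_vandermonde (fun i => (x i : ℚ))
    (fun j : Fin n => P j) (fun i => hd i)
    (fun i => by rw [Monic, leadingCoeff, hd, (hP i).2])).symm

/-- The sum of Vandermonde determinants as a function of `p`, for even `n`. -/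
theorem exists_sum_vandermonde_even (r : ℕ) : ∃ C : ℚ, ∀ p : ℕ,
    ∑ x ∈ increasing (2 * r) (2 * r + p), (Matrix.vandermonde fun i => (x i : ℚ)).det =
      C * ∏ i : Fin (2 * r), scale (2 * r + p) i := by
  refine ⟨topForm (2 * r) (bivector (fun i j => pairMatrix i j) ^ r) / (2 ^ r * r.factorial),
    fun p => ?_⟩
  obtain ⟨P, hP, hs⟩ := exists_adapted_even (2 * r + p)
  have h := sum_det_even (fun x (i : Fin (2 * r)) => (P i).eval (x : ℚ)) (2 * r + p)
    (fun i => scale (2 * r + p) i) (fun i j => pairMatrix i j)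
    (fun i j => hs i j (by omega) (by omega))
  simp only [det_monic P hP] at h
  rw [div_mul_eq_mul_div, eq_div_iff (by positivity)]
  linear_combination h

/-- The sum of Vandermonde determinants as a function of `p`, for odd `n`. -/
theorem exists_sum_vandermonde_odd (r : ℕ) : ∃ C : ℚ, ∀ p : ℕ,
    ∑ x ∈ increasing (2 * r + 1) (2 * r + 1 + p), (Matrix.vandermonde fun i => (x i : ℚ)).det =
      C * (1 / (2 * r + p).factorial * ∏ i : Fin (2 * r + 1), scale (2 * r + p) i) := by
  refine ⟨topForm (2 * r + 1) (ExteriorAlgebra.ι ℚ (fun i : Fin (2 * r + 1) => sumVector i) *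
    bivector (fun i j => pairMatrix i j) ^ r) / (2 ^ r * r.factorial), fun p => ?_⟩
  obtain ⟨P, d, hP, hsum, hs⟩ := exists_adapted_odd (2 * r + p)
  rw [show 2 * r + 1 + p = 2 * r + p + 1 by ring]
  have h := sum_det_odd (fun x (i : Fin (2 * r + 1)) => (P i).eval (x : ℚ)) (2 * r + p + 1)
    (fun i => scale (2 * r + p) i) (fun i => d i) (fun i => sumVector i)
    (1 / (2 * r + p).factorial) (fun i j => pairMatrix i j) (fun i => hsum i)
    (fun i j => hs i j (fun ⟨k, hk⟩ => by omega) (fun ⟨k, hk⟩ => by omega))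
  simp only [det_monic P hP] at h
  rw [div_mul_eq_mul_div, eq_div_iff (by positivity)]
  linear_combination h

end AdaptedOdd

/-! ### The product formulas for the number of patterns -/

section Products

theorem prod_scale_even (r p : ℕ) : ∏ i : Fin (2 * r), scale (2 * r + p) i =
    ∏ i ∈ Finset.range r, ((p + 2 * (2 * r) - 1 - 2 * i).factorial : ℚ) /
      (p + 2 * i).factorial := by
  rw [Fin.prod_univ_eq_prod_range (fun i => scale (2 * r + p) i), ← Finset.prod_range_reflect]
  have h : ∀ s (f : ℕ → ℚ), ∏ i ∈ Finset.range (2 * s), f i =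
      ∏ i ∈ Finset.range s, f (2 * i) * f (2 * i + 1) := by
    intro s f
    induction s with
    | zero => simp
    | succ s ih =>
      rw [Finset.prod_range_succ, ← ih, show 2 * (s + 1) = 2 * s + 1 + 1 by ring,
        Finset.prod_range_succ, Finset.prod_range_succ, mul_assoc]
  rw [h]
  refine Finset.prod_congr rfl fun i hi => ?_
  rw [Finset.mem_range] at hi
  rw [show 2 * r - 1 - 2 * i = 2 * (r - 1 - i) + 1 by omega,
    show 2 * r - 1 - (2 * i + 1) = 2 * (r - 1 - i) by omega, scale, scale,
    if_pos (even_two_mul _), if_neg (Nat.not_even_iff_odd.mpr (odd_two_mul_add_one _)),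
    show 2 * r + p - (2 * (r - 1 - i) + 1) - 1 = p + 2 * i by omega,
    show 2 * r + p + 2 * (r - 1 - i) + 1 = p + 2 * (2 * r) - 1 - 2 * i by omega]
  ring

theorem prod_scale_odd (r p : ℕ) :
    1 / (2 * r + p).factorial * ∏ i : Fin (2 * r + 1), scale (2 * r + p) i =
    ∏ i ∈ Finset.range (r + 1), ((p + 2 * (2 * r + 1) - 1 - 2 * i).factorial : ℚ) /
      (p + 2 * i).factorial := by
  rw [Fin.prod_univ_eq_prod_range (fun i => scale (2 * r + p) i),
    ← Finset.prod_range_reflect (n := r + 1)]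
  have h : ∀ s, s ≤ r → 1 / ((2 * r + p).factorial : ℚ) *
      ∏ i ∈ Finset.range (2 * s + 1), scale (2 * r + p) i =
      ∏ i ∈ Finset.range (s + 1), (scale (2 * r + p) (2 * i) / (2 * r + p - 2 * i).factorial) := by
    intro s hs
    induction s with
    | zero => simp; ring
    | succ s ih =>
      rw [Finset.prod_range_succ _ (s + 1), ← ih (by omega),
        show 2 * (s + 1) + 1 = 2 * s + 1 + 1 + 1 by ring,
        Finset.prod_range_succ, Finset.prod_range_succ, scale.eq_def _ (2 * s + 1),
        if_neg (Nat.not_even_iff_odd.mpr (odd_two_mul_add_one _)),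
        show 2 * r + p - (2 * s + 1) - 1 = 2 * r + p - 2 * (s + 1) by omega]
      rw [show 2 * s + 1 + 1 = 2 * (s + 1) by ring]
      ring
  rw [h r le_rfl]
  refine Finset.prod_congr rfl fun i hi => ?_
  rw [Finset.mem_range] at hi
  rw [scale, if_pos (even_two_mul _),
    show 2 * r + p + 2 * i + 1 = p + 2 * (2 * r + 1) - 1 - 2 * (r + 1 - 1 - i) by omega,
    show 2 * r + p - 2 * i = p + 2 * (r + 1 - 1 - i) by omega]

/-- The product to which, for fixed `n`, the number of patterns is proportional. -/
noncomputable def countProd (n p : ℕ) : ℚ :=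
  ∏ i ∈ Finset.range ((n + 1) / 2),
    ((p + 2 * n - 1 - 2 * i).factorial : ℚ) / (p + 2 * i).factorial

theorem card_GZPattern_eq_div (n p : ℕ) :
    (Fintype.card (GZPattern n p) : ℚ) = countProd n p / countProd n 0 := by
  have h : ∃ C : ℚ, ∀ p : ℕ, (Fintype.card (GZPattern n p) : ℚ) = C * countProd n p := by
    have h1 : ∃ C : ℚ, ∀ p : ℕ,
        ∑ x ∈ increasing n (n + p), (Matrix.vandermonde fun i => (x i : ℚ)).det =
          C * countProd n p := by
      rcases Nat.even_or_odd' n with ⟨r, rfl | rfl⟩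
      · obtain ⟨C, hC⟩ := exists_sum_vandermonde_even r
        refine ⟨C, fun p => ?_⟩
        rw [hC, prod_scale_even, countProd, show (2 * r + 1) / 2 = r by omega]
      · obtain ⟨C, hC⟩ := exists_sum_vandermonde_odd r
        refine ⟨C, fun p => ?_⟩
        rw [hC, prod_scale_odd, countProd, show (2 * r + 1 + 1) / 2 = r + 1 by omega]
    obtain ⟨C, hC⟩ := h1
    have hne : (∏ i : Fin n, ((i : ℕ).factorial : ℚ)) ≠ 0 :=
      Finset.prod_ne_zero_iff.mpr fun i _ => by positivity
    refine ⟨C / ∏ i : Fin n, ((i : ℕ).factorial : ℚ), fun p => ?_⟩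
    rw [div_mul_eq_mul_div, eq_div_iff hne, ← hC, ← card_GZPattern_mul, mul_comm]
  obtain ⟨C, hC⟩ := h
  have h0 := hC 0
  rw [card_GZPattern_zero, Nat.cast_one] at h0
  -- the constant is nonzero because there is a pattern for `p = 0`
  have hne : countProd n 0 ≠ 0 := fun h => by rw [h, mul_zero] at h0; exact one_ne_zero h0
  rw [hC p, eq_div_iff hne]
  linear_combination countProd n p * (-h0)

/-- `countProd` as the numerator of the product over pairs, by induction on `n`: from `n` to `n + 1`
both sides are multiplied by `(p + 2n + 1)! / (p + n)!`. -/
theorem countProd_eq_prod (n p : ℕ) : countProd n p =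
    ∏ k ∈ Finset.range n, ∏ j ∈ Finset.range (k + 1), ((p : ℚ) + 1 + j + k) := by
  have hasc : ∀ m k : ℕ, ∏ j ∈ Finset.range k, ((m : ℚ) + 1 + j) = (m +
      k).factorial / m.factorial := by
    intro m k
    induction k with
    | zero => simp [Nat.factorial_ne_zero]
    | succ k ih =>
      rw [Finset.prod_range_succ, ih, ← add_assoc, Nat.factorial_succ]
      push_cast
      ring
  induction n with
  | zero => simp [countProd]
  | succ n ih =>
    have h1 : ∏ j ∈ Finset.range (n + 1), ((p : ℚ) + 1 + j + n) =
        (p + 2 * n + 1).factorial / (p + n).factorial := by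
      rw [show p + 2 * n + 1 = p + n + (n + 1) by ring, ← hasc]
      refine Finset.prod_congr rfl fun j _ => ?_
      push_cast; ring
    rw [Finset.prod_range_succ, ← ih, h1]
    -- the numerators for `n + 1` are those for `n` shifted by one place; the parity of `n` decides
    -- whether the number of factors grows
    have hf : ∀ m : ℕ, (m.factorial : ℚ) ≠ 0 := fun m => by positivity
    unfold countProd
    rcases Nat.even_or_odd' n with ⟨r, rfl | rfl⟩
    · rw [show (2 * r + 1 + 1) / 2 = r + 1 by omega, show (2 * r + 1) / 2 = r by omega,
        Finset.prod_div_distrib, Finset.prod_div_distrib, Finset.prod_range_succ',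
        Finset.prod_range_succ (fun i => ((p + 2 * i).factorial : ℚ))]
      have : ∀ i ∈ Finset.range r, ((p + 2 * (2 * r + 1) - 1 - 2 * (i + 1)).factorial : ℚ) =
          (p + 2 * (2 * r) - 1 - 2 * i).factorial := fun i _ => by
        congr 2; omega
      rw [Finset.prod_congr rfl this,
        show p + 2 * (2 * r + 1) - 1 - 2 * 0 = p + 2 * (2 * r) + 1 by omega, div_mul_div_comm]
    · rw [show (2 * r + 1 + 1 + 1) / 2 = r + 1 by omega, show (2 * r + 1 + 1) / 2 = r + 1 by omega,
        Finset.prod_div_distrib, Finset.prod_div_distrib, Finset.prod_range_succ',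
        Finset.prod_range_succ (fun i => ((p + 2 * (2 * r + 1) - 1 - 2 * i).factorial : ℚ))]
      have : ∀ i ∈ Finset.range r, ((p + 2 * (2 * r + 1 + 1) - 1 - 2 * (i + 1)).factorial : ℚ) =
          (p + 2 * (2 * r + 1) - 1 - 2 * i).factorial := fun i _ => by
        congr 2; omega
      rw [Finset.prod_congr rfl this,
        show p + 2 * (2 * r + 1 + 1) - 1 - 2 * 0 = p + 2 * (2 * r + 1) + 1 by omega,
        show p + 2 * (2 * r + 1) - 1 - 2 * r = p + (2 * r + 1) by omega, div_mul_div_comm,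
        mul_right_comm, mul_div_mul_right _ _ (hf _)]

theorem card_GZPattern_first (n p : ℕ) : (Fintype.card (GZPattern n p) : ℚ) =
      ∏ j ∈ Finset.Icc 1 n, ∏ k ∈ Finset.Icc j n,
        ((p : ℚ) + 1 + 2 * n - j - k) / (1 + 2 * n - j - k) := by
  rw [card_GZPattern_eq_div, countProd_eq_prod, countProd_eq_prod, ← Finset.prod_div_distrib]
  simp only [← Finset.prod_div_distrib]
  -- the substitution `j ↦ n - k`, `k ↦ n - j`
  rw [Finset.prod_sigma', Finset.prod_sigma']
  refine Finset.prod_bij' (fun x _ => ⟨n - x.1, n - x.2⟩) (fun x _ => ⟨n - x.1, n -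
      x.2⟩) ?_ ?_ ?_ ?_ ?_
  · rintro ⟨k, j⟩ h
    simp only [Finset.mem_sigma, Finset.mem_range, Finset.mem_Icc] at h ⊢
    omega
  · rintro ⟨k, j⟩ h
    simp only [Finset.mem_sigma, Finset.mem_range, Finset.mem_Icc] at h ⊢
    omega
  · rintro ⟨k, j⟩ h
    simp only [Finset.mem_sigma, Finset.mem_range] at h
    simp only [Sigma.mk.injEq, heq_eq_eq]
    omega
  · rintro ⟨k, j⟩ h
    simp only [Finset.mem_sigma, Finset.mem_Icc] at h
    simp only [Sigma.mk.injEq, heq_eq_eq]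
    omega
  · rintro ⟨k, j⟩ h
    simp only [Finset.mem_sigma, Finset.mem_range] at h
    dsimp only
    rw [Nat.cast_sub (by omega), Nat.cast_sub (by omega), Nat.cast_zero]
    congr 1 <;> ring

theorem card_GZPattern_second (n p : ℕ) (hn : 0 < n) : (Fintype.card (GZPattern n p) : ℚ) =
      ∏ i ∈ Finset.range ((n - 1) / 2 + 1),
        ((p + 2 * n - 2 * i - 1).choose (2 * n - 4 * i - 1) : ℚ) /
          ((2 * n - 2 * i - 1).choose (2 * n - 4 * i - 1) : ℚ) := by
  rw [card_GZPattern_eq_div, countProd, countProd, ← Finset.prod_div_distrib,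
    show (n + 1) / 2 = (n - 1) / 2 + 1 by omega]
  refine Finset.prod_congr rfl fun i hi => ?_
  rw [Finset.mem_range] at hi
  have hf : ∀ m : ℕ, (m.factorial : ℚ) ≠ 0 := fun m => by positivity
  rw [Nat.cast_choose ℚ (by omega), Nat.cast_choose ℚ (by omega),
    show p + 2 * n - 2 * i - 1 - (2 * n - 4 * i - 1) = p + 2 * i by omega,
    show 2 * n - 2 * i - 1 - (2 * n - 4 * i - 1) = 0 + 2 * i by omega,
    show p + 2 * n - 1 - 2 * i = p + 2 * n - 2 * i - 1 by omega,
    show 0 + 2 * n - 1 - 2 * i = 2 * n - 2 * i - 1 by omega]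
  have h1 := hf (2 * n - 4 * i - 1)
  have h2 := hf (p + 2 * i)
  have h3 := hf (0 + 2 * i)
  have h4 := hf (2 * n - 2 * i - 1)
  field_simp

end Products
end Parafermion

theorem mainTheorem1 (n p : ℕ) (hn : 0 < n) (hp : 0 < p) :
    -- existence of the parafermion Fock space of order `p`
    (∃ (W : Type) (_ : NormedAddCommGroup W) (_ : InnerProductSpace ℂ W) (_ : CompleteSpace W)
      (f : Fin n → ℤˣ → Module.End ℂ W) (vac : W), IsFockSpace n p W f vac) ∧
    -- its structure
    ∀ (W : Type*) [NormedAddCommGroup W] [InnerProductSpace ℂ W]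
      (f : Fin n → ℤˣ → Module.End ℂ W) (vac : W), IsFockSpace n p W f vac →
    -- the vacuum vector is unique up to scalars
    (∀ v : W, (∀ j, f j (-1) v = 0) → ∃ c : ℂ, v = c • vac) ∧
    -- the dimension formulas
    ((Module.finrank ℂ W : ℚ) =
      ∏ j ∈ Finset.Icc 1 n, ∏ k ∈ Finset.Icc j n,
        ((p : ℚ) + 1 + 2 * n - j - k) / (1 + 2 * n - j - k)) ∧
    ((Module.finrank ℂ W : ℚ) =
      ∏ i ∈ Finset.range ((n - 1) / 2 + 1),
        ((p + 2 * n - 2 * i - 1).choose (2 * n - 4 * i - 1) : ℚ) /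
          ((2 * n - 2 * i - 1).choose (2 * n - 4 * i - 1) : ℚ)) ∧
    ∃ (ρ : so n →ₗ⁅ℂ⁆ Module.End ℂ W) (e : OrthonormalBasis (GZPattern n p) ℂ W),
      -- `W` is the irreducible `so(2n+1)`-module of highest weight `(p/2, …, p/2)`
      (∀ j ξ, ρ (paraElt j ξ) = f j ξ) ∧
      IsIrreducibleRep ρ ∧
      (∃ v, IsHighestWeightVector ρ (fun _ => (p : ℂ) / 2) v) ∧
      -- the vacuum is the basis vector of the zero pattern
      e (GZPattern.zero n p) = vac ∧
      -- the action of the Cartan elements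
      (∀ (k : Fin n) (m : GZPattern n p),
        ρ (cartan k) (e m) =
          (-(p : ℂ) / 2 + ∑ j ∈ Finset.Icc 1 ((k : ℕ) + 1), (m.1 j ((k : ℕ) + 1) : ℂ)
            - ∑ j ∈ Finset.Icc 1 (k : ℕ), (m.1 j (k : ℕ) : ℂ)) • e m) ∧
      -- the action of `f_n^+` and `f_n^-`
      (∀ (j : Fin n) (m : GZPattern n p), (j : ℕ) + 1 = n →
        f j 1 (e m) = ∑ i ∈ Finset.Icc 1 n,
          ((raiseLastCoeff n p m.1 i : ℝ) : ℂ) • ket e (shiftOne m.1 1 i n)) ∧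
      (∀ (j : Fin n) (m : GZPattern n p), (j : ℕ) + 1 = n →
        f j (-1) (e m) = ∑ i ∈ Finset.Icc 1 n,
          ((lowerLastCoeff n p m.1 i : ℝ) : ℂ) • ket e (shiftOne m.1 (-1) i n)) ∧
      -- the action of `f_j^+` and `f_j^-` in general
      (∀ (j : Fin n) (m : GZPattern n p),
        f j 1 (e m) = ∑ i : RowPath ((j : ℕ) + 1) n,
          ((raiseCoeff p m.1 i : ℝ) : ℂ) • ket e (shiftPath m.1 1 i)) ∧
      (∀ (j : Fin n) (m : GZPattern n p),
        f j (-1) (e m) = ∑ i : RowPath ((j : ℕ) + 1) n,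
          ((lowerCoeff p m.1 i : ℝ) : ℂ) • ket e (shiftPath m.1 (-1) i)) := by
  refine ⟨?_, ?_⟩
  · exact ⟨EuclideanSpace ℂ (GZPattern n p), inferInstance, inferInstance, inferInstance, _, _,
      isFockSpace_model (EuclideanSpace.basisFun (GZPattern n p) ℂ)⟩
  · intro W _ _ f vac h
    obtain ⟨ht, e, rfl, rfl⟩ := h.exists_basis
    have hdim : Module.finrank ℂ W = Fintype.card (GZPattern n p) :=
      Module.finrank_eq_card_basis e.toBasis
    refine ⟨fun v hv => h.vacuum_unique ht hv, ?_, ?_, (isFockSpace_model e).rep, e,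
      IsFockSpace.rep_paraElt _, isIrreducibleRep_model e, ⟨_, isHighestWeightVector_full e⟩, rfl,
      ?_, modelOp_one_basis_last e, modelOp_neg_one_basis_last e, modelOp_one_basis e,
      modelOp_neg_one_basis e⟩
    · rw [hdim, card_GZPattern_first n p]
    · rw [hdim, card_GZPattern_second n p hn]
    · intro k m
      rw [rep_cartan_basis]
      unfold weightVal
      push_cast
      rfl
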